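/- Let $k$ be a field, let $C$ and $C'$ be cocommutative cosemisimple $k$-coalgebras (each is a direct sum of simple subcoalgebras), and let $f : C' \to C$ be a morphism of coalgebras. Notation. $\mathrm{Coalg}\,C$ is the category of cocommutative $k$-coalgebras $D$ equipped with a coalgebra map $\varphi : D \to C$ (the slice category over $C$), with its cartesian structure given by fibre products over $C$. $\mathrm{Vec}^C$ is the category of (right) $C$-comodules, symmetric monoidal under the cotensor product $V\otimes^C W\subseteq V\otimes W$, with unit $C$. $U^C : \mathrm{Coalg}\,C \to \mathrm{Vec}^C$ sends $\varphi : D\to C$ to $D$ with coaction $(\mathrm{id}\otimes\varphi)\Delta$. $L_f : \mathrm{Coalg}\,C\to\mathrm{Coalg}\,C'$ is the pullback along $f$ in the category of cocommutative coalgebras, and $K_f = f^* : \mathrm{Vec}^C\to\mathrm{Vec}^{C'}$ is $f^*V = V\otimes^C C'\subseteq V\otimes C'$, where $C'$ has the left $C$-coaction $(f\otimes\mathrm{id})\Delta$, with $C'$-coaction $\mathrm{id}\otimes\Delta$. A *linear-non-linear (LNL) adjunction* is a symmetric monoidal adjunction $U\dashv R$ (both functors lax symmetric monoidal, unit and counit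 monoidal) between a cartesian category, the source of $U$, and a symmetric monoidal closed category, the target of $U$. Proposition. The functor $U^C$ is the left adjoint of an LNL adjunction, and so is $U^{C'}$. For all LNL adjunctions $U^C\dashv R^C$ and $U^{C'}\dashv R^{C'}$ on these functors (any choice of adjoints, internal homs and monoidal structures), with units $\eta$ and $\eta'$, the pair $(L_f,K_f)$ is a morphism of LNL adjunctions; that is: 1. $L_f$ is cartesian (preserves finite products). 2. $K_f$ is strong symmetric monoidal, with structure isomorphisms $K_fV\otimes^{C'}K_fW\to K_f(V\otimes^C W)$ induced by $v\otimes c\otimes w\otimes c'\mapsto v\otimes w\otimes\varepsilon(c)c'$ and $C'\to K_fC$ given by $(f\otimes\mathrm{id})\Delta$; and it is closed: for this structure, the canonical map $K_f[V,W]\to[K_fV,K_fW]$ is an isomorphism for all $V,W$. 3. There is a natural isomorphism $\alpha : K_fU^C\cong U^{C'}L_f$ whose inverse, at $\varphi:D\to C$ with pullback $X$ and projections $p:X\to D$, $q:X\to C'$, is the map $X\to D\otimes^C C'$ given by $(p\otimes q)\Delta_X$. 4. There is a natural isomorphism $\beta : L_fR^C\cong R^{C'}K_f$ such that the units are compatible: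 for every object $X$ of $\mathrm{Coalg}\,C$, $$R^{C'}(\alpha_X)\circ\beta_{U^CX}\circ L_f(\eta_X)=\eta'_{L_fX}.$$ -/

import Mathlib

open CategoryTheory CategoryTheory.Limits MonoidalCategory
open scoped TensorProduct

universe u

noncomputable section

namespace ComodLNL

section Lift

variable {k : Type u} [Field k]

/-- The factorization of a linear map through an injective linear map. -/
def factorThrough {K M Z : Type u} [AddCommMonoid K] [Module k K] [AddCommMonoid M] [Module k M]
    [AddCommMonoid Z] [Module k Z] (i : K →ₗ[k] M) (hi : Function.Injective i) (g : Z →ₗ[k] M)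
    (hg : ∀ z, g z ∈ LinearMap.range i) : Z →ₗ[k] K :=
  (LinearEquiv.ofInjective i hi).symm.toLinearMap ∘ₗ g.codRestrict (LinearMap.range i) hg

lemma factorThrough_apply {K M Z : Type u} [AddCommMonoid K] [Module k K] [AddCommMonoid M]
    [Module k M] [AddCommMonoid Z] [Module k Z] (i : K →ₗ[k] M) (hi : Function.Injective i)
    (g : Z →ₗ[k] M) (hg : ∀ z, g z ∈ LinearMap.range i) (z : Z) :
    i (factorThrough i hi g hg z) = g z :=
  congrArg Subtype.val ((LinearEquiv.ofInjective i hi).apply_symm_apply ⟨g z, hg z⟩)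

lemma comp_factorThrough {K M Z : Type u} [AddCommMonoid K] [Module k K] [AddCommMonoid M]
    [Module k M] [AddCommMonoid Z] [Module k Z] (i : K →ₗ[k] M) (hi : Function.Injective i)
    (g : Z →ₗ[k] M) (hg : ∀ z, g z ∈ LinearMap.range i) :
    i ∘ₗ factorThrough i hi g hg = g :=
  LinearMap.ext (factorThrough_apply i hi g hg)

lemma map_injective {A B A' B' : Type u} [AddCommGroup A] [Module k A] [AddCommGroup B] [Module k B]
    [AddCommGroup A'] [Module k A'] [AddCommGroup B'] [Module k B'] {f : A →ₗ[k] B}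
    {g : A' →ₗ[k] B'} (hf : Function.Injective f) (hg : Function.Injective g) :
    Function.Injective (TensorProduct.map f g) := by
  have : TensorProduct.map f g = g.lTensor B ∘ₗ f.rTensor A' := by
    ext; simp
  rw [this, LinearMap.coe_comp]
  exact (Module.Flat.lTensor_preserves_injective_linearMap _ hg).comp
    (Module.Flat.rTensor_preserves_injective_linearMap _ hf)

end Lift

section Subcoalgebra

variable {k : Type u} [Field k] {M : Type u} [AddCommGroup M] [Module k M] [Coalgebra k M]

/-- A subcoalgebra: a subspace `S` with `Δ(S) ⊆ S ⊗ S`. -/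
def IsSubcoalgebra (S : Submodule k M) : Prop :=
  ∀ x ∈ S, Coalgebra.comul (R := k) x ∈ LinearMap.range (TensorProduct.map S.subtype S.subtype)

lemma subtype_tensor_injective (S : Submodule k M) :
    Function.Injective (TensorProduct.map S.subtype S.subtype) :=
  map_injective S.injective_subtype S.injective_subtype

/-- The comultiplication of a subcoalgebra. -/
def subComul {S : Submodule k M} (hS : IsSubcoalgebra S) : S →ₗ[k] S ⊗[k] S :=
  factorThrough (TensorProduct.map S.subtype S.subtype) (subtype_tensor_injective S)
    (Coalgebra.comul ∘ₗ S.subtype) (fun x => hS x.1 x.2)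

lemma map_subComul {S : Submodule k M} (hS : IsSubcoalgebra S) :
    TensorProduct.map S.subtype S.subtype ∘ₗ subComul hS = Coalgebra.comul ∘ₗ S.subtype :=
  comp_factorThrough _ _ _ _

lemma map_subComul_apply {S : Submodule k M} (hS : IsSubcoalgebra S) (x : S) :
    TensorProduct.map S.subtype S.subtype (subComul hS x) = Coalgebra.comul (x : M) :=
  factorThrough_apply _ _ _ _ x

/-- The coalgebra structure of a subcoalgebra. -/
@[reducible] def subCoalgebra {S : Submodule k M} (hS : IsSubcoalgebra S) : Coalgebra k S where
  comul := subComul hS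
  counit := Coalgebra.counit ∘ₗ S.subtype
  coassoc := by
    have hinj := map_injective S.injective_subtype (subtype_tensor_injective S)
    apply LinearMap.ext
    intro x
    apply hinj
    have e1 : TensorProduct.map S.subtype (TensorProduct.map S.subtype S.subtype) ∘ₗ
        (TensorProduct.assoc k S S S).toLinearMap ∘ₗ (subComul hS).rTensor S =
        (TensorProduct.assoc k M M M).toLinearMap ∘ₗ
          (Coalgebra.comul (R := k) (A := M)).rTensor M ∘ₗ
          TensorProduct.map S.subtype S.subtype := by
      ext a b
      simp [← map_subComul_apply hS a]
      generalize subComul hS a = y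
      induction y using TensorProduct.induction_on with
      | zero => simp
      | tmul p q => simp
      | add p q hp hq => simp [TensorProduct.add_tmul, hp, hq]
    have e2 : TensorProduct.map S.subtype (TensorProduct.map S.subtype S.subtype) ∘ₗ
        (subComul hS).lTensor S =
          (Coalgebra.comul (R := k) (A := M)).lTensor M ∘ₗ
          TensorProduct.map S.subtype S.subtype := by
      ext a b
      simp [map_subComul_apply hS b]
    have h1 := LinearMap.congr_fun e1 (subComul hS x)
    have h2 := LinearMap.congr_fun e2 (subComul hS x)
    simp only [LinearMap.comp_apply, map_subComul_apply] at h1 h2 ⊢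
    rw [h1, h2]
    exact Coalgebra.coassoc_apply (x : M)
  rTensor_counit_comp_comul := by
    apply LinearMap.ext
    intro x
    apply Module.Flat.lTensor_preserves_injective_linearMap (M := k) S.subtype S.injective_subtype
    have e : S.subtype.lTensor k ∘ₗ (Coalgebra.counit ∘ₗ S.subtype).rTensor S =
        (Coalgebra.counit (R := k) (A := M)).rTensor M ∘ₗ
          TensorProduct.map S.subtype S.subtype := by
      ext a b
      simp
    have h := LinearMap.congr_fun e (subComul hS x)
    simp only [LinearMap.comp_apply, map_subComul_apply] at h ⊢
    rw [h]
    simp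
  lTensor_counit_comp_comul := by
    apply LinearMap.ext
    intro x
    apply Module.Flat.rTensor_preserves_injective_linearMap (M := k) S.subtype S.injective_subtype
    have e : S.subtype.rTensor k ∘ₗ (Coalgebra.counit ∘ₗ S.subtype).lTensor S =
        (Coalgebra.counit (R := k) (A := M)).lTensor M ∘ₗ
          TensorProduct.map S.subtype S.subtype := by
      ext a b
      simp
    have h := LinearMap.congr_fun e (subComul hS x)
    simp only [LinearMap.comp_apply, map_subComul_apply] at h ⊢
    rw [h]
    simp

lemma subCoalgebra_isCocomm {S : Submodule k M} (hS : IsSubcoalgebra S)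
    [Coalgebra.IsCocomm k M] :
    let _ := subCoalgebra hS
    Coalgebra.IsCocomm k S := by
  let _ := subCoalgebra hS
  refine ⟨?_⟩
  apply LinearMap.ext
  intro x
  apply subtype_tensor_injective S
  have e : TensorProduct.map S.subtype S.subtype ∘ₗ (TensorProduct.comm k S S).toLinearMap =
      (TensorProduct.comm k M M).toLinearMap ∘ₗ TensorProduct.map S.subtype S.subtype := by
    ext a b
    simp
  have h := LinearMap.congr_fun e (subComul hS x)
  change TensorProduct.map S.subtype S.subtype
    ((TensorProduct.comm k S S).toLinearMap (subComul hS x)) =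
    TensorProduct.map S.subtype S.subtype (subComul hS x)
  simp only [LinearMap.comp_apply] at h
  rw [h, map_subComul_apply]
  exact Coalgebra.comm_comul k (x : M)

lemma isSubcoalgebra_sSup (s : Set (Submodule k M)) (hs : ∀ S ∈ s, IsSubcoalgebra S) :
    IsSubcoalgebra (sSup s) := by
  intro x hx
  have : sSup s ≤ Submodule.comap (Coalgebra.comul (R := k) (A := M))
      (LinearMap.range (TensorProduct.map (sSup s).subtype (sSup s).subtype)) := by
    refine sSup_le fun S hS y hy => ?_
    obtain ⟨z, hz⟩ := hs S hS y hy
    refine ⟨TensorProduct.map (Submodule.inclusion (le_sSup hS))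
      (Submodule.inclusion (le_sSup hS)) z, ?_⟩
    rw [← hz, ← LinearMap.comp_apply, ← TensorProduct.map_comp]
    rfl
  exact this hx

lemma isSubcoalgebra_range {N : Type u} [AddCommGroup N] [Module k N] [Coalgebra k N]
    (f : N →ₗc[k] M) : IsSubcoalgebra (LinearMap.range (f : N →ₗ[k] M)) := by
  rintro _ ⟨y, rfl⟩
  refine ⟨TensorProduct.map (f : N →ₗ[k] M).rangeRestrict (f : N →ₗ[k] M).rangeRestrict
    (Coalgebra.comul y), ?_⟩
  rw [← LinearMap.comp_apply, ← TensorProduct.map_comp]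
  exact CoalgHomClass.map_comp_comul_apply f y

lemma codRestrict_comul {N : Type u} [AddCommGroup N] [Module k N] [Coalgebra k N]
    {S : Submodule k M} (hS : IsSubcoalgebra S) (f : N →ₗc[k] M) (hf : ∀ x, f x ∈ S) :
    TensorProduct.map ((f : N →ₗ[k] M).codRestrict S hf) ((f : N →ₗ[k] M).codRestrict S hf) ∘ₗ
      Coalgebra.comul = subComul hS ∘ₗ (f : N →ₗ[k] M).codRestrict S hf := by
  apply LinearMap.ext
  intro x
  apply subtype_tensor_injective S
  rw [LinearMap.comp_apply, LinearMap.comp_apply, map_subComul_apply, ← LinearMap.comp_apply,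
    ← TensorProduct.map_comp]
  exact CoalgHomClass.map_comp_comul_apply f x

/-- A simple coalgebra: it is nonzero and its only subcoalgebras are `0` and itself;
here for a subcoalgebra `S` of `M`. -/
def IsSimpleSubcoalgebra (S : Submodule k M) : Prop :=
  IsSubcoalgebra S ∧ S ≠ ⊥ ∧ ∀ T : Submodule k M, IsSubcoalgebra T → T ≤ S → T = ⊥ ∨ T = S

variable (k M) in
/-- A coalgebra is cosemisimple if it is the (internal) direct sum of simple subcoalgebras. -/
def IsCosemisimple : Prop :=
  ∃ (I : Type u) (_ : DecidableEq I) (S : I → Submodule k M),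
    (∀ i, IsSimpleSubcoalgebra (S i)) ∧ DirectSum.IsInternal S

end Subcoalgebra

section Coalg

variable (k : Type u) [Field k]

/-- The category of cocommutative `k`-coalgebras and coalgebra morphisms. -/
abbrev Coalg : Type (u + 1) :=
  ObjectProperty.FullSubcategory (fun C : CoalgCat.{u} k => Coalgebra.IsCocomm k C)

variable {k}

instance (C : Coalg k) : Coalgebra.IsCocomm k C.obj := C.property

/-- A cocommutative coalgebra as an object of the category of cocommutative coalgebras. -/
abbrev Coalg.of (M : Type u) [AddCommGroup M] [Module k M] [Coalgebra k M]
    [h : Coalgebra.IsCocomm k M] : Coalg k :=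
  ⟨CoalgCat.of k M, h⟩

/-- The coalgebra map underlying a morphism of `Coalg k`. -/
abbrev Coalg.toHom {C D : Coalg k} (f : C ⟶ D) : C.obj →ₗc[k] D.obj := f.hom.toCoalgHom

/-- A coalgebra map as a morphism of `Coalg k`. -/
abbrev Coalg.ofHom {C D : Coalg k} (f : C.obj →ₗc[k] D.obj) : C ⟶ D := ⟨⟨f⟩⟩

lemma Coalg.hom_ext {C D : Coalg k} {f g : C ⟶ D}
    (h : ∀ x, Coalg.toHom f x = Coalg.toHom g x) : f = g := by
  apply ObjectProperty.hom_ext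
  apply CoalgCat.hom_ext
  exact CoalgHom.ext h


/-- The first projection of the product coalgebra `C ⊗ D`, i.e. `id ⊗ ε`. -/
def prodFst (C D : Coalg k) : Coalg.of (C.obj ⊗[k] D.obj) ⟶ C :=
  Coalg.ofHom (CoalgHom.comp (Coalgebra.TensorProduct.rid k k C.obj).toCoalgHom
    (Coalgebra.TensorProduct.map (CoalgHom.id k C.obj) (Coalgebra.counitCoalgHom k D.obj)))

/-- The second projection of the product coalgebra `C ⊗ D`, i.e. `ε ⊗ id`. -/
def prodSnd (C D : Coalg k) : Coalg.of (C.obj ⊗[k] D.obj) ⟶ D :=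
  Coalg.ofHom (CoalgHom.comp (Coalgebra.TensorProduct.lid k D.obj).toCoalgHom
    (Coalgebra.TensorProduct.map (Coalgebra.counitCoalgHom k C.obj) (CoalgHom.id k D.obj)))

/-- The pairing `(f ⊗ g) ∘ Δ` of two coalgebra maps with cocommutative source. -/
def prodLift {C D E : Coalg k} (f : E ⟶ C) (g : E ⟶ D) : E ⟶ Coalg.of (C.obj ⊗[k] D.obj) :=
  Coalg.ofHom (CoalgHom.comp (Coalgebra.TensorProduct.map (Coalg.toHom f) (Coalg.toHom g))
    (Coalgebra.comulCoalgHom k E.obj))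

lemma prodLift_apply {C D E : Coalg k} (f : E ⟶ C) (g : E ⟶ D) (x : E.obj) :
    Coalg.toHom (prodLift f g) x = TensorProduct.map (Coalg.toHom f : E.obj →ₗ[k] C.obj)
      (Coalg.toHom g : E.obj →ₗ[k] D.obj) (Coalgebra.comul x) := rfl

lemma prodFst_apply (C D : Coalg k) (x : C.obj ⊗[k] D.obj) :
    Coalg.toHom (prodFst C D) x =
      TensorProduct.rid k C.obj ((Coalgebra.counit (R := k) (A := D.obj)).lTensor C.obj x) := rfl

lemma prodSnd_apply (C D : Coalg k) (x : C.obj ⊗[k] D.obj) :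
    Coalg.toHom (prodSnd C D) x =
      TensorProduct.lid k D.obj ((Coalgebra.counit (R := k) (A := C.obj)).rTensor D.obj x) := rfl

lemma prodFst_tmul (C D : Coalg k) (c : C.obj) (d : D.obj) :
    Coalg.toHom (prodFst C D) (c ⊗ₜ[k] d) = Coalgebra.counit (R := k) d • c := by
  rw [prodFst_apply]
  simp

lemma prodSnd_tmul (C D : Coalg k) (c : C.obj) (d : D.obj) :
    Coalg.toHom (prodSnd C D) (c ⊗ₜ[k] d) = Coalgebra.counit (R := k) c • d := by
  rw [prodSnd_apply]
  simp

lemma prodLift_fst {C D E : Coalg k} (f : E ⟶ C) (g : E ⟶ D) :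
    prodLift f g ≫ prodFst C D = f := by
  apply Coalg.hom_ext
  intro x
  change Coalg.toHom (prodFst C D) (Coalg.toHom (prodLift f g) x) = _
  rw [prodFst_apply, prodLift_apply]
  have e : (Coalgebra.counit (R := k) (A := D.obj)).lTensor C.obj ∘ₗ
      TensorProduct.map (Coalg.toHom f : E.obj →ₗ[k] C.obj) (Coalg.toHom g : E.obj →ₗ[k] D.obj) =
      TensorProduct.map (Coalg.toHom f : E.obj →ₗ[k] C.obj) LinearMap.id ∘ₗ
        (Coalgebra.counit (R := k) (A := E.obj)).lTensor E.obj := by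
    ext a b
    simp
  have h := LinearMap.congr_fun e (Coalgebra.comul x)
  simp only [LinearMap.comp_apply] at h
  rw [h]
  simp

lemma prodLift_snd {C D E : Coalg k} (f : E ⟶ C) (g : E ⟶ D) :
    prodLift f g ≫ prodSnd C D = g := by
  apply Coalg.hom_ext
  intro x
  change Coalg.toHom (prodSnd C D) (Coalg.toHom (prodLift f g) x) = _
  rw [prodSnd_apply, prodLift_apply]
  have e : (Coalgebra.counit (R := k) (A := C.obj)).rTensor D.obj ∘ₗ
      TensorProduct.map (Coalg.toHom f : E.obj →ₗ[k] C.obj) (Coalg.toHom g : E.obj →ₗ[k] D.obj) =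
      TensorProduct.map LinearMap.id (Coalg.toHom g : E.obj →ₗ[k] D.obj) ∘ₗ
        (Coalgebra.counit (R := k) (A := E.obj)).rTensor E.obj := by
    ext a b
    simp
  have h := LinearMap.congr_fun e (Coalgebra.comul x)
  simp only [LinearMap.comp_apply] at h
  rw [h]
  simp

lemma prodLift_eta {C D E : Coalg k} (m : E ⟶ Coalg.of (C.obj ⊗[k] D.obj)) :
    prodLift (m ≫ prodFst C D) (m ≫ prodSnd C D) = m := by
  apply Coalg.hom_ext
  intro x
  rw [prodLift_apply]
  have e : TensorProduct.map (Coalg.toHom (m ≫ prodFst C D) : E.obj →ₗ[k] C.obj)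
      (Coalg.toHom (m ≫ prodSnd C D) : E.obj →ₗ[k] D.obj) =
      TensorProduct.map (Coalg.toHom (prodFst C D) : C.obj ⊗[k] D.obj →ₗ[k] C.obj)
        (Coalg.toHom (prodSnd C D) : C.obj ⊗[k] D.obj →ₗ[k] D.obj) ∘ₗ
      TensorProduct.map (Coalg.toHom m : E.obj →ₗ[k] C.obj ⊗[k] D.obj)
        (Coalg.toHom m : E.obj →ₗ[k] C.obj ⊗[k] D.obj) := by
    rw [← TensorProduct.map_comp]
    rfl
  rw [e, LinearMap.comp_apply]
  erw [CoalgHomClass.map_comp_comul_apply (Coalg.toHom m) x]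
  have e2 : TensorProduct.map (Coalg.toHom (prodFst C D) : C.obj ⊗[k] D.obj →ₗ[k] C.obj)
        (Coalg.toHom (prodSnd C D) : C.obj ⊗[k] D.obj →ₗ[k] D.obj) ∘ₗ
        (Coalgebra.comul (R := k) (A := C.obj ⊗[k] D.obj)) = LinearMap.id := by
    ext c d
    have e3 : TensorProduct.map (Coalg.toHom (prodFst C D) : C.obj ⊗[k] D.obj →ₗ[k] C.obj)
        (Coalg.toHom (prodSnd C D) : C.obj ⊗[k] D.obj →ₗ[k] D.obj) ∘ₗ
        (TensorProduct.AlgebraTensorModule.tensorTensorTensorComm k k k k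
          C.obj C.obj D.obj D.obj).toLinearMap =
        TensorProduct.map ((TensorProduct.rid k C.obj).toLinearMap ∘ₗ
          (Coalgebra.counit (R := k) (A := C.obj)).lTensor C.obj)
          ((TensorProduct.lid k D.obj).toLinearMap ∘ₗ
          (Coalgebra.counit (R := k) (A := D.obj)).rTensor D.obj) := by
      ext a b p q
      have h1 := prodFst_tmul C D a p
      have h2 := prodSnd_tmul C D b q
      simp only [TensorProduct.AlgebraTensorModule.curry_apply, LinearMap.restrictScalars_self,
        TensorProduct.curry_apply, LinearMap.comp_apply, LinearEquiv.coe_coe,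
        TensorProduct.AlgebraTensorModule.tensorTensorTensorComm_tmul, TensorProduct.map_tmul,
        CoalgHom.coe_toLinearMap, h1, h2, LinearMap.lTensor_tmul, LinearMap.rTensor_tmul,
        TensorProduct.rid_tmul, TensorProduct.lid_tmul, TensorProduct.smul_tmul]
      exact congrArg (fun t => a ⊗ₜ[k] t) (smul_comm _ _ _)
    have h := LinearMap.congr_fun e3 (Coalgebra.comul c ⊗ₜ Coalgebra.comul d)
    simpa using h
  exact LinearMap.congr_fun e2 (Coalg.toHom m x)

instance : HasBinaryProducts (Coalg k) := by
  have (C D : Coalg k) : HasLimit (pair C D) :=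
    ⟨⟨BinaryFan.mk (prodFst C D) (prodSnd C D),
      BinaryFan.isLimitMk (fun s => prodLift s.fst s.snd) (fun s => prodLift_fst _ _)
        (fun s => prodLift_snd _ _) (fun s m h1 h2 => by
          rw [← prodLift_eta m, h1, h2])⟩⟩
  exact hasBinaryProducts_of_hasLimit_pair _

/-- The largest subcoalgebra on which two morphisms agree. -/
def eqSub {C D : Coalg k} (f g : C ⟶ D) : Submodule k C.obj :=
  sSup {S | IsSubcoalgebra S ∧ ∀ x ∈ S, Coalg.toHom f x = Coalg.toHom g x}

lemma eqSub_isSubcoalgebra {C D : Coalg k} (f g : C ⟶ D) : IsSubcoalgebra (eqSub f g) :=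
  isSubcoalgebra_sSup _ fun _ h => h.1

lemma eqSub_le {C D : Coalg k} (f g : C ⟶ D) :
    eqSub f g ≤ LinearMap.eqLocus (Coalg.toHom f : C.obj →ₗ[k] D.obj) (Coalg.toHom g) :=
  sSup_le fun _ h x hx => h.2 x hx

/-- The equalizer of two morphisms of cocommutative coalgebras. -/
def eqObj {C D : Coalg k} (f g : C ⟶ D) : Coalg k :=
  letI := subCoalgebra (eqSub_isSubcoalgebra f g)
  haveI := subCoalgebra_isCocomm (eqSub_isSubcoalgebra f g)
  Coalg.of (eqSub f g)

/-- The inclusion of the equalizer. -/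
def eqIncl {C D : Coalg k} (f g : C ⟶ D) : eqObj f g ⟶ C :=
  letI := subCoalgebra (eqSub_isSubcoalgebra f g)
  haveI := subCoalgebra_isCocomm (eqSub_isSubcoalgebra f g)
  Coalg.ofHom (C := eqObj f g) (D := C)
    { (eqSub f g).subtype with
      counit_comp := rfl
      map_comp_comul := map_subComul (eqSub_isSubcoalgebra f g) }

lemma eqIncl_condition {C D : Coalg k} (f g : C ⟶ D) : eqIncl f g ≫ f = eqIncl f g ≫ g :=
  Coalg.hom_ext fun x => eqSub_le f g x.2

lemma range_le_eqSub {C D E : Coalg k} {f g : C ⟶ D} {h : E ⟶ C} (w : h ≫ f = h ≫ g)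
    (x : E.obj) : Coalg.toHom h x ∈ eqSub f g := by
  have hle : LinearMap.range (Coalg.toHom h : E.obj →ₗ[k] C.obj) ≤ eqSub f g := by
    refine le_sSup ⟨isSubcoalgebra_range _, ?_⟩
    rintro _ ⟨y, rfl⟩
    exact congrArg (fun t : E ⟶ D => Coalg.toHom t y) w
  exact hle ⟨x, rfl⟩

/-- The factorization through the equalizer. -/
def eqLift {C D E : Coalg k} {f g : C ⟶ D} (h : E ⟶ C) (w : h ≫ f = h ≫ g) : E ⟶ eqObj f g :=
  letI := subCoalgebra (eqSub_isSubcoalgebra f g)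
  haveI := subCoalgebra_isCocomm (eqSub_isSubcoalgebra f g)
  Coalg.ofHom (C := E) (D := eqObj f g)
    { (Coalg.toHom h : E.obj →ₗ[k] C.obj).codRestrict (eqSub f g) (range_le_eqSub w) with
      counit_comp := CoalgHomClass.counit_comp (Coalg.toHom h)
      map_comp_comul := by
        exact codRestrict_comul (eqSub_isSubcoalgebra f g) (Coalg.toHom h) (range_le_eqSub w) }

instance : HasEqualizers (Coalg k) := by
  have (C D : Coalg k) (f g : C ⟶ D) : HasLimit (parallelPair f g) :=
    ⟨⟨Fork.ofι (eqIncl f g) (eqIncl_condition f g),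
      Fork.IsLimit.mk' _ fun s => ⟨eqLift s.ι s.condition, Coalg.hom_ext fun x => rfl,
        fun {m} hm => Coalg.hom_ext fun x => Subtype.ext
          (congrArg (fun t : s.pt ⟶ C => Coalg.toHom t x) hm)⟩⟩⟩
  exact hasEqualizers_of_hasLimit_parallelPair _

instance : HasPullbacks (Coalg k) := hasPullbacks_of_hasBinaryProducts_of_hasEqualizers _

end Coalg

section Comodules

variable (k : Type u) [Field k] (C : Type u) [AddCommGroup C] [Module k C] [Coalgebra k C]

/-- Comodules over a coalgebra `C`: a vector space with a coassociative counital coaction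
`V → V ⊗ C`. -/
structure Comod where
  carrier : Type u
  [addCommGroup : AddCommGroup carrier]
  [module : Module k carrier]
  /-- the coaction -/
  coact : carrier →ₗ[k] carrier ⊗[k] C
  coassoc : (TensorProduct.assoc k carrier C C).toLinearMap ∘ₗ coact.rTensor C ∘ₗ coact =
    (Coalgebra.comul (R := k) (A := C)).lTensor carrier ∘ₗ coact
  counit : (TensorProduct.rid k carrier).toLinearMap ∘ₗ
    (Coalgebra.counit (R := k) (A := C)).lTensor carrier ∘ₗ coact = LinearMap.id

attribute [instance] Comod.addCommGroup Comod.module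

variable {k C}

namespace Comod

/-- Morphisms of comodules: linear maps commuting with the coactions. -/
@[ext]
structure Hom (V W : Comod k C) where
  lin : V.carrier →ₗ[k] W.carrier
  comm : W.coact ∘ₗ lin = lin.rTensor C ∘ₗ V.coact

instance : Category (Comod k C) where
  Hom V W := Hom V W
  id V := ⟨LinearMap.id, by simp⟩
  comp f g := ⟨g.lin ∘ₗ f.lin, by
    rw [← LinearMap.comp_assoc, g.comm, LinearMap.comp_assoc, f.comm, ← LinearMap.comp_assoc,
      LinearMap.rTensor_comp]⟩

/-- The linear map underlying a morphism of comodules. -/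
def toLin {V W : Comod k C} (f : V ⟶ W) : V.carrier →ₗ[k] W.carrier := Hom.lin f

/-- A colinear map as a morphism of comodules. -/
def ofLin {V W : Comod k C} (f : V.carrier →ₗ[k] W.carrier)
    (h : W.coact ∘ₗ f = f.rTensor C ∘ₗ V.coact) : V ⟶ W := Hom.mk f h

@[simp] lemma toLin_ofLin {V W : Comod k C} (f : V.carrier →ₗ[k] W.carrier)
    (h : W.coact ∘ₗ f = f.rTensor C ∘ₗ V.coact) : toLin (ofLin f h) = f := rfl

@[simp] lemma toLin_id (V : Comod k C) : toLin (𝟙 V) = LinearMap.id := rfl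

@[simp] lemma toLin_comp {V W X : Comod k C} (f : V ⟶ W) (g : W ⟶ X) :
    toLin (f ≫ g) = toLin g ∘ₗ toLin f := rfl

lemma toLin_comm {V W : Comod k C} (f : V ⟶ W) :
    W.coact ∘ₗ toLin f = (toLin f).rTensor C ∘ₗ V.coact := Hom.comm f

lemma toLin_comm_apply {V W : Comod k C} (f : V ⟶ W) (x : V.carrier) :
    W.coact (toLin f x) = (toLin f).rTensor C (V.coact x) :=
  LinearMap.congr_fun (Hom.comm f) x

lemma hom_ext {V W : Comod k C} {f g : V ⟶ W} (h : toLin f = toLin g) : f = g := Hom.ext h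

/-- An isomorphism of comodules from a colinear map with a linear inverse. -/
def isoMk {V W : Comod k C} (f : V ⟶ W) (g : W.carrier →ₗ[k] V.carrier)
    (h1 : g ∘ₗ toLin f = LinearMap.id) (h2 : toLin f ∘ₗ g = LinearMap.id) : V ≅ W where
  hom := f
  inv := ofLin g (by
    have e : V.coact = g.rTensor C ∘ₗ W.coact ∘ₗ toLin f := by
      rw [toLin_comm, ← LinearMap.comp_assoc, ← LinearMap.rTensor_comp, h1]
      simp
    rw [e, LinearMap.comp_assoc, LinearMap.comp_assoc, h2, LinearMap.comp_id])
  hom_inv_id := hom_ext h1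
  inv_hom_id := hom_ext h2

lemma coassoc_apply (V : Comod k C) (x : V.carrier) :
    TensorProduct.assoc k V.carrier C C (V.coact.rTensor C (V.coact x)) =
      (Coalgebra.comul (R := k) (A := C)).lTensor V.carrier (V.coact x) :=
  LinearMap.congr_fun V.coassoc x

lemma counit_apply (V : Comod k C) (x : V.carrier) :
    TensorProduct.rid k V.carrier
      ((Coalgebra.counit (R := k) (A := C)).lTensor V.carrier (V.coact x)) = x :=
  LinearMap.congr_fun V.counit x

/-- A subspace `i : K → M` of a comodule `M` with a compatible map `K → K ⊗ C` is a comodule. -/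
def ofInjective (M : Comod k C) (K : Type u) [AddCommGroup K] [Module k K]
    (i : K →ₗ[k] M.carrier) (hi : Function.Injective i) (δ : K →ₗ[k] K ⊗[k] C)
    (h : i.rTensor C ∘ₗ δ = M.coact ∘ₗ i) : Comod k C where
  carrier := K
  coact := δ
  coassoc := by
    apply LinearMap.ext
    intro x
    apply Module.Flat.rTensor_preserves_injective_linearMap (M := C ⊗[k] C) i hi
    have e1 : i.rTensor (C ⊗[k] C) ∘ₗ (TensorProduct.assoc k K C C).toLinearMap ∘ₗ δ.rTensor C =
        (TensorProduct.assoc k M.carrier C C).toLinearMap ∘ₗ M.coact.rTensor C ∘ₗ i.rTensor C := by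
      rw [← LinearMap.rTensor_comp, ← h, LinearMap.rTensor_comp, ← LinearMap.comp_assoc,
        ← LinearMap.comp_assoc]
      congr 1
      ext a b c
      simp
    have e2 : i.rTensor (C ⊗[k] C) ∘ₗ (Coalgebra.comul (R := k) (A := C)).lTensor K =
        (Coalgebra.comul (R := k) (A := C)).lTensor M.carrier ∘ₗ i.rTensor C := by
      ext a b
      simp
    have h1 := LinearMap.congr_fun e1 (δ x)
    have h2 := LinearMap.congr_fun e2 (δ x)
    have h3 := LinearMap.congr_fun h x
    simp only [LinearMap.comp_apply] at h1 h2 h3 ⊢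
    rw [h1, h2, h3]
    exact M.coassoc_apply (i x)
  counit := by
    apply LinearMap.ext
    intro x
    apply hi
    have e : i ∘ₗ (TensorProduct.rid k K).toLinearMap ∘ₗ
        (Coalgebra.counit (R := k) (A := C)).lTensor K =
        (TensorProduct.rid k M.carrier).toLinearMap ∘ₗ
          (Coalgebra.counit (R := k) (A := C)).lTensor M.carrier ∘ₗ i.rTensor C := by
      ext a b
      simp
    have h1 := LinearMap.congr_fun e (δ x)
    have h3 := LinearMap.congr_fun h x
    simp only [LinearMap.comp_apply] at h1 h3 ⊢
    rw [h1, h3]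
    exact M.counit_apply (i x)

/-- The comodule `V ⊗ W` whose coaction is that of `W`. -/
@[reducible] def tmul (V : Type u) [AddCommGroup V] [Module k V] (W : Comod k C) : Comod k C where
  carrier := V ⊗[k] W.carrier
  coact := (TensorProduct.assoc k V W.carrier C).symm.toLinearMap ∘ₗ W.coact.lTensor V
  coassoc := by
    ext v w
    have e (y : W.carrier ⊗[k] C) : TensorProduct.assoc k (V ⊗[k] W.carrier) C C
        (((TensorProduct.assoc k V W.carrier C).symm.toLinearMap ∘ₗ W.coact.lTensor V).rTensor C
          ((TensorProduct.assoc k V W.carrier C).symm (v ⊗ₜ y))) =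
        (TensorProduct.assoc k V W.carrier (C ⊗[k] C)).symm
          (v ⊗ₜ (TensorProduct.assoc k W.carrier C C (W.coact.rTensor C y))) := by
      induction y using TensorProduct.induction_on with
      | zero => simp
      | add p q hp hq => simp only [TensorProduct.tmul_add, map_add, hp, hq]
      | tmul a c =>
        simp only [TensorProduct.assoc_symm_tmul, LinearMap.rTensor_tmul, LinearMap.comp_apply,
          LinearMap.lTensor_tmul, LinearEquiv.coe_coe]
        generalize W.coact a = z
        induction z using TensorProduct.induction_on with
        | zero => simp
        | add p q hp hq =>
          simp only [TensorProduct.tmul_add, TensorProduct.add_tmul, map_add, hp, hq]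
        | tmul a c => rfl
    have e' (y : W.carrier ⊗[k] C) : (Coalgebra.comul (R := k) (A := C)).lTensor (V ⊗[k] W.carrier)
        ((TensorProduct.assoc k V W.carrier C).symm (v ⊗ₜ y)) =
        (TensorProduct.assoc k V W.carrier (C ⊗[k] C)).symm
          (v ⊗ₜ ((Coalgebra.comul (R := k) (A := C)).lTensor W.carrier y)) := by
      induction y using TensorProduct.induction_on with
      | zero => simp
      | add p q hp hq => simp only [TensorProduct.tmul_add, map_add, hp, hq]
      | tmul a c =>
        simp only [TensorProduct.assoc_symm_tmul, LinearMap.lTensor_tmul]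
    simp only [TensorProduct.AlgebraTensorModule.curry_apply, LinearMap.restrictScalars_self,
      TensorProduct.curry_apply, LinearMap.comp_apply, LinearMap.lTensor_tmul, LinearEquiv.coe_coe]
    rw [e, e', W.coassoc_apply]
  counit := by
    ext v w
    have e (y : W.carrier ⊗[k] C) : TensorProduct.rid k (V ⊗[k] W.carrier)
        ((Coalgebra.counit (R := k) (A := C)).lTensor (V ⊗[k] W.carrier)
          ((TensorProduct.assoc k V W.carrier C).symm (v ⊗ₜ y))) =
        v ⊗ₜ (TensorProduct.rid k W.carrier
          ((Coalgebra.counit (R := k) (A := C)).lTensor W.carrier y)) := by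
      induction y using TensorProduct.induction_on with
      | zero => simp
      | add p q hp hq => simp only [TensorProduct.tmul_add, map_add, hp, hq]
      | tmul a c => simp
    simp only [TensorProduct.AlgebraTensorModule.curry_apply, LinearMap.restrictScalars_self,
      TensorProduct.curry_apply, LinearMap.comp_apply, LinearMap.lTensor_tmul, LinearEquiv.coe_coe,
      LinearMap.id_apply]
    rw [e, W.counit_apply]

end Comod

section Cotensor

variable {D : Type u} [AddCommGroup D] [Module k D] [Coalgebra k D]

/-- The cotensor product of a right `C`-comodule `V` and a space `W` with a left coaction
`l : W → C ⊗ W`: the equalizer of `ρ_V ⊗ id` and `id ⊗ l` in `V ⊗ W`. -/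
def cotensor (V : Comod k C) {W : Type u} [AddCommGroup W] [Module k W] (l : W →ₗ[k] C ⊗[k] W) :
    Submodule k (V.carrier ⊗[k] W) :=
  LinearMap.eqLocus ((TensorProduct.assoc k V.carrier C W).toLinearMap ∘ₗ V.coact.rTensor W)
    (l.lTensor V.carrier)

lemma mem_cotensor (V : Comod k C) {W : Type u} [AddCommGroup W] [Module k W]
    (l : W →ₗ[k] C ⊗[k] W) (x : V.carrier ⊗[k] W) : x ∈ cotensor V l ↔
      TensorProduct.assoc k V.carrier C W (V.coact.rTensor W x) = l.lTensor V.carrier x := Iff.rfl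

lemma mem_range_lTensor (X : Type u) [AddCommGroup X] [Module k X] {M N : Type u} [AddCommGroup M]
    [Module k M] [AddCommGroup N] [Module k N] (f g : M →ₗ[k] N) (x : X ⊗[k] M) :
    x ∈ LinearMap.range ((LinearMap.eqLocus f g).subtype.lTensor X) ↔
      f.lTensor X x = g.lTensor X x := by
  have h := Module.Flat.eqLocus_lTensor_eq (S := k) (M := X) f g
  exact (SetLike.ext_iff.mp h x).symm

lemma mem_range_rTensor (X : Type u) [AddCommGroup X] [Module k X] {M N : Type u} [AddCommGroup M]
    [Module k M] [AddCommGroup N] [Module k N] (f g : M →ₗ[k] N) (x : M ⊗[k] X) :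
    x ∈ LinearMap.range ((LinearMap.eqLocus f g).subtype.rTensor X) ↔
      f.rTensor X x = g.rTensor X x := by
  have h := mem_range_lTensor X f g (TensorProduct.comm k M X x)
  rw [← LinearMap.comm_comp_rTensor_comp_comm_eq, ← LinearMap.comm_comp_rTensor_comp_comm_eq f,
    ← LinearMap.comm_comp_rTensor_comp_comm_eq g] at h
  simp only [LinearMap.comp_apply, LinearEquiv.coe_coe, LinearMap.mem_range,
    EmbeddingLike.apply_eq_iff_eq] at h ⊢
  simp only [← TensorProduct.comm_symm (R := k) (M := M) (N := X),
    LinearEquiv.symm_apply_apply] at h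
  rw [← h]
  constructor
  · rintro ⟨y, hy⟩
    exact ⟨TensorProduct.comm k _ _ y, by simpa using hy⟩
  · rintro ⟨y, hy⟩
    exact ⟨_, hy⟩

/-- For a left `C`-coaction `l` and a right `D`-coaction on `W`: the two coactions commute. -/
def IsBicomod (W : Comod k D) (l : W.carrier →ₗ[k] C ⊗[k] W.carrier) : Prop :=
  (TensorProduct.assoc k C W.carrier D).toLinearMap ∘ₗ l.rTensor D ∘ₗ W.coact =
    W.coact.lTensor C ∘ₗ l

lemma coact_mem_range (V : Comod k C) (W : Comod k D) {l : W.carrier →ₗ[k] C ⊗[k] W.carrier}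
    (h : IsBicomod W l) (x : cotensor V l) :
    (TensorProduct.assoc k V.carrier W.carrier D).symm (W.coact.lTensor V.carrier x.1) ∈
      LinearMap.range ((cotensor V l).subtype.rTensor D) := by
  refine (mem_range_rTensor D _ _ _).mpr ?_
  have e1 : (TensorProduct.assoc k V.carrier (C ⊗[k] W.carrier) D).toLinearMap ∘ₗ
      ((TensorProduct.assoc k V.carrier C W.carrier).toLinearMap ∘ₗ
        V.coact.rTensor W.carrier).rTensor D ∘ₗ
      (TensorProduct.assoc k V.carrier W.carrier D).symm.toLinearMap ∘ₗ
        W.coact.lTensor V.carrier =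
      ((TensorProduct.assoc k C W.carrier D).symm.toLinearMap ∘ₗ
        W.coact.lTensor C).lTensor V.carrier ∘ₗ
      ((TensorProduct.assoc k V.carrier C W.carrier).toLinearMap ∘ₗ
        V.coact.rTensor W.carrier) := by
    ext v w
    obtain ⟨s, hs⟩ := TensorProduct.exists_finset (V.coact v)
    obtain ⟨t, ht⟩ := TensorProduct.exists_finset (W.coact w)
    simp [hs, ht, TensorProduct.sum_tmul, TensorProduct.tmul_sum]
    try rw [Finset.sum_comm]
  have e2 : (TensorProduct.assoc k V.carrier (C ⊗[k] W.carrier) D).toLinearMap ∘ₗ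
      (l.lTensor V.carrier).rTensor D ∘ₗ
      (TensorProduct.assoc k V.carrier W.carrier D).symm.toLinearMap ∘ₗ
        W.coact.lTensor V.carrier =
      ((TensorProduct.assoc k C W.carrier D).symm.toLinearMap ∘ₗ
        W.coact.lTensor C).lTensor V.carrier ∘ₗ l.lTensor V.carrier := by
    rw [← LinearMap.lTensor_comp, LinearMap.comp_assoc, ← h]
    ext v w
    obtain ⟨t, ht⟩ := TensorProduct.exists_finset (W.coact w)
    simp [ht, TensorProduct.tmul_sum]
  have h1 := LinearMap.congr_fun e1 x.1
  have h2 := LinearMap.congr_fun e2 x.1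
  have h3 := (mem_cotensor V l x.1).mp x.2
  simp only [LinearMap.comp_apply, LinearEquiv.coe_coe] at h1 h2
  rw [h3] at h1
  exact (TensorProduct.assoc k V.carrier (C ⊗[k] W.carrier) D).injective (h1.trans h2.symm)

/-- The coaction of `D` on the cotensor product: the restriction of `id ⊗ ρ_W`. -/
def cotensorCoact (V : Comod k C) (W : Comod k D) {l : W.carrier →ₗ[k] C ⊗[k] W.carrier}
    (h : IsBicomod W l) : cotensor V l →ₗ[k] cotensor V l ⊗[k] D :=
  factorThrough ((cotensor V l).subtype.rTensor D)
    (Module.Flat.rTensor_preserves_injective_linearMap _ (cotensor V l).injective_subtype)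
    ((TensorProduct.assoc k V.carrier W.carrier D).symm.toLinearMap ∘ₗ
      W.coact.lTensor V.carrier ∘ₗ (cotensor V l).subtype) (coact_mem_range V W h)

lemma rTensor_cotensorCoact (V : Comod k C) (W : Comod k D)
    {l : W.carrier →ₗ[k] C ⊗[k] W.carrier} (h : IsBicomod W l) :
    (cotensor V l).subtype.rTensor D ∘ₗ cotensorCoact V W h =
      (TensorProduct.assoc k V.carrier W.carrier D).symm.toLinearMap ∘ₗ
        W.coact.lTensor V.carrier ∘ₗ (cotensor V l).subtype :=
  comp_factorThrough _ _ _ _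

/-- The cotensor product of a `C`-comodule with a `C`-`D`-bicomodule `W`, as a `D`-comodule. -/
def cotensorComod (V : Comod k C) (W : Comod k D) {l : W.carrier →ₗ[k] C ⊗[k] W.carrier}
    (h : IsBicomod W l) : Comod k D :=
  Comod.ofInjective (Comod.tmul V.carrier W) (cotensor V l) (cotensor V l).subtype
    (cotensor V l).injective_subtype (cotensorCoact V W h) (rTensor_cotensorCoact V W h)

/-- The inclusion of the cotensor product into the tensor product, as a linear map. -/
def cotensorIncl (V : Comod k C) (W : Comod k D) {l : W.carrier →ₗ[k] C ⊗[k] W.carrier}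
    (h : IsBicomod W l) : (cotensorComod V W h).carrier →ₗ[k] V.carrier ⊗[k] W.carrier :=
  (cotensor V l).subtype

section
variable (V : Comod k C) (W : Comod k D) {l : W.carrier →ₗ[k] C ⊗[k] W.carrier}
  (h : IsBicomod W l)

lemma cotensorIncl_injective : Function.Injective (cotensorIncl V W h) :=
  (cotensor V l).injective_subtype

lemma rTensor_cotensorIncl_injective (X : Type u) [AddCommGroup X] [Module k X] :
    Function.Injective ((cotensorIncl V W h).rTensor X) :=
  Module.Flat.rTensor_preserves_injective_linearMap _ (cotensorIncl_injective V W h)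

lemma lTensor_cotensorIncl_injective (X : Type u) [AddCommGroup X] [Module k X] :
    Function.Injective ((cotensorIncl V W h).lTensor X) :=
  Module.Flat.lTensor_preserves_injective_linearMap _ (cotensorIncl_injective V W h)

lemma cotensorIncl_eq : (TensorProduct.assoc k V.carrier C W.carrier).toLinearMap ∘ₗ
      V.coact.rTensor W.carrier ∘ₗ cotensorIncl V W h =
    l.lTensor V.carrier ∘ₗ cotensorIncl V W h :=
  LinearMap.ext fun x => x.2

lemma cotensor_coact : (cotensorIncl V W h).rTensor D ∘ₗ (cotensorComod V W h).coact =
    (TensorProduct.assoc k V.carrier W.carrier D).symm.toLinearMap ∘ₗ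
      W.coact.lTensor V.carrier ∘ₗ cotensorIncl V W h :=
  rTensor_cotensorCoact V W h

/-- A linear map that equalizes the two maps factors through the cotensor product. -/
def cotensorLift {Z : Type u} [AddCommGroup Z] [Module k Z]
    (g : Z →ₗ[k] V.carrier ⊗[k] W.carrier)
    (hg : (TensorProduct.assoc k V.carrier C W.carrier).toLinearMap ∘ₗ
      V.coact.rTensor W.carrier ∘ₗ g = l.lTensor V.carrier ∘ₗ g) :
    Z →ₗ[k] (cotensorComod V W h).carrier :=
  g.codRestrict (cotensor V l) (fun z => LinearMap.congr_fun hg z)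

lemma cotensorIncl_lift {Z : Type u} [AddCommGroup Z] [Module k Z]
    (g : Z →ₗ[k] V.carrier ⊗[k] W.carrier)
    (hg : (TensorProduct.assoc k V.carrier C W.carrier).toLinearMap ∘ₗ
      V.coact.rTensor W.carrier ∘ₗ g = l.lTensor V.carrier ∘ₗ g) :
    cotensorIncl V W h ∘ₗ cotensorLift V W h g hg = g := rfl

lemma cotensor_colinear {Z : Comod k D} (g : Z.carrier →ₗ[k] (cotensorComod V W h).carrier)
    (hg : (TensorProduct.assoc k V.carrier W.carrier D).symm.toLinearMap ∘ₗ
      W.coact.lTensor V.carrier ∘ₗ cotensorIncl V W h ∘ₗ g =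
      (cotensorIncl V W h ∘ₗ g).rTensor D ∘ₗ Z.coact) :
    (cotensorComod V W h).coact ∘ₗ g = g.rTensor D ∘ₗ Z.coact := by
  apply LinearMap.ext
  intro z
  apply rTensor_cotensorIncl_injective V W h D
  have h1 := LinearMap.congr_fun (cotensor_coact V W h) (g z)
  have h2 := LinearMap.congr_fun hg z
  rw [LinearMap.rTensor_comp] at h2
  exact h1.trans h2

variable {V W h} in
lemma cotensor_hom_ext {Z : Type u} [AddCommGroup Z] [Module k Z]
    {f g : Z →ₗ[k] (cotensorComod V W h).carrier}
    (e : cotensorIncl V W h ∘ₗ f = cotensorIncl V W h ∘ₗ g) : f = g :=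
  LinearMap.ext fun z => cotensorIncl_injective V W h (LinearMap.congr_fun e z)

end

/-- The functoriality of the cotensor product. -/
def cotensorMap {V V' : Comod k C} {W W' : Comod k D} {l : W.carrier →ₗ[k] C ⊗[k] W.carrier}
    {l' : W'.carrier →ₗ[k] C ⊗[k] W'.carrier} (h : IsBicomod W l) (h' : IsBicomod W' l')
    (f : V ⟶ V') (g : W ⟶ W') (hg : l' ∘ₗ Comod.toLin g = (Comod.toLin g).lTensor C ∘ₗ l) :
    cotensorComod V W h ⟶ cotensorComod V' W' h' :=
  Comod.ofLin (cotensorLift V' W' h'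
    (TensorProduct.map (Comod.toLin f) (Comod.toLin g) ∘ₗ cotensorIncl V W h) (by
      have e1 : (TensorProduct.assoc k V'.carrier C W'.carrier).toLinearMap ∘ₗ
          V'.coact.rTensor W'.carrier ∘ₗ TensorProduct.map (Comod.toLin f) (Comod.toLin g) =
          TensorProduct.map (Comod.toLin f) ((Comod.toLin g).lTensor C) ∘ₗ
          (TensorProduct.assoc k V.carrier C W.carrier).toLinearMap ∘ₗ
            V.coact.rTensor W.carrier := by
        ext v w
        obtain ⟨s, hs⟩ := TensorProduct.exists_finset (V.coact v)
        simp [Comod.toLin_comm_apply, hs, TensorProduct.sum_tmul]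
      have e2 : l'.lTensor V'.carrier ∘ₗ TensorProduct.map (Comod.toLin f) (Comod.toLin g) =
          TensorProduct.map (Comod.toLin f) ((Comod.toLin g).lTensor C) ∘ₗ
            l.lTensor V.carrier := by
        ext v w
        have h1 := LinearMap.congr_fun hg w
        simp only [LinearMap.comp_apply] at h1
        simp [h1]
      apply LinearMap.ext
      intro x
      have h1 := LinearMap.congr_fun e1 (cotensorIncl V W h x)
      have h2 := LinearMap.congr_fun e2 (cotensorIncl V W h x)
      have h3 := LinearMap.congr_fun (cotensorIncl_eq V W h) x
      simp only [LinearMap.comp_apply] at h1 h2 h3 ⊢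
      rw [h1, h2, h3]))
    (cotensor_colinear V' W' h' _ (by
      rw [cotensorIncl_lift, LinearMap.rTensor_comp, LinearMap.comp_assoc, cotensor_coact]
      have e1 : (TensorProduct.assoc k V'.carrier W'.carrier D).symm.toLinearMap ∘ₗ
          W'.coact.lTensor V'.carrier ∘ₗ TensorProduct.map (Comod.toLin f) (Comod.toLin g) =
          (TensorProduct.map (Comod.toLin f) (Comod.toLin g)).rTensor D ∘ₗ
          (TensorProduct.assoc k V.carrier W.carrier D).symm.toLinearMap ∘ₗ
            W.coact.lTensor V.carrier := by
        ext v w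
        obtain ⟨s, hs⟩ := TensorProduct.exists_finset (W.coact w)
        simp [Comod.toLin_comm_apply, hs, TensorProduct.tmul_sum]
      exact congrArg (fun t => t ∘ₗ cotensorIncl V W h) e1))

lemma cotensorIncl_map {V V' : Comod k C} {W W' : Comod k D} {l : W.carrier →ₗ[k] C ⊗[k] W.carrier}
    {l' : W'.carrier →ₗ[k] C ⊗[k] W'.carrier} (h : IsBicomod W l) (h' : IsBicomod W' l')
    (f : V ⟶ V') (g : W ⟶ W') (hg : l' ∘ₗ Comod.toLin g = (Comod.toLin g).lTensor C ∘ₗ l) :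
    cotensorIncl V' W' h' ∘ₗ Comod.toLin (cotensorMap h h' f g hg) =
      TensorProduct.map (Comod.toLin f) (Comod.toLin g) ∘ₗ cotensorIncl V W h := rfl

end Cotensor
end Comodules

section Monoidal

variable {k : Type u} [Field k] {C : Type u} [AddCommGroup C] [Module k C] [Coalgebra k C]

namespace Comod

/-- The left coaction obtained from the right coaction by the flip. -/
def lcoact (V : Comod k C) : V.carrier →ₗ[k] C ⊗[k] V.carrier :=
  (TensorProduct.comm k V.carrier C).toLinearMap ∘ₗ V.coact

lemma toLin_lcoact {V W : Comod k C} (f : V ⟶ W) :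
    W.lcoact ∘ₗ toLin f = (toLin f).lTensor C ∘ₗ V.lcoact := by
  apply LinearMap.ext
  intro v
  simp only [lcoact, LinearMap.comp_apply, toLin_comm_apply]
  obtain ⟨s, hs⟩ := TensorProduct.exists_finset (V.coact v)
  simp [hs]

variable (k C) in
/-- The coalgebra `C` as a comodule over itself. -/
@[reducible] def regular : Comod k C where
  carrier := C
  coact := Coalgebra.comul
  coassoc := Coalgebra.coassoc
  counit := by
    ext x
    simp

variable [Coalgebra.IsCocomm k C]

lemma isBicomod_lcoact (V : Comod k C) : IsBicomod V V.lcoact := by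
  apply LinearMap.ext
  intro v
  have e2 : (TensorProduct.comm k (V.carrier ⊗[k] C) C).toLinearMap =
      (TensorProduct.assoc k C V.carrier C).toLinearMap ∘ₗ
      (TensorProduct.comm k V.carrier C).toLinearMap.rTensor C ∘ₗ
      (TensorProduct.assoc k V.carrier C C).symm.toLinearMap ∘ₗ
      (TensorProduct.comm k C C).toLinearMap.lTensor V.carrier ∘ₗ
      (TensorProduct.assoc k V.carrier C C).toLinearMap := by
    ext
    simp
  have e3 : V.coact.lTensor C ∘ₗ (TensorProduct.comm k V.carrier C).toLinearMap =
      (TensorProduct.comm k (V.carrier ⊗[k] C) C).toLinearMap ∘ₗ V.coact.rTensor C := by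
    ext
    simp
  have e4 : (TensorProduct.comm k C C).toLinearMap.lTensor V.carrier ∘ₗ
      (Coalgebra.comul (R := k) (A := C)).lTensor V.carrier =
      (Coalgebra.comul (R := k) (A := C)).lTensor V.carrier := by
    rw [← LinearMap.lTensor_comp, Coalgebra.comm_comp_comul]
  have h3 := LinearMap.congr_fun e3 (V.coact v)
  have h2 := LinearMap.congr_fun e2 (V.coact.rTensor C (V.coact v))
  have h4 := LinearMap.congr_fun e4 (V.coact v)
  simp only [LinearMap.comp_apply, LinearEquiv.coe_coe, lcoact, LinearMap.rTensor_comp]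
    at h2 h3 h4 ⊢
  rw [h3, h2, V.coassoc_apply, h4, ← V.coassoc_apply, LinearEquiv.symm_apply_apply]

lemma lcoact_coassoc (V : Comod k C) :
    (TensorProduct.assoc k C C V.carrier).toLinearMap ∘ₗ
      (Coalgebra.comul (R := k) (A := C)).rTensor V.carrier ∘ₗ V.lcoact =
    V.lcoact.lTensor C ∘ₗ V.lcoact := by
  apply LinearMap.ext
  intro v
  have e1 : V.lcoact.lTensor C ∘ₗ (TensorProduct.comm k V.carrier C).toLinearMap =
      (TensorProduct.assoc k C C V.carrier).toLinearMap ∘ₗ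
      (TensorProduct.comm k C C).toLinearMap.rTensor V.carrier ∘ₗ
      (TensorProduct.comm k V.carrier (C ⊗[k] C)).toLinearMap ∘ₗ
      (TensorProduct.assoc k V.carrier C C).toLinearMap ∘ₗ V.coact.rTensor C := by
    ext v c
    obtain ⟨s, hs⟩ := TensorProduct.exists_finset (V.coact v)
    simp [lcoact, hs, TensorProduct.tmul_sum, TensorProduct.sum_tmul]
  have e2 : (TensorProduct.comm k C C).toLinearMap.rTensor V.carrier ∘ₗ
      (TensorProduct.comm k V.carrier (C ⊗[k] C)).toLinearMap ∘ₗ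
      (Coalgebra.comul (R := k) (A := C)).lTensor V.carrier =
      (Coalgebra.comul (R := k) (A := C)).rTensor V.carrier ∘ₗ
        (TensorProduct.comm k V.carrier C).toLinearMap := by
    ext v c
    simp
  have h1 := LinearMap.congr_fun e1 (V.coact v)
  have h2 := LinearMap.congr_fun e2 (V.coact v)
  simp only [LinearMap.comp_apply, LinearEquiv.coe_coe] at h1 h2 ⊢
  rw [V.coassoc_apply, h2] at h1
  exact h1.symm

lemma regular_lcoact : (regular k C).lcoact = (Coalgebra.comul : C →ₗ[k] C ⊗[k] C) := Coalgebra.comm_comp_comul k C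

/-- The monoidal product of comodules over a cocommutative coalgebra: the cotensor product. -/
def cten (V W : Comod k C) : Comod k C := cotensorComod V W W.isBicomod_lcoact

/-- The inclusion of the cotensor product into the tensor product of vector spaces. -/
def incl (V W : Comod k C) : (cten V W).carrier →ₗ[k] V.carrier ⊗[k] W.carrier :=
  cotensorIncl V W W.isBicomod_lcoact

lemma incl_injective (V W : Comod k C) : Function.Injective (incl V W) :=
  cotensorIncl_injective _ _ _

lemma incl_eq (V W : Comod k C) (x : (cten V W).carrier) :
    TensorProduct.assoc k V.carrier C W.carrier (V.coact.rTensor W.carrier (incl V W x)) =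
      W.lcoact.lTensor V.carrier (incl V W x) := x.2

lemma incl_coact (V W : Comod k C) (x : (cten V W).carrier) :
    (incl V W).rTensor C ((cten V W).coact x) =
      (TensorProduct.assoc k V.carrier W.carrier C).symm
        (W.coact.lTensor V.carrier (incl V W x)) :=
  LinearMap.congr_fun (cotensor_coact V W W.isBicomod_lcoact) x

lemma incl_lcoact (V W : Comod k C) (x : (cten V W).carrier) :
    (incl V W).lTensor C ((cten V W).lcoact x) =
      TensorProduct.assoc k C V.carrier W.carrier
        (V.lcoact.rTensor W.carrier (incl V W x)) := by
  have e1 : (incl V W).lTensor C ∘ₗ (TensorProduct.comm k (cten V W).carrier C).toLinearMap =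
      (TensorProduct.comm k (V.carrier ⊗[k] W.carrier) C).toLinearMap ∘ₗ
        (incl V W).rTensor C := by
    ext a c
    simp
  have e2 : (TensorProduct.comm k (V.carrier ⊗[k] W.carrier) C).toLinearMap ∘ₗ
      (TensorProduct.assoc k V.carrier W.carrier C).symm.toLinearMap ∘ₗ
      W.coact.lTensor V.carrier =
      (TensorProduct.comm k (V.carrier ⊗[k] W.carrier) C).toLinearMap ∘ₗ
      (TensorProduct.assoc k V.carrier W.carrier C).symm.toLinearMap ∘ₗ
      (TensorProduct.comm k C W.carrier).toLinearMap.lTensor V.carrier ∘ₗ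
      W.lcoact.lTensor V.carrier := by
    ext v w
    obtain ⟨s, hs⟩ := TensorProduct.exists_finset (W.coact w)
    simp [lcoact, hs, TensorProduct.tmul_sum]
  have e3 : (TensorProduct.comm k (V.carrier ⊗[k] W.carrier) C).toLinearMap ∘ₗ
      (TensorProduct.assoc k V.carrier W.carrier C).symm.toLinearMap ∘ₗ
      (TensorProduct.comm k C W.carrier).toLinearMap.lTensor V.carrier ∘ₗ
      (TensorProduct.assoc k V.carrier C W.carrier).toLinearMap ∘ₗ
      V.coact.rTensor W.carrier = (TensorProduct.assoc k C V.carrier W.carrier).toLinearMap ∘ₗ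
        V.lcoact.rTensor W.carrier := by
    ext v w
    obtain ⟨s, hs⟩ := TensorProduct.exists_finset (V.coact v)
    simp [lcoact, hs, TensorProduct.sum_tmul]
  have h1 := LinearMap.congr_fun e1 ((cten V W).coact x)
  have h2 := LinearMap.congr_fun e2 (incl V W x)
  have h3 := LinearMap.congr_fun e3 (incl V W x)
  simp only [LinearMap.comp_apply, LinearEquiv.coe_coe] at h1 h2 h3
  rw [incl_eq] at h3
  rw [incl_coact, h2, h3] at h1
  exact h1

/-- The monoidal product of two morphisms of comodules. -/
def ctenMap {V V' W W' : Comod k C} (f : V ⟶ V') (g : W ⟶ W') : cten V W ⟶ cten V' W' :=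
  cotensorMap _ _ f g (toLin_lcoact g)

lemma incl_ctenMap {V V' W W' : Comod k C} (f : V ⟶ V') (g : W ⟶ W') (x : (cten V W).carrier) :
    incl V' W' (toLin (ctenMap f g) x) = TensorProduct.map (toLin f) (toLin g) (incl V W x) := rfl

/-- The map to a threefold tensor product underlying the associator. -/
def assocAux (V W X : Comod k C) :
    (cten (cten V W) X).carrier →ₗ[k] V.carrier ⊗[k] (W.carrier ⊗[k] X.carrier) :=
  (TensorProduct.assoc k V.carrier W.carrier X.carrier).toLinearMap ∘ₗ
    (incl V W).rTensor X.carrier ∘ₗ incl (cten V W) X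

lemma assocAux_mem (V W X : Comod k C) (z : (cten (cten V W) X).carrier) :
    assocAux V W X z ∈ LinearMap.range ((incl W X).lTensor V.carrier) := by
  refine (mem_range_lTensor V.carrier _ _ _).mpr ?_
  have h := congrArg (fun t => (TensorProduct.assoc k V.carrier W.carrier (C ⊗[k] X.carrier))
    ((incl V W).rTensor (C ⊗[k] X.carrier) t)) (incl_eq (cten V W) X z)
  have e1 : (TensorProduct.assoc k V.carrier W.carrier (C ⊗[k] X.carrier)).toLinearMap ∘ₗ
      (incl V W).rTensor (C ⊗[k] X.carrier) ∘ₗ X.lcoact.lTensor (cten V W).carrier =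
      (X.lcoact.lTensor W.carrier).lTensor V.carrier ∘ₗ
        (TensorProduct.assoc k V.carrier W.carrier X.carrier).toLinearMap ∘ₗ
        (incl V W).rTensor X.carrier := by
    ext a x
    obtain ⟨s, hs⟩ := TensorProduct.exists_finset (incl V W a)
    simp [hs, TensorProduct.sum_tmul]
  have e2 : (TensorProduct.assoc k V.carrier W.carrier (C ⊗[k] X.carrier)).toLinearMap ∘ₗ
      (incl V W).rTensor (C ⊗[k] X.carrier) ∘ₗ
      (TensorProduct.assoc k (cten V W).carrier C X.carrier).toLinearMap ∘ₗ
      (cten V W).coact.rTensor X.carrier =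
      ((TensorProduct.assoc k W.carrier C X.carrier).toLinearMap ∘ₗ
        W.coact.rTensor X.carrier).lTensor V.carrier ∘ₗ
        (TensorProduct.assoc k V.carrier W.carrier X.carrier).toLinearMap ∘ₗ
        (incl V W).rTensor X.carrier := by
    have e3 : (TensorProduct.assoc k V.carrier W.carrier (C ⊗[k] X.carrier)).toLinearMap ∘ₗ
      (incl V W).rTensor (C ⊗[k] X.carrier) ∘ₗ
      (TensorProduct.assoc k (cten V W).carrier C X.carrier).toLinearMap =
      (TensorProduct.assoc k V.carrier W.carrier (C ⊗[k] X.carrier)).toLinearMap ∘ₗ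
      (TensorProduct.assoc k (V.carrier ⊗[k] W.carrier) C X.carrier).toLinearMap ∘ₗ
      ((incl V W).rTensor C).rTensor X.carrier := by
      ext a c x
      simp
    ext a x
    have h3 := LinearMap.congr_fun e3 ((cten V W).coact a ⊗ₜ x)
    simp only [LinearMap.comp_apply, LinearEquiv.coe_coe, LinearMap.rTensor_tmul,
      incl_coact] at h3
    simp only [TensorProduct.AlgebraTensorModule.curry_apply, LinearMap.restrictScalars_self,
      TensorProduct.curry_apply, LinearMap.comp_apply, LinearEquiv.coe_coe,
      LinearMap.rTensor_tmul]
    rw [h3]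
    generalize incl V W a = y
    induction y using TensorProduct.induction_on with
    | zero => simp
    | add p q hp hq => simp only [TensorProduct.add_tmul, map_add, hp, hq]
    | tmul v w =>
      obtain ⟨s, hs⟩ := TensorProduct.exists_finset (W.coact w)
      simp [hs, TensorProduct.sum_tmul, TensorProduct.tmul_sum]
  have h1 := LinearMap.congr_fun e1 (incl (cten V W) X z)
  have h2 := LinearMap.congr_fun e2 (incl (cten V W) X z)
  simp only [LinearMap.comp_apply, LinearEquiv.coe_coe] at h h1 h2
  exact h2.symm.trans (h.trans h1)

lemma lTensor_incl_injective (V W X : Comod k C) :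
    Function.Injective ((incl W X).lTensor V.carrier) :=
  Module.Flat.lTensor_preserves_injective_linearMap _ (incl_injective W X)

lemma rTensor_incl_injective (V W X : Comod k C) :
    Function.Injective ((incl V W).rTensor X.carrier) :=
  Module.Flat.rTensor_preserves_injective_linearMap _ (incl_injective V W)

/-- First lift of the associator. -/
def assocAux' (V W X : Comod k C) :
    (cten (cten V W) X).carrier →ₗ[k] V.carrier ⊗[k] (cten W X).carrier :=
  factorThrough ((incl W X).lTensor V.carrier) (lTensor_incl_injective V W X)
    (assocAux V W X) (assocAux_mem V W X)

lemma incl_assocAux' (V W X : Comod k C) (z : (cten (cten V W) X).carrier) :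
    (incl W X).lTensor V.carrier (assocAux' V W X z) = assocAux V W X z :=
  factorThrough_apply _ _ _ _ z

lemma assocAux'_eq (V W X : Comod k C) :
    (TensorProduct.assoc k V.carrier C (cten W X).carrier).toLinearMap ∘ₗ
      V.coact.rTensor (cten W X).carrier ∘ₗ assocAux' V W X =
    (cten W X).lcoact.lTensor V.carrier ∘ₗ assocAux' V W X := by
  apply LinearMap.ext
  intro z
  apply Module.Flat.lTensor_preserves_injective_linearMap (M := V.carrier) ((incl W X).lTensor C)
    (Module.Flat.lTensor_preserves_injective_linearMap _ (incl_injective W X))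
  have e1 : ((incl W X).lTensor C).lTensor V.carrier ∘ₗ
      (TensorProduct.assoc k V.carrier C (cten W X).carrier).toLinearMap ∘ₗ
      V.coact.rTensor (cten W X).carrier =
      (TensorProduct.assoc k V.carrier C (W.carrier ⊗[k] X.carrier)).toLinearMap ∘ₗ
      V.coact.rTensor (W.carrier ⊗[k] X.carrier) ∘ₗ (incl W X).lTensor V.carrier := by
    ext v a
    obtain ⟨s, hs⟩ := TensorProduct.exists_finset (V.coact v)
    simp [hs, TensorProduct.sum_tmul]
  have e2 : ((incl W X).lTensor C).lTensor V.carrier ∘ₗ (cten W X).lcoact.lTensor V.carrier =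
      ((TensorProduct.assoc k C W.carrier X.carrier).toLinearMap ∘ₗ
        W.lcoact.rTensor X.carrier).lTensor V.carrier ∘ₗ (incl W X).lTensor V.carrier := by
    ext v a
    simp [incl_lcoact]
  have e3 : (TensorProduct.assoc k V.carrier C (W.carrier ⊗[k] X.carrier)).toLinearMap ∘ₗ
      V.coact.rTensor (W.carrier ⊗[k] X.carrier) ∘ₗ
      (TensorProduct.assoc k V.carrier W.carrier X.carrier).toLinearMap =
      (TensorProduct.assoc k C W.carrier X.carrier).toLinearMap.lTensor V.carrier ∘ₗ
      (TensorProduct.assoc k V.carrier (C ⊗[k] W.carrier) X.carrier).toLinearMap ∘ₗ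
      ((TensorProduct.assoc k V.carrier C W.carrier).toLinearMap ∘ₗ
        V.coact.rTensor W.carrier).rTensor X.carrier := by
    ext v w x
    obtain ⟨s, hs⟩ := TensorProduct.exists_finset (V.coact v)
    simp [hs, TensorProduct.sum_tmul]
  have e4 : ((TensorProduct.assoc k C W.carrier X.carrier).toLinearMap ∘ₗ
        W.lcoact.rTensor X.carrier).lTensor V.carrier ∘ₗ
      (TensorProduct.assoc k V.carrier W.carrier X.carrier).toLinearMap =
      (TensorProduct.assoc k C W.carrier X.carrier).toLinearMap.lTensor V.carrier ∘ₗ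
      (TensorProduct.assoc k V.carrier (C ⊗[k] W.carrier) X.carrier).toLinearMap ∘ₗ
      (W.lcoact.lTensor V.carrier).rTensor X.carrier := by
    ext v w x
    simp
  have e5 : ((TensorProduct.assoc k V.carrier C W.carrier).toLinearMap ∘ₗ
        V.coact.rTensor W.carrier).rTensor X.carrier ∘ₗ (incl V W).rTensor X.carrier =
      (W.lcoact.lTensor V.carrier).rTensor X.carrier ∘ₗ (incl V W).rTensor X.carrier := by
    ext a x
    simp [incl_eq]
  have h1 := LinearMap.congr_fun e1 (assocAux' V W X z)
  have h2 := LinearMap.congr_fun e2 (assocAux' V W X z)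
  have h3 := LinearMap.congr_fun e3 ((incl V W).rTensor X.carrier (incl (cten V W) X z))
  have h4 := LinearMap.congr_fun e4 ((incl V W).rTensor X.carrier (incl (cten V W) X z))
  have h5 := LinearMap.congr_fun e5 (incl (cten V W) X z)
  simp only [LinearMap.comp_apply, LinearEquiv.coe_coe, incl_assocAux'] at h1 h2 h3 h4 h5 ⊢
  rw [h1, h2]
  simp only [assocAux, LinearMap.comp_apply, LinearEquiv.coe_coe]
  rw [h3, h4, h5]

/-- The linear map underlying the associator. -/
def assocLin (V W X : Comod k C) :
    (cten (cten V W) X).carrier →ₗ[k] (cten V (cten W X)).carrier :=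
  cotensorLift V (cten W X) (cten W X).isBicomod_lcoact (assocAux' V W X) (assocAux'_eq V W X)

lemma incl_assocLin (V W X : Comod k C) (z : (cten (cten V W) X).carrier) :
    (incl W X).lTensor V.carrier (incl V (cten W X) (assocLin V W X z)) =
      TensorProduct.assoc k V.carrier W.carrier X.carrier
        ((incl V W).rTensor X.carrier (incl (cten V W) X z)) :=
  incl_assocAux' V W X z

lemma assocLin_colinear (V W X : Comod k C) :
    (cten V (cten W X)).coact ∘ₗ assocLin V W X =
      (assocLin V W X).rTensor C ∘ₗ (cten (cten V W) X).coact := by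
  apply LinearMap.ext
  intro z
  apply Module.Flat.rTensor_preserves_injective_linearMap (M := C)
    ((incl W X).lTensor V.carrier ∘ₗ incl V (cten W X))
    ((lTensor_incl_injective V W X).comp (incl_injective V (cten W X)))
  have e1 : ((incl W X).lTensor V.carrier).rTensor C ∘ₗ
      (TensorProduct.assoc k V.carrier (cten W X).carrier C).symm.toLinearMap ∘ₗ
      (cten W X).coact.lTensor V.carrier =
      (TensorProduct.assoc k V.carrier (W.carrier ⊗[k] X.carrier) C).symm.toLinearMap ∘ₗ
      ((TensorProduct.assoc k W.carrier X.carrier C).symm.toLinearMap ∘ₗ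
        X.coact.lTensor W.carrier).lTensor V.carrier ∘ₗ (incl W X).lTensor V.carrier := by
    have e2 : ((incl W X).lTensor V.carrier).rTensor C ∘ₗ
      (TensorProduct.assoc k V.carrier (cten W X).carrier C).symm.toLinearMap =
      (TensorProduct.assoc k V.carrier (W.carrier ⊗[k] X.carrier) C).symm.toLinearMap ∘ₗ
        ((incl W X).rTensor C).lTensor V.carrier := by
      ext v a c
      simp
    rw [← LinearMap.comp_assoc, e2]
    ext v a
    simp [incl_coact]
  have e2 : ((incl W X).lTensor V.carrier ∘ₗ incl V (cten W X)) ∘ₗ assocLin V W X =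
      (TensorProduct.assoc k V.carrier W.carrier X.carrier).toLinearMap ∘ₗ
        (incl V W).rTensor X.carrier ∘ₗ incl (cten V W) X :=
    LinearMap.ext (incl_assocLin V W X)
  have e3 : ((incl V W).rTensor X.carrier).rTensor C ∘ₗ
      (TensorProduct.assoc k (cten V W).carrier X.carrier C).symm.toLinearMap ∘ₗ
      X.coact.lTensor (cten V W).carrier =
      (TensorProduct.assoc k (V.carrier ⊗[k] W.carrier) X.carrier C).symm.toLinearMap ∘ₗ
      X.coact.lTensor (V.carrier ⊗[k] W.carrier) ∘ₗ (incl V W).rTensor X.carrier := by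
    ext a x
    obtain ⟨s, hs⟩ := TensorProduct.exists_finset (X.coact x)
    simp [hs, TensorProduct.tmul_sum]
  have e4 : (TensorProduct.assoc k V.carrier (W.carrier ⊗[k] X.carrier) C).symm.toLinearMap ∘ₗ
      ((TensorProduct.assoc k W.carrier X.carrier C).symm.toLinearMap ∘ₗ
        X.coact.lTensor W.carrier).lTensor V.carrier ∘ₗ
      (TensorProduct.assoc k V.carrier W.carrier X.carrier).toLinearMap =
      (TensorProduct.assoc k V.carrier W.carrier X.carrier).toLinearMap.rTensor C ∘ₗ
      (TensorProduct.assoc k (V.carrier ⊗[k] W.carrier) X.carrier C).symm.toLinearMap ∘ₗ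
      X.coact.lTensor (V.carrier ⊗[k] W.carrier) := by
    ext v w x
    obtain ⟨s, hs⟩ := TensorProduct.exists_finset (X.coact x)
    simp [hs, TensorProduct.tmul_sum]
  have h1 := LinearMap.congr_fun e1 (incl V (cten W X) (assocLin V W X z))
  have h3 := LinearMap.congr_fun e3 (incl (cten V W) X z)
  have h4 := LinearMap.congr_fun e4 ((incl V W).rTensor X.carrier (incl (cten V W) X z))
  have h5 := LinearMap.congr_fun (congrArg (LinearMap.rTensor C) e2) ((cten (cten V W) X).coact z)
  simp only [LinearMap.rTensor_comp, LinearMap.comp_apply, LinearEquiv.coe_coe, incl_coact,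
    incl_assocLin] at h1 h3 h4 h5 ⊢
  rw [h1, h5, h3, h4]

end Comod
end Monoidal

section Structure

variable {k : Type u} [Field k] {C : Type u} [AddCommGroup C] [Module k C] [Coalgebra k C]
  [Coalgebra.IsCocomm k C]

namespace Comod

lemma braidAux_eq (V W : Comod k C) :
    (TensorProduct.assoc k W.carrier C V.carrier).toLinearMap ∘ₗ W.coact.rTensor V.carrier ∘ₗ
      (TensorProduct.comm k V.carrier W.carrier).toLinearMap ∘ₗ incl V W =
    V.lcoact.lTensor W.carrier ∘ₗ
      (TensorProduct.comm k V.carrier W.carrier).toLinearMap ∘ₗ incl V W := by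
  have e1 : (TensorProduct.assoc k W.carrier C V.carrier).toLinearMap ∘ₗ
      W.coact.rTensor V.carrier ∘ₗ (TensorProduct.comm k V.carrier W.carrier).toLinearMap =
      (TensorProduct.assoc k W.carrier C V.carrier).toLinearMap ∘ₗ
      (TensorProduct.comm k C W.carrier).toLinearMap.rTensor V.carrier ∘ₗ
      (TensorProduct.comm k V.carrier (C ⊗[k] W.carrier)).toLinearMap ∘ₗ
      W.lcoact.lTensor V.carrier := by
    ext v w
    obtain ⟨s, hs⟩ := TensorProduct.exists_finset (W.coact w)
    simp [lcoact, hs, TensorProduct.sum_tmul, TensorProduct.tmul_sum]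
  have e2 : V.lcoact.lTensor W.carrier ∘ₗ
      (TensorProduct.comm k V.carrier W.carrier).toLinearMap =
      (TensorProduct.assoc k W.carrier C V.carrier).toLinearMap ∘ₗ
      (TensorProduct.comm k C W.carrier).toLinearMap.rTensor V.carrier ∘ₗ
      (TensorProduct.comm k V.carrier (C ⊗[k] W.carrier)).toLinearMap ∘ₗ
      (TensorProduct.assoc k V.carrier C W.carrier).toLinearMap ∘ₗ
      V.coact.rTensor W.carrier := by
    ext v w
    obtain ⟨s, hs⟩ := TensorProduct.exists_finset (V.coact v)
    simp [lcoact, hs, TensorProduct.sum_tmul, TensorProduct.tmul_sum]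
  apply LinearMap.ext
  intro x
  have h1 := LinearMap.congr_fun e1 (incl V W x)
  have h2 := LinearMap.congr_fun e2 (incl V W x)
  simp only [LinearMap.comp_apply, LinearEquiv.coe_coe, incl_eq] at h1 h2 ⊢
  rw [h1, h2]

/-- The linear map underlying the symmetry: the restriction of `v ⊗ w ↦ w ⊗ v`. -/
def braidLin (V W : Comod k C) : (cten V W).carrier →ₗ[k] (cten W V).carrier :=
  cotensorLift W V V.isBicomod_lcoact
    ((TensorProduct.comm k V.carrier W.carrier).toLinearMap ∘ₗ incl V W) (braidAux_eq V W)

lemma incl_braidLin (V W : Comod k C) (x : (cten V W).carrier) :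
    incl W V (braidLin V W x) = TensorProduct.comm k V.carrier W.carrier (incl V W x) := rfl

lemma braidLin_colinear (V W : Comod k C) :
    (cten W V).coact ∘ₗ braidLin V W = (braidLin V W).rTensor C ∘ₗ (cten V W).coact := by
  apply LinearMap.ext
  intro x
  apply Module.Flat.rTensor_preserves_injective_linearMap (M := C) _ (incl_injective W V)
  have e1 : (incl W V).rTensor C ∘ₗ (braidLin V W).rTensor C =
      (TensorProduct.comm k V.carrier W.carrier).toLinearMap.rTensor C ∘ₗ
        (incl V W).rTensor C := by
    rw [← LinearMap.rTensor_comp, ← LinearMap.rTensor_comp]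
    rfl
  have e2 : (TensorProduct.assoc k W.carrier V.carrier C).symm.toLinearMap ∘ₗ
      V.coact.lTensor W.carrier ∘ₗ (TensorProduct.comm k V.carrier W.carrier).toLinearMap =
      (TensorProduct.comm k V.carrier W.carrier).toLinearMap.rTensor C ∘ₗ
      (TensorProduct.assoc k V.carrier W.carrier C).symm.toLinearMap ∘ₗ
      (TensorProduct.comm k C W.carrier).toLinearMap.lTensor V.carrier ∘ₗ
      (TensorProduct.assoc k V.carrier C W.carrier).toLinearMap ∘ₗ
      V.coact.rTensor W.carrier := by
    ext v w
    obtain ⟨s, hs⟩ := TensorProduct.exists_finset (V.coact v)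
    simp [hs, TensorProduct.sum_tmul, TensorProduct.tmul_sum]
  have e3 : (TensorProduct.comm k C W.carrier).toLinearMap.lTensor V.carrier ∘ₗ
      W.lcoact.lTensor V.carrier = W.coact.lTensor V.carrier := by
    rw [← LinearMap.lTensor_comp]
    congr 1
    apply LinearMap.ext
    intro w
    exact (TensorProduct.comm k W.carrier C).symm_apply_apply _
  have h1 := LinearMap.congr_fun e1 ((cten V W).coact x)
  have h2 := LinearMap.congr_fun e2 (incl V W x)
  have h3 := LinearMap.congr_fun e3 (incl V W x)
  simp only [LinearMap.comp_apply, LinearEquiv.coe_coe, incl_eq, incl_coact, incl_braidLin]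
    at h1 h2 h3 ⊢
  rw [h1, h2, h3]

/-- The symmetry of the cotensor product. -/
def braid (V W : Comod k C) : cten V W ≅ cten W V :=
  isoMk (ofLin (braidLin V W) (braidLin_colinear V W)) (braidLin W V)
    (LinearMap.ext fun x => incl_injective V W (by
      simp only [toLin_ofLin, LinearMap.comp_apply, incl_braidLin, LinearMap.id_apply]
      exact (TensorProduct.comm k V.carrier W.carrier).symm_apply_apply _))
    (LinearMap.ext fun x => incl_injective W V (by
      simp only [toLin_ofLin, LinearMap.comp_apply, incl_braidLin, LinearMap.id_apply]
      exact (TensorProduct.comm k W.carrier V.carrier).symm_apply_apply _))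

lemma incl_braid (V W : Comod k C) (x : (cten V W).carrier) :
    incl W V (toLin (braid V W).hom x) =
      TensorProduct.comm k V.carrier W.carrier (incl V W x) := rfl

/-- The inverse of the associator, obtained from the associator and the symmetry. -/
def assocInv (V W X : Comod k C) :
    (cten V (cten W X)).carrier →ₗ[k] (cten (cten V W) X).carrier :=
  toLin (braid X (cten V W)).hom ∘ₗ toLin (ctenMap (𝟙 X) (braid W V).hom) ∘ₗ
    assocLin X W V ∘ₗ toLin (ctenMap (braid W X).hom (𝟙 V)) ∘ₗ toLin (braid V (cten W X)).hom

lemma incl_assocInv (V W X : Comod k C) (y : (cten V (cten W X)).carrier) :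
    (incl V W).rTensor X.carrier (incl (cten V W) X (assocInv V W X y)) =
      (TensorProduct.assoc k V.carrier W.carrier X.carrier).symm
        ((incl W X).lTensor V.carrier (incl V (cten W X) y)) := by
  have e1 : (incl V W).rTensor X.carrier ∘ₗ
      (TensorProduct.comm k X.carrier (cten V W).carrier).toLinearMap ∘ₗ
      TensorProduct.map LinearMap.id (toLin (braid W V).hom) =
      (TensorProduct.comm k X.carrier (V.carrier ⊗[k] W.carrier)).toLinearMap ∘ₗ
      (TensorProduct.comm k W.carrier V.carrier).toLinearMap.lTensor X.carrier ∘ₗ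
      (incl W V).lTensor X.carrier := by
    ext x a
    simp [incl_braid]
  have e2 : (incl X W).rTensor V.carrier ∘ₗ
      TensorProduct.map (toLin (braid W X).hom) LinearMap.id ∘ₗ
      (TensorProduct.comm k V.carrier (cten W X).carrier).toLinearMap =
      (TensorProduct.comm k W.carrier X.carrier).toLinearMap.rTensor V.carrier ∘ₗ
      (TensorProduct.comm k V.carrier (W.carrier ⊗[k] X.carrier)).toLinearMap ∘ₗ
      (incl W X).lTensor V.carrier := by
    ext x a
    simp [incl_braid]
  have e3 : (TensorProduct.comm k X.carrier (V.carrier ⊗[k] W.carrier)).toLinearMap ∘ₗ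
      (TensorProduct.comm k W.carrier V.carrier).toLinearMap.lTensor X.carrier ∘ₗ
      (TensorProduct.assoc k X.carrier W.carrier V.carrier).toLinearMap ∘ₗ
      (TensorProduct.comm k W.carrier X.carrier).toLinearMap.rTensor V.carrier ∘ₗ
      (TensorProduct.comm k V.carrier (W.carrier ⊗[k] X.carrier)).toLinearMap =
      (TensorProduct.assoc k V.carrier W.carrier X.carrier).symm.toLinearMap := by
    ext v w x
    simp
  have h1 := LinearMap.congr_fun e1 (incl X (cten W V) (assocLin X W V
    (toLin (ctenMap (braid W X).hom (𝟙 V)) (toLin (braid V (cten W X)).hom y))))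
  have h2 := LinearMap.congr_fun e2 (incl V (cten W X) y)
  have h3 := LinearMap.congr_fun e3 ((incl W X).lTensor V.carrier (incl V (cten W X) y))
  simp only [LinearMap.comp_apply, LinearEquiv.coe_coe, incl_assocLin, incl_ctenMap, toLin_id,
    incl_braid, assocInv] at h1 h2 h3 ⊢
  rw [h1, h2, h3]

/-- The associator of the cotensor product. -/
def assocIso (V W X : Comod k C) : cten (cten V W) X ≅ cten V (cten W X) :=
  isoMk (ofLin (assocLin V W X) (assocLin_colinear V W X)) (assocInv V W X)
    (LinearMap.ext fun z => incl_injective _ _ (rTensor_incl_injective V W X (by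
      rw [toLin_ofLin, LinearMap.comp_apply, incl_assocInv, incl_assocLin]
      simp)))
    (LinearMap.ext fun z => incl_injective _ _ (lTensor_incl_injective V W X (by
      rw [toLin_ofLin, LinearMap.comp_apply, incl_assocLin, incl_assocInv]
      simp)))

lemma incl_assocIso (V W X : Comod k C) (z : (cten (cten V W) X).carrier) :
    (incl W X).lTensor V.carrier (incl V (cten W X) (toLin (assocIso V W X).hom z)) =
      TensorProduct.assoc k V.carrier W.carrier X.carrier
        ((incl V W).rTensor X.carrier (incl (cten V W) X z)) :=
  incl_assocLin V W X z

/-- The inverse of the left unitor: the left coaction. -/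
def lunitInv (V : Comod k C) : V ⟶ cten (regular k C) V :=
  ofLin (cotensorLift (regular k C) V V.isBicomod_lcoact V.lcoact (lcoact_coassoc V))
    (cotensor_colinear (regular k C) V V.isBicomod_lcoact _ (by
      rw [cotensorIncl_lift, ← V.isBicomod_lcoact]
      apply LinearMap.ext
      intro x
      exact (TensorProduct.assoc k C V.carrier C).symm_apply_apply _))

lemma incl_lunitInv (V : Comod k C) (v : V.carrier) :
    incl (regular k C) V (toLin (lunitInv V) v) = V.lcoact v := rfl

/-- The left unitor: the restriction of `ε ⊗ id`. -/
def lunitLin (V : Comod k C) : (cten (regular k C) V).carrier →ₗ[k] V.carrier :=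
  (TensorProduct.lid k V.carrier).toLinearMap ∘ₗ
    (Coalgebra.counit (R := k) (A := C)).rTensor V.carrier ∘ₗ incl (regular k C) V

lemma lunitLin_comp (V : Comod k C) : lunitLin V ∘ₗ toLin (lunitInv V) = LinearMap.id := by
  apply LinearMap.ext
  intro v
  have e : (TensorProduct.lid k V.carrier).toLinearMap ∘ₗ
      (Coalgebra.counit (R := k) (A := C)).rTensor V.carrier ∘ₗ
      (TensorProduct.comm k V.carrier C).toLinearMap =
      (TensorProduct.rid k V.carrier).toLinearMap ∘ₗ
      (Coalgebra.counit (R := k) (A := C)).lTensor V.carrier := by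
    ext v c
    simp
  have h := LinearMap.congr_fun e (V.coact v)
  simp only [LinearMap.comp_apply, LinearEquiv.coe_coe] at h
  rw [V.counit_apply] at h
  exact h

lemma comp_lunitLin (V : Comod k C) : toLin (lunitInv V) ∘ₗ lunitLin V = LinearMap.id := by
  apply LinearMap.ext
  intro x
  apply incl_injective
  have e1 : V.lcoact ∘ₗ (TensorProduct.lid k V.carrier).toLinearMap ∘ₗ
      (Coalgebra.counit (R := k) (A := C)).rTensor V.carrier =
      (TensorProduct.lid k (C ⊗[k] V.carrier)).toLinearMap ∘ₗ
      (Coalgebra.counit (R := k) (A := C)).rTensor (C ⊗[k] V.carrier) ∘ₗ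
      V.lcoact.lTensor C := by
    ext c v
    simp
  have e2 : (TensorProduct.lid k (C ⊗[k] V.carrier)).toLinearMap ∘ₗ
      (Coalgebra.counit (R := k) (A := C)).rTensor (C ⊗[k] V.carrier) ∘ₗ
      (TensorProduct.assoc k C C V.carrier).toLinearMap =
      ((TensorProduct.lid k C).toLinearMap ∘ₗ
        (Coalgebra.counit (R := k) (A := C)).rTensor C).rTensor V.carrier := by
    ext c d v
    simp [TensorProduct.smul_tmul']
  have e3 : ((TensorProduct.lid k C).toLinearMap ∘ₗ
        (Coalgebra.counit (R := k) (A := C)).rTensor C).rTensor V.carrier ∘ₗ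
      (Coalgebra.comul (R := k) (A := C)).rTensor V.carrier = LinearMap.id := by
    ext c v
    simp
  have h1 := LinearMap.congr_fun e1 (incl (regular k C) V x)
  have h2 := LinearMap.congr_fun e2
    ((Coalgebra.comul (R := k) (A := C)).rTensor V.carrier (incl (regular k C) V x))
  have h3 := LinearMap.congr_fun e3 (incl (regular k C) V x)
  have h4 := incl_eq (regular k C) V x
  simp only [LinearMap.comp_apply, LinearEquiv.coe_coe, LinearMap.id_apply] at h1 h2 h3 ⊢
  rw [incl_lunitInv]
  refine h1.trans ?_
  refine Eq.trans ?_ (h2.trans h3)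
  exact congrArg (fun t => TensorProduct.lid k (C ⊗[k] V.carrier)
    ((Coalgebra.counit (R := k) (A := C)).rTensor (C ⊗[k] V.carrier) t)) h4.symm

/-- The left unitor. -/
def lunit (V : Comod k C) : cten (regular k C) V ≅ V :=
  (isoMk (lunitInv V) (lunitLin V) (lunitLin_comp V) (comp_lunitLin V)).symm

lemma lunit_hom (V : Comod k C) (x : (cten (regular k C) V).carrier) :
    toLin (lunit V).hom x = TensorProduct.lid k V.carrier
      ((Coalgebra.counit (R := k) (A := C)).rTensor V.carrier (incl (regular k C) V x)) := rfl

/-- The right unitor. -/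
def runit (V : Comod k C) : cten V (regular k C) ≅ V := braid V (regular k C) ≪≫ lunit V

lemma runit_hom (V : Comod k C) (x : (cten V (regular k C)).carrier) :
    toLin (runit V).hom x = TensorProduct.rid k V.carrier
      ((Coalgebra.counit (R := k) (A := C)).lTensor V.carrier (incl V (regular k C) x)) := by
  have e : (TensorProduct.lid k V.carrier).toLinearMap ∘ₗ
      (Coalgebra.counit (R := k) (A := C)).rTensor V.carrier ∘ₗ
      (TensorProduct.comm k V.carrier C).toLinearMap =
      (TensorProduct.rid k V.carrier).toLinearMap ∘ₗ
      (Coalgebra.counit (R := k) (A := C)).lTensor V.carrier := by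
    ext v c
    simp
  exact LinearMap.congr_fun e (incl V (regular k C) x)

instance : MonoidalCategoryStruct (Comod k C) where
  tensorObj V W := cten V W
  whiskerLeft V _ _ g := ctenMap (𝟙 V) g
  whiskerRight f W := ctenMap f (𝟙 W)
  tensorHom f g := ctenMap f g
  tensorUnit := regular k C
  associator := assocIso
  leftUnitor := lunit
  rightUnitor := runit

/-- The inclusion of the cotensor product into the tensor product, for the monoidal structure. -/
abbrev ι (V W : Comod k C) : (V ⊗ W : Comod k C).carrier →ₗ[k] V.carrier ⊗[k] W.carrier :=
  incl V W

/-- The forgetful functor to vector spaces. -/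
def forgetVec : Comod k C ⥤ ModuleCat.{u} k where
  obj V := ModuleCat.of k V.carrier
  map f := ModuleCat.ofHom (toLin f)

/-- The inclusion of the cotensor product as a morphism of vector spaces. -/
def δι (V W : Comod k C) : forgetVec.obj (V ⊗ W) ⟶ forgetVec.obj V ⊗ forgetVec.obj W :=
  ModuleCat.ofHom (incl V W)

/-- The counit as a morphism of vector spaces. -/
def ηι : forgetVec.obj (𝟙_ (Comod k C)) ⟶ 𝟙_ (ModuleCat.{u} k) :=
  ModuleCat.ofHom (Coalgebra.counit (R := k) (A := C))

instance : (forgetVec (k := k) (C := C)).Faithful where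
  map_injective h := hom_ext (congrArg ModuleCat.Hom.hom h)

instance (V W : Comod k C) : Mono (δι V W) :=
  (ModuleCat.mono_iff_injective _).mpr (incl_injective V W)

instance (X : ModuleCat.{u} k) (V W : Comod k C) : Mono (X ◁ δι V W) :=
  (ModuleCat.mono_iff_injective _).mpr
    (Module.Flat.lTensor_preserves_injective_linearMap (M := X) _ (incl_injective V W))

variable {X' : ModuleCat.{u} k}

lemma δι_tensorHom {V V' W W' : Comod k C} (f : V ⟶ V') (g : W ⟶ W')
    (h : forgetVec.obj V' ⊗ forgetVec.obj W' ⟶ X') :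
    forgetVec.map (f ⊗ₘ g) ≫ δι V' W' ≫ h =
      δι V W ≫ (forgetVec.map f ⊗ₘ forgetVec.map g) ≫ h := rfl

lemma δι_assoc (V W X : Comod k C) :
    forgetVec.map (α_ V W X).hom ≫ δι V (W ⊗ X) ≫ forgetVec.obj V ◁ δι W X =
      δι (V ⊗ W) X ≫ δι V W ▷ forgetVec.obj X ≫ (α_ _ _ _).hom := by
  apply ModuleCat.hom_ext
  apply LinearMap.ext
  intro x
  exact incl_assocIso V W X x

lemma δι_assoc' (V W X : Comod k C)
    (h : forgetVec.obj V ⊗ forgetVec.obj W ⊗ forgetVec.obj X ⟶ X') :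
    forgetVec.map (α_ V W X).hom ≫ δι V (W ⊗ X) ≫ forgetVec.obj V ◁ δι W X ≫ h =
      δι (V ⊗ W) X ≫ δι V W ▷ forgetVec.obj X ≫ (α_ _ _ _).hom ≫ h := by
  have := congrArg (fun t => t ≫ h) (δι_assoc V W X)
  simpa only [Category.assoc] using this

lemma δι_leftUnitor (V : Comod k C) : forgetVec.map (λ_ V).hom =
    δι (𝟙_ _) V ≫ ηι ▷ forgetVec.obj V ≫ (λ_ _).hom := rfl

lemma δι_rightUnitor (V : Comod k C) : forgetVec.map (ρ_ V).hom =
    δι V (𝟙_ _) ≫ forgetVec.obj V ◁ ηι ≫ (ρ_ _).hom := by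
  apply ModuleCat.hom_ext
  apply LinearMap.ext
  intro x
  exact runit_hom V x

/-- The symmetry, for the monoidal structure. -/
def swap (V W : Comod k C) : V ⊗ W ≅ W ⊗ V := braid V W

lemma δι_braid (V W : Comod k C) (h : forgetVec.obj W ⊗ forgetVec.obj V ⟶ X') :
    forgetVec.map (swap V W).hom ≫ δι W V ≫ h =
    δι V W ≫ (β_ (forgetVec.obj V) (forgetVec.obj W)).hom ≫ h := rfl

lemma hom_ext_δι {V W X : Comod k C} {f g : V ⟶ W ⊗ X}
    (h : forgetVec.map f ≫ δι W X = forgetVec.map g ≫ δι W X) : f = g :=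
  forgetVec.map_injective ((cancel_mono (δι W X)).mp h)

lemma hom_ext_δι₂ {V W X Y : Comod k C} {f g : V ⟶ W ⊗ X ⊗ Y}
    (h : forgetVec.map f ≫ δι W (X ⊗ Y) ≫ forgetVec.obj W ◁ δι X Y =
      forgetVec.map g ≫ δι W (X ⊗ Y) ≫ forgetVec.obj W ◁ δι X Y) : f = g := by
  apply hom_ext_δι
  rw [← cancel_mono (forgetVec.obj W ◁ δι X Y), Category.assoc, Category.assoc, h]

end Comod
end Structure

section MonoidalCat

variable {k : Type u} [Field k] {C : Type u} [AddCommGroup C] [Module k C] [Coalgebra k C]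
  [Coalgebra.IsCocomm k C]

namespace Comod

lemma forget_tensorHom_δι {V V' W W' : Comod k C} (f : V ⟶ V') (g : W ⟶ W') :
    forgetVec.map (f ⊗ₘ g) ≫ δι V' W' =
      δι V W ≫ (forgetVec.map f ⊗ₘ forgetVec.map g) := rfl

lemma assoc_nat {V V' W W' X X' : Comod k C} (f : V ⟶ V') (g : W ⟶ W') (h : X ⟶ X') :
    ((f ⊗ₘ g) ⊗ₘ h) ≫ (α_ V' W' X').hom = (α_ V W X).hom ≫ (f ⊗ₘ (g ⊗ₘ h)) := by
  apply hom_ext_δι₂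
  rw [Functor.map_comp, Functor.map_comp, Category.assoc, Category.assoc, δι_assoc,
    δι_tensorHom, δι_tensorHom]
  have e1 : (forgetVec.map (f ⊗ₘ g) ⊗ₘ forgetVec.map h) ≫ δι V' W' ▷ forgetVec.obj X' =
      δι V W ▷ forgetVec.obj X ≫
        ((forgetVec.map f ⊗ₘ forgetVec.map g) ⊗ₘ forgetVec.map h) := by
    rw [tensorHom_comp_whiskerRight, forget_tensorHom_δι, whiskerRight_comp_tensorHom]
  have e2 : (forgetVec.map f ⊗ₘ forgetVec.map (g ⊗ₘ h)) ≫ forgetVec.obj V' ◁ δι W' X' =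
      forgetVec.obj V ◁ δι W X ≫
        (forgetVec.map f ⊗ₘ (forgetVec.map g ⊗ₘ forgetVec.map h)) := by
    rw [tensorHom_comp_whiskerLeft, forget_tensorHom_δι, whiskerLeft_comp_tensorHom]
  rw [reassoc_of% e1, e2, δι_assoc', MonoidalCategory.associator_naturality]

lemma forget_whiskerLeft (V : Comod k C) {W W' : Comod k C} (g : W ⟶ W') {X' : ModuleCat.{u} k}
    (h : forgetVec.obj V ⊗ forgetVec.obj W' ⟶ X') :
    forgetVec.map (V ◁ g) ≫ δι V W' ≫ h = δι V W ≫ forgetVec.obj V ◁ forgetVec.map g ≫ h := rfl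

lemma forget_whiskerRight {V V' : Comod k C} (f : V ⟶ V') (W : Comod k C) {X' : ModuleCat.{u} k}
    (h : forgetVec.obj V' ⊗ forgetVec.obj W ⟶ X') :
    forgetVec.map (f ▷ W) ≫ δι V' W ≫ h = δι V W ≫ forgetVec.map f ▷ forgetVec.obj W ≫ h := rfl

lemma triangle_aux (V W : Comod k C) :
    (α_ V (𝟙_ (Comod k C)) W).hom ≫ V ◁ (λ_ W).hom = (ρ_ V).hom ▷ W := by
  apply hom_ext_δι
  rw [← Category.comp_id (δι V W), Functor.map_comp, Category.assoc, forget_whiskerLeft,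
    forget_whiskerRight, δι_leftUnitor, δι_rightUnitor]
  simp only [MonoidalCategory.whiskerLeft_comp, MonoidalCategory.comp_whiskerRight,
    Category.assoc, δι_assoc']
  rw [← MonoidalCategory.triangle, Category.assoc, ← MonoidalCategory.associator_naturality_middle_assoc]

lemma pentagon_aux (V W X Y : Comod k C) :
    (α_ V W X).hom ▷ Y ≫ (α_ V (W ⊗ X) Y).hom ≫ V ◁ (α_ W X Y).hom =
      (α_ (V ⊗ W) X Y).hom ≫ (α_ V W (X ⊗ Y)).hom := by
  apply hom_ext_δι₂
  have : Mono (forgetVec.obj V ◁ forgetVec.obj W ◁ δι X Y) :=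
    (ModuleCat.mono_iff_injective _).mpr (show Function.Injective
      (((incl X Y).lTensor W.carrier).lTensor V.carrier) from
        Module.Flat.lTensor_preserves_injective_linearMap _ (lTensor_incl_injective W X Y))
  rw [← cancel_mono (forgetVec.obj V ◁ forgetVec.obj W ◁ δι X Y)]
  have e1 : forgetVec.obj V ◁ forgetVec.map (α_ W X Y).hom ≫
      forgetVec.obj V ◁ δι W (X ⊗ Y) ≫ forgetVec.obj V ◁ forgetVec.obj W ◁ δι X Y =
      forgetVec.obj V ◁ δι (W ⊗ X) Y ≫ forgetVec.obj V ◁ (δι W X ▷ forgetVec.obj Y) ≫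
        forgetVec.obj V ◁ (α_ _ _ _).hom := by
    simp only [← MonoidalCategory.whiskerLeft_comp, δι_assoc]
  have e2 : forgetVec.map (α_ V W X).hom ▷ forgetVec.obj Y ≫
      δι V (W ⊗ X) ▷ forgetVec.obj Y ≫ (forgetVec.obj V ◁ δι W X) ▷ forgetVec.obj Y =
      δι (V ⊗ W) X ▷ forgetVec.obj Y ≫ δι V W ▷ forgetVec.obj X ▷ forgetVec.obj Y ≫
        (α_ _ _ _).hom ▷ forgetVec.obj Y := by
    simp only [← MonoidalCategory.comp_whiskerRight, δι_assoc]
  simp only [Functor.map_comp, Category.assoc]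
  rw [forget_whiskerLeft, e1, δι_assoc', forget_whiskerRight,
    ← MonoidalCategory.associator_naturality_middle_assoc, reassoc_of% e2,
    MonoidalCategory.pentagon, δι_assoc', ← MonoidalCategory.associator_naturality_right,
    ← MonoidalCategory.whisker_exchange_assoc, δι_assoc',
    ← MonoidalCategory.associator_naturality_left_assoc]

instance : MonoidalCategory (Comod k C) where
  tensorHom_def f g := by
    apply hom_ext_δι
    rw [← Category.comp_id (δι _ _), Functor.map_comp, Category.assoc, forget_whiskerLeft,
      forget_whiskerRight, δι_tensorHom, MonoidalCategory.tensorHom_def, Category.assoc]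
  id_tensorHom_id V W := by
    apply hom_ext_δι
    rw [forget_tensorHom_δι]
    simp
  tensorHom_comp_tensorHom f₁ f₂ g₁ g₂ := by
    apply hom_ext_δι
    rw [Functor.map_comp, Category.assoc]
    simp only [forget_tensorHom_δι, δι_tensorHom, Functor.map_comp,
      MonoidalCategory.tensorHom_comp_tensorHom]
  whiskerLeft_id V W := by
    apply hom_ext_δι
    rw [← Category.comp_id (δι _ _), forget_whiskerLeft]
    simp
  id_whiskerRight V W := by
    apply hom_ext_δι
    rw [← Category.comp_id (δι _ _), forget_whiskerRight]
    simp
  associator_naturality := assoc_nat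
  leftUnitor_naturality {V W} f := by
    apply forgetVec.map_injective
    rw [Functor.map_comp, Functor.map_comp, δι_leftUnitor, δι_leftUnitor, forget_whiskerLeft]
    simp only [Category.assoc]
    rw [MonoidalCategory.whisker_exchange_assoc, MonoidalCategory.id_whiskerLeft]
    simp
  rightUnitor_naturality {V W} f := by
    apply forgetVec.map_injective
    rw [Functor.map_comp, Functor.map_comp, δι_rightUnitor, δι_rightUnitor, forget_whiskerRight]
    simp only [Category.assoc]
    rw [← MonoidalCategory.whisker_exchange_assoc, MonoidalCategory.whiskerRight_id]
    simp
  pentagon := pentagon_aux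
  triangle := triangle_aux

lemma swap_symm (V W : Comod k C) : (swap V W).inv = (swap W V).hom := rfl

lemma hexagon_aux (V W X : Comod k C) :
    (α_ V W X).hom ≫ (swap V (W ⊗ X)).hom ≫ (α_ W X V).hom =
      (swap V W).hom ▷ X ≫ (α_ W V X).hom ≫ W ◁ (swap V X).hom := by
  apply hom_ext_δι₂
  have e1 : forgetVec.obj W ◁ forgetVec.map (swap V X).hom ≫ forgetVec.obj W ◁ δι X V =
      forgetVec.obj W ◁ δι V X ≫ forgetVec.obj W ◁ (β_ _ _).hom := by
    have := δι_braid V X (𝟙 _)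
    simp only [Category.comp_id] at this
    simp only [← MonoidalCategory.whiskerLeft_comp, this]
  have e2 : forgetVec.map (swap V W).hom ▷ forgetVec.obj X ≫ δι W V ▷ forgetVec.obj X =
      δι V W ▷ forgetVec.obj X ≫ (β_ _ _).hom ▷ forgetVec.obj X := by
    have := δι_braid V W (𝟙 _)
    simp only [Category.comp_id] at this
    simp only [← MonoidalCategory.comp_whiskerRight, this]
  simp only [Functor.map_comp, Category.assoc]
  rw [δι_assoc, δι_braid, forget_whiskerLeft, e1, δι_assoc', forget_whiskerRight,
    reassoc_of% e2, ← BraidedCategory.braiding_naturality_right_assoc, δι_assoc',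
    BraidedCategory.hexagon_forward]

instance : SymmetricCategory (Comod k C) where
  braiding := swap
  braiding_naturality_right V {W X} f := by
    apply hom_ext_δι
    have := δι_braid V X (𝟙 _)
    simp only [Category.comp_id] at this
    rw [← Category.comp_id (δι X V), Functor.map_comp, Category.assoc, δι_braid,
      Functor.map_comp, Category.assoc, forget_whiskerRight, forget_whiskerLeft, δι_braid]
    simp
  braiding_naturality_left {V W} f X := by
    apply hom_ext_δι
    rw [← Category.comp_id (δι X W), Functor.map_comp, Category.assoc, δι_braid,
      Functor.map_comp, Category.assoc, forget_whiskerRight, forget_whiskerLeft, δι_braid]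
    simp
  hexagon_forward := hexagon_aux
  hexagon_reverse V W X := by
    have h := hexagon_aux X V W
    have h' := congrArg Iso.inv (show α_ X V W ≪≫ swap X (V ⊗ W) ≪≫ α_ V W X =
      whiskerRightIso (swap X V) W ≪≫ α_ V X W ≪≫ whiskerLeftIso V (swap X W) from Iso.ext h)
    simpa only [Iso.trans_inv, whiskerRightIso_inv, whiskerLeftIso_inv, Category.assoc,
      swap_symm] using h'
  symmetry V W := (swap V W).hom_inv_id

end Comod
end MonoidalCat

section Functors

variable {k : Type u} [Field k]

/-- The comodule of a coalgebra map `φ : D → C`: the space `D` with coaction `(id ⊗ φ) ∘ Δ`. -/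
@[reducible] def ofCoalgHom {C D : Type u} [AddCommGroup C] [Module k C] [Coalgebra k C]
    [AddCommGroup D] [Module k D] [Coalgebra k D] (φ : D →ₗc[k] C) : Comod k C where
  carrier := D
  coact := (φ : D →ₗ[k] C).lTensor D ∘ₗ Coalgebra.comul
  coassoc := by
    apply LinearMap.ext
    intro x
    have e1 : (TensorProduct.assoc k D C C).toLinearMap ∘ₗ
        ((φ : D →ₗ[k] C).lTensor D ∘ₗ Coalgebra.comul).rTensor C ∘ₗ (φ : D →ₗ[k] C).lTensor D =
        (TensorProduct.map (φ : D →ₗ[k] C) (φ : D →ₗ[k] C)).lTensor D ∘ₗ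
        (TensorProduct.assoc k D D D).toLinearMap ∘ₗ
        (Coalgebra.comul (R := k) (A := D)).rTensor D := by
      ext a b
      obtain ⟨s, hs⟩ := TensorProduct.exists_finset (Coalgebra.comul (R := k) a)
      simp [hs, TensorProduct.sum_tmul]
    have e2 : (Coalgebra.comul (R := k) (A := C)).lTensor D ∘ₗ (φ : D →ₗ[k] C).lTensor D =
        (TensorProduct.map (φ : D →ₗ[k] C) (φ : D →ₗ[k] C)).lTensor D ∘ₗ
        (Coalgebra.comul (R := k) (A := D)).lTensor D := by
      rw [← LinearMap.lTensor_comp, ← LinearMap.lTensor_comp]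
      exact congrArg _ (CoalgHomClass.map_comp_comul φ).symm
    have h1 := LinearMap.congr_fun e1 (Coalgebra.comul x)
    have h2 := LinearMap.congr_fun e2 (Coalgebra.comul x)
    simp only [LinearMap.comp_apply, LinearEquiv.coe_coe] at h1 h2 ⊢
    rw [h1, h2, Coalgebra.coassoc_apply]
  counit := by
    apply LinearMap.ext
    intro x
    have e : (Coalgebra.counit (R := k) (A := C)).lTensor D ∘ₗ (φ : D →ₗ[k] C).lTensor D =
        (Coalgebra.counit (R := k) (A := D)).lTensor D := by
      rw [← LinearMap.lTensor_comp]
      exact congrArg _ (CoalgHomClass.counit_comp φ)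
    have h := LinearMap.congr_fun e (Coalgebra.comul x)
    simp only [LinearMap.comp_apply] at h ⊢
    rw [h]
    simp

lemma ofCoalgHom_colinear {C D E : Type u} [AddCommGroup C] [Module k C] [Coalgebra k C]
    [AddCommGroup D] [Module k D] [Coalgebra k D] [AddCommGroup E] [Module k E] [Coalgebra k E]
    (φ : D →ₗc[k] C) (ψ : E →ₗc[k] C) (g : D →ₗc[k] E) (hw : ∀ b, ψ (g b) = φ b) :
    (ofCoalgHom ψ).coact ∘ₗ (g : D →ₗ[k] E) =
      (g : D →ₗ[k] E).rTensor C ∘ₗ (ofCoalgHom φ).coact := by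
  apply LinearMap.ext
  intro x
  have e : (ψ : E →ₗ[k] C).lTensor E ∘ₗ TensorProduct.map (g : D →ₗ[k] E) (g : D →ₗ[k] E) =
      (g : D →ₗ[k] E).rTensor C ∘ₗ (φ : D →ₗ[k] C).lTensor D := by
    ext a b
    simp [hw]
  have h := LinearMap.congr_fun e (Coalgebra.comul x)
  have h' := CoalgHomClass.map_comp_comul_apply g x
  simp only [LinearMap.comp_apply] at h ⊢
  rw [← h]
  exact congrArg _ h'.symm

/-- The functor `U^C` from cocommutative coalgebras over `C` to `C`-comodules: it sends
`φ : D → C` to `D` with the coaction `(id ⊗ φ) ∘ Δ`. -/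
def toComod (C : Coalg k) : Over C ⥤ Comod k C.obj where
  obj X := ofCoalgHom (Coalg.toHom X.hom)
  map {X Y} g := Comod.ofLin (Coalg.toHom g.left : X.left.obj →ₗ[k] Y.left.obj)
    (ofCoalgHom_colinear (Coalg.toHom X.hom) (Coalg.toHom Y.hom) (Coalg.toHom g.left)
      fun b => congrArg (fun t : X.left ⟶ C => Coalg.toHom t b) (Over.w g))

/-- The left `C`-coaction `(f ⊗ id) ∘ Δ` on `C'` induced by a coalgebra map `f : C' → C`. -/
def leftCoact {C C' : Coalg k} (f : C' ⟶ C) : C'.obj →ₗ[k] C.obj ⊗[k] C'.obj :=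
  (Coalg.toHom f : C'.obj →ₗ[k] C.obj).rTensor C'.obj ∘ₗ Coalgebra.comul

lemma isBicomod_leftCoact {C C' : Coalg k} (f : C' ⟶ C) :
    IsBicomod (Comod.regular k C'.obj) (leftCoact f) := by
  apply LinearMap.ext
  intro x
  have e1 : (TensorProduct.assoc k C.obj C'.obj C'.obj).toLinearMap ∘ₗ
      (leftCoact f).rTensor C'.obj =
      (Coalg.toHom f : C'.obj →ₗ[k] C.obj).rTensor (C'.obj ⊗[k] C'.obj) ∘ₗ
      (TensorProduct.assoc k C'.obj C'.obj C'.obj).toLinearMap ∘ₗ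
      (Coalgebra.comul (R := k) (A := C'.obj)).rTensor C'.obj := by
    ext a b
    obtain ⟨s, hs⟩ := TensorProduct.exists_finset (Coalgebra.comul (R := k) a)
    simp [leftCoact, hs, TensorProduct.sum_tmul]
  have e2 : (Coalgebra.comul (R := k) (A := C'.obj)).lTensor C.obj ∘ₗ
      (Coalg.toHom f : C'.obj →ₗ[k] C.obj).rTensor C'.obj =
      (Coalg.toHom f : C'.obj →ₗ[k] C.obj).rTensor (C'.obj ⊗[k] C'.obj) ∘ₗ
      (Coalgebra.comul (R := k) (A := C'.obj)).lTensor C'.obj := by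
    ext a b
    simp
  have h1 := LinearMap.congr_fun e1 (Coalgebra.comul x)
  have h2 := LinearMap.congr_fun e2 (Coalgebra.comul x)
  simp only [LinearMap.comp_apply, LinearEquiv.coe_coe] at h1 h2
  rw [Coalgebra.coassoc_apply, ← h2] at h1
  exact h1

lemma leftCoact_id {C C' : Coalg k} (f : C' ⟶ C) :
    leftCoact f ∘ₗ Comod.toLin (𝟙 (Comod.regular k C'.obj)) =
      (Comod.toLin (𝟙 (Comod.regular k C'.obj))).lTensor C.obj ∘ₗ leftCoact f := by
  refine Eq.trans (LinearMap.comp_id _) (Eq.trans (LinearMap.id_comp _).symm ?_)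
  exact congrArg (fun t => t ∘ₗ leftCoact f) (LinearMap.lTensor_id C.obj C'.obj).symm

/-- The functor `f^* : Vec^C → Vec^{C'}` of a coalgebra map `f : C' → C`: it sends `V` to the
cotensor product over `C` of `V` and `C'`, with the `C'`-coaction `id ⊗ Δ`. -/
def comodPullback {C C' : Coalg k} (f : C' ⟶ C) : Comod k C.obj ⥤ Comod k C'.obj where
  obj V := cotensorComod V (Comod.regular k C'.obj) (isBicomod_leftCoact f)
  map g := cotensorMap (isBicomod_leftCoact f) (isBicomod_leftCoact f) g (𝟙 _) (leftCoact_id f)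
  map_id V := Comod.hom_ext (cotensor_hom_ext (LinearMap.ext fun x =>
    LinearMap.congr_fun (TensorProduct.map_id (R := k) (M := V.carrier) (N := C'.obj))
      (cotensorIncl V (Comod.regular k C'.obj) (isBicomod_leftCoact f) x)))
  map_comp {V _ _} g h := Comod.hom_ext (cotensor_hom_ext (LinearMap.ext fun x =>
    LinearMap.congr_fun (TensorProduct.map_comp (Comod.toLin h) (LinearMap.id (R := k) (M := C'.obj))
        (Comod.toLin g) (LinearMap.id (R := k) (M := C'.obj)))
      (cotensorIncl V (Comod.regular k C'.obj) (isBicomod_leftCoact f) x)))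

/-- The inclusion `f^* V ⊆ V ⊗ C'`. -/
def pullbackIncl {C C' : Coalg k} (f : C' ⟶ C) (V : Comod k C.obj) :
    ((comodPullback f).obj V).carrier →ₗ[k] V.carrier ⊗[k] C'.obj :=
  cotensorIncl V (Comod.regular k C'.obj) (isBicomod_leftCoact f)

/-- The cartesian structure on coalgebras over `C`, given by fibre products over `C`. -/
instance (C : Coalg k) : CartesianMonoidalCategory (Over C) := Over.cartesianMonoidalCategory C

instance (C : Coalg k) : BraidedCategory (Over C) := Over.braidedCategory C

end Functors

section LNL

universe v₁ v₂ v₃ v₄ u₁ u₂ u₃ u₄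

/-- A linear-non-linear adjunction with left adjoint `U : 𝒞 ⥤ ℳ`: the category `𝒞` is cartesian,
`ℳ` is symmetric monoidal closed, and `U ⊣ R` is a symmetric monoidal adjunction. -/
structure LNLAdjunction {𝒞 : Type u₁} [Category.{v₁} 𝒞] [CartesianMonoidalCategory 𝒞]
    [BraidedCategory 𝒞] {ℳ : Type u₂} [Category.{v₂} ℳ] [MonoidalCategory ℳ]
    [SymmetricCategory ℳ] (U : 𝒞 ⥤ ℳ) where
  closed : MonoidalClosed ℳ
  R : ℳ ⥤ 𝒞
  adj : U ⊣ R
  laxU : U.LaxBraided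
  laxR : R.LaxBraided
  unit_monoidal : NatTrans.IsMonoidal adj.unit
  counit_monoidal : NatTrans.IsMonoidal adj.counit

/-- The canonical map `K[V, W] ⟶ [KV, KW]` for a lax monoidal functor `K` between monoidal closed
categories: the transpose of `KV ⊗ K[V, W] ⟶ K(V ⊗ [V, W]) ⟶ KW`. -/
def closedComparison {ℳ : Type u₁} [Category.{v₁} ℳ] [MonoidalCategory ℳ] [MonoidalClosed ℳ]
    {ℳ' : Type u₂} [Category.{v₂} ℳ'] [MonoidalCategory ℳ'] [MonoidalClosed ℳ']
    (K : ℳ ⥤ ℳ') [K.LaxMonoidal] (V W : ℳ) :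
    K.obj ((ihom V).obj W) ⟶ (ihom (K.obj V)).obj (K.obj W) :=
  MonoidalClosed.curry (Functor.LaxMonoidal.μ K V ((ihom V).obj W) ≫ K.map ((ihom.ev V).app W))

/-- A pair of functors `(L, K)` as a morphism of linear-non-linear adjunctions: `K` is strong
symmetric monoidal and closed, `L` is cartesian, there are isomorphisms `K U ≅ U' L` and
`L R ≅ R' K`, and, modulo these isomorphisms, `L η = η' L`. -/
structure LNLMorphism {𝒞 : Type u₁} [Category.{v₁} 𝒞] [CartesianMonoidalCategory 𝒞]
    [BraidedCategory 𝒞] {ℳ : Type u₂} [Category.{v₂} ℳ] [MonoidalCategory ℳ]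
    [SymmetricCategory ℳ] {U : 𝒞 ⥤ ℳ} (A : LNLAdjunction U)
    {𝒞' : Type u₃} [Category.{v₃} 𝒞'] [CartesianMonoidalCategory 𝒞'] [BraidedCategory 𝒞']
    {ℳ' : Type u₄} [Category.{v₄} ℳ'] [MonoidalCategory ℳ'] [SymmetricCategory ℳ']
    {U' : 𝒞' ⥤ ℳ'} (A' : LNLAdjunction U') (L : 𝒞 ⥤ 𝒞') (K : ℳ ⥤ ℳ') where
  strong : K.Braided
  closed : letI := A.closed; letI := A'.closed; ∀ V W : ℳ, IsIso (closedComparison K V W)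
  cartesian : PreservesFiniteProducts L
  isoU : U ⋙ K ≅ L ⋙ U'
  isoR : A.R ⋙ L ≅ K ⋙ A'.R
  unit_comp : ∀ X : 𝒞, L.map (A.adj.unit.app X) ≫ isoR.hom.app (U.obj X) ≫
    A'.R.map (isoU.hom.app X) = A'.adj.unit.app (L.obj X)

namespace LNLMorphism

variable {𝒞 : Type u₁} [Category.{v₁} 𝒞] [CartesianMonoidalCategory 𝒞]
    [BraidedCategory 𝒞] {ℳ : Type u₂} [Category.{v₂} ℳ] [MonoidalCategory ℳ]
    [SymmetricCategory ℳ] {U : 𝒞 ⥤ ℳ} {A : LNLAdjunction U}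
    {𝒞' : Type u₃} [Category.{v₃} 𝒞'] [CartesianMonoidalCategory 𝒞'] [BraidedCategory 𝒞']
    {ℳ' : Type u₄} [Category.{v₄} ℳ'] [MonoidalCategory ℳ'] [SymmetricCategory ℳ']
    {U' : 𝒞' ⥤ ℳ'} {A' : LNLAdjunction U'} {L : 𝒞 ⥤ 𝒞'} {K : ℳ ⥤ ℳ'}

/-- The structure isomorphism `K V ⊗ K W ⟶ K (V ⊗ W)`. -/
def tensorMap (M : LNLMorphism A A' L K) (V W : ℳ) : K.obj V ⊗ K.obj W ⟶ K.obj (V ⊗ W) :=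
  letI := M.strong
  Functor.LaxMonoidal.μ K V W

/-- The structure isomorphism `I' ⟶ K I`. -/
def unitMap (M : LNLMorphism A A' L K) : 𝟙_ ℳ' ⟶ K.obj (𝟙_ ℳ) :=
  letI := M.strong
  Functor.LaxMonoidal.ε K

end LNLMorphism

end LNL

section Canonical

variable {k : Type u} [Field k] {C C' : Coalg k}

/-- The map `v ⊗ c ⊗ w ⊗ c' ↦ v ⊗ w ⊗ ε(c) c'`. -/
def mulCounit (V W : Type u) [AddCommGroup V] [Module k V] [AddCommGroup W] [Module k W]
    (E : Type u) [AddCommGroup E] [Module k E] [Coalgebra k E] :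
    (V ⊗[k] E) ⊗[k] (W ⊗[k] E) →ₗ[k] (V ⊗[k] W) ⊗[k] E :=
  ((TensorProduct.lid k E).toLinearMap ∘ₗ
      (Coalgebra.counit (R := k) (A := E)).rTensor E).lTensor (V ⊗[k] W) ∘ₗ
    (TensorProduct.tensorTensorTensorComm k V E W E).toLinearMap

/-- The structure maps of a morphism of linear-non-linear adjunctions with underlying functors
pullback along `f` and `f^*` are the usual ones: `f^* V ⊗ f^* W ⟶ f^* (V ⊗ W)` is
`v ⊗ c ⊗ w ⊗ c' ↦ v ⊗ w ⊗ ε(c) c'`, `C' ⟶ f^* C` is `(f ⊗ id) ∘ Δ`, and for `φ : D → C` with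
pullback `X` and projections `p : X → D`, `q : X → C'`, the isomorphism `X ⟶ f^* D` is
`(p ⊗ q) ∘ Δ`. -/
structure IsCanonical (f : C' ⟶ C) {A : LNLAdjunction (toComod C)}
    {A' : LNLAdjunction (toComod C')}
    (M : LNLMorphism A A' (Over.pullback f) (comodPullback f)) : Prop where
  tensorMap_eq : ∀ (V W : Comod k C.obj)
    (x : ((comodPullback f).obj V ⊗ (comodPullback f).obj W : Comod k C'.obj).carrier),
    (Comod.ι V W).rTensor C'.obj
        (pullbackIncl f (V ⊗ W) (Comod.toLin (M.tensorMap V W) x)) =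
      mulCounit V.carrier W.carrier C'.obj
        (TensorProduct.map (pullbackIncl f V) (pullbackIncl f W)
          (Comod.ι ((comodPullback f).obj V) ((comodPullback f).obj W) x))
  unitMap_eq : ∀ c : C'.obj,
    pullbackIncl f (𝟙_ (Comod k C.obj)) (Comod.toLin M.unitMap c) = leftCoact f c
  isoU_eq : ∀ (X : Over C) (x : (pullback X.hom f).obj),
    pullbackIncl f ((toComod C).obj X) (Comod.toLin (M.isoU.inv.app X) x) =
      TensorProduct.map
        (Coalg.toHom (pullback.fst X.hom f) : (pullback X.hom f).obj →ₗ[k] X.left.obj)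
        (Coalg.toHom (pullback.snd X.hom f) : (pullback X.hom f).obj →ₗ[k] C'.obj)
        (Coalgebra.comul x)

end Canonical

end ComodLNL

end

open ComodLNL

/-! Write □ for the cotensor product, f_! : Vec^{C'} → Vec^C for corestriction (push the coaction
forward along f), and Σ_f for composition of coalgebra maps with f. The comparison of the two
adjunctions rests on two facts.

The first is a projection formula. The functor f_! is left adjoint to f^*, with the coaction as unit
and v ⊗ c ↦ ε(c)v as counit. It is oplax symmetric monoidal because V □_{C'} W is contained in V □_C
W inside V ⊗ W. The Frobenius map f_!(f^*V □_{C'} X) → V □_C f_!X is invertible, with inverse v ⊗ x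
↦ v ⊗ x₋₁ ⊗ x₀ (`isIso_frobenius`). Formally, this makes f^* closed, by Yoneda
(`isIso_closedComparison`). Since f_! is also conservative, it makes f^* strong monoidal
(`isIso_ε_of_frobenius`, `isIso_μ_of_frobenius`).

The second is that fibre products of cocommutative coalgebras are cotensor products: (p ⊗ q)Δ maps
the pullback of D → C ← E bijectively onto D □_C E (`pair_injective`, `mem_range_pair`). The
pullback is an equalizer in the coalgebra D ⊗ E, and cocommutativity shows that an equalizer of
coalgebra maps g, h is the subspace where x₁ ⊗ g(x₂) = x₁ ⊗ h(x₂) (`eqSub_eq`). Hence U^C is strong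
symmetric monoidal, and α exists.

The functor L_f is cartesian because it is right adjoint to Σ_f. The functors f_! U^{C'} and U^C Σ_f
agree on underlying vector spaces, and β is the conjugate of this identification for the composite
adjunctions. Compatibility with the units then reduces to an identity between counits
(`unit_comp_conjugate`, `comparison_compat`).

It remains to construct the adjunctions. A right adjoint of U^C amounts to a terminal object in each
comma category U^C ↓ V. A coalgebra D over C with a colinear map to V yields a linear map G : D → V
× C. Sending x to the values at x of all convolution products of functionals pulled back along G
maps D to the functions on words in the dual of V × C. The span of all these images, over all D, is
a coalgebra whose comultiplication is dual to concatenation of words, and it is terminal. The lax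
structure on R^C comes from the strong structure of U^C.

Cosemisimplicity gives closedness. Comodules are treated as modules over the free algebra on C^*. In
this sense C is semisimple, so each V ⊗ C is too, and the coaction V → V ⊗ C has a colinear
retraction (`exists_coact_retraction`). This makes V □ X a natural retract of V ⊗ X, and the
internal hom is the subspace of Hom(V, W) spanned by the maps arising from all colinear V □ X → W.
-/

noncomputable section

namespace ComodLNL

/-! ### The projection formula and closed right adjoints -/

section Formal

universe v₁ v₂ v₃ v₄ u₁ u₂ u₃ u₄

open Functor.LaxMonoidal Functor.OplaxMonoidal

variable {ℳ : Type u₁} [Category.{v₁} ℳ] [MonoidalCategory ℳ]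
  {ℳ' : Type u₂} [Category.{v₂} ℳ'] [MonoidalCategory ℳ']

/-- The right adjoint of an oplax braided functor is lax braided. -/
@[reducible] def laxBraidedOfAdjunction [BraidedCategory ℳ] [BraidedCategory ℳ']
    {F : ℳ' ⥤ ℳ} {K : ℳ ⥤ ℳ'} (adj : F ⊣ K) [F.OplaxMonoidal] [K.LaxMonoidal] [adj.IsMonoidal]
    (hF : ∀ X Y : ℳ', F.map (β_ X Y).hom ≫ δ F Y X = δ F X Y ≫ (β_ _ _).hom) :
    K.LaxBraided where
  braided V W := by
    apply (adj.homEquiv _ _).symm.injective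
    simp only [Adjunction.homEquiv_counit, Functor.map_comp, Category.assoc,
      Adjunction.counit_naturality, Adjunction.map_μ_comp_counit_app_tensor,
      Adjunction.map_μ_comp_counit_app_tensor_assoc]
    rw [reassoc_of% hF]
    simp

/-- The Frobenius morphism `F (K V ⊗ X) ⟶ V ⊗ F X` of an adjunction `F ⊣ K` with `F` oplax
monoidal. -/
def frobenius {F : ℳ' ⥤ ℳ} {K : ℳ ⥤ ℳ'} (adj : F ⊣ K) [F.OplaxMonoidal] (V : ℳ) (X : ℳ') :
    F.obj (K.obj V ⊗ X) ⟶ V ⊗ F.obj X :=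
  δ F (K.obj V) X ≫ adj.counit.app V ▷ F.obj X

/-- If the Frobenius morphisms are isomorphisms, then the right adjoint is closed. -/
theorem isIso_closedComparison [MonoidalClosed ℳ] [MonoidalClosed ℳ']
    {F : ℳ' ⥤ ℳ} {K : ℳ ⥤ ℳ'} (adj : F ⊣ K) [F.OplaxMonoidal] [K.LaxMonoidal] [adj.IsMonoidal]
    (V W : ℳ) [∀ X, IsIso (frobenius adj V X)] : IsIso (closedComparison K V W) := by
  -- After transposing along both closed structures and along F ⊣ K, composition with the comparison
  -- map becomes precomposition with the Frobenius morphism.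
  have key : ∀ (X : ℳ') (g : X ⟶ K.obj ((ihom V).obj W)),
      (adj.homEquiv _ _).symm (MonoidalClosed.uncurry (g ≫ closedComparison K V W)) =
        frobenius adj V X ≫ MonoidalClosed.uncurry ((adj.homEquiv _ _).symm g) := by
    intro X g
    rw [closedComparison, MonoidalClosed.uncurry_natural_left, MonoidalClosed.uncurry_curry,
      MonoidalClosed.uncurry_eq]
    simp only [Adjunction.homEquiv_counit, Functor.map_comp, Category.assoc,
      Adjunction.counit_naturality, Adjunction.map_μ_comp_counit_app_tensor_assoc,
      frobenius, MonoidalCategory.whiskerLeft_comp]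
    rw [← δ_natural_right_assoc, MonoidalCategory.tensorHom_def]
    simp only [Category.assoc]
    rw [← MonoidalCategory.whisker_exchange_assoc, MonoidalCategory.whisker_exchange_assoc,
      MonoidalCategory.whisker_exchange_assoc]
  refine isIso_of_yoneda_map_bijective _ fun X => ?_
  -- The chain is Hom(X, K[V,W]) ≃ Hom(FX, [V,W]) ≃ Hom(V ⊗ FX, W) ≃ Hom(F(KV ⊗ X), W) ≃ Hom(KV ⊗ X,
  -- KW) ≃ Hom(X, [KV,KW]); the third bijection is the Frobenius isomorphism.
  let e : (X ⟶ K.obj ((ihom V).obj W)) ≃ (X ⟶ (ihom (K.obj V)).obj (K.obj W)) :=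
    (adj.homEquiv _ _).symm.trans (((ihom.adjunction V).homEquiv _ _).symm.trans
      ((asIso (frobenius adj V X)).symm.homCongr (Iso.refl W) |>.trans ((adj.homEquiv _ _).trans
        ((ihom.adjunction (K.obj V)).homEquiv _ _))))
  have he : (fun g => g ≫ closedComparison K V W) = e := by
    funext g
    apply MonoidalClosed.uncurry_injective
    apply (adj.homEquiv _ _).symm.injective
    rw [key]
    simp only [e, Equiv.trans_apply, Iso.homCongr_apply, Iso.symm_inv, asIso_hom, Iso.refl_hom,
      Category.comp_id]
    exact ((congrArg _ (MonoidalClosed.uncurry_curry _)).trans (Equiv.symm_apply_apply _ _)).symm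
  rw [he]
  exact e.bijective

end Formal

/-! ### Conjugate comparisons and compatibility with units -/

section Units

universe v₁ v₂ v₃ v₄ u₁ u₂ u₃ u₄

variable {𝒞 : Type u₁} [Category.{v₁} 𝒞] {ℳ : Type u₂} [Category.{v₂} ℳ]
  {𝒞' : Type u₃} [Category.{v₃} 𝒞'] {ℳ' : Type u₄} [Category.{v₄} ℳ']
  {U : 𝒞 ⥤ ℳ} {R : ℳ ⥤ 𝒞} {U' : 𝒞' ⥤ ℳ'} {R' : ℳ' ⥤ 𝒞'} {S : 𝒞' ⥤ 𝒞} {L : 𝒞 ⥤ 𝒞'}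
  {F : ℳ' ⥤ ℳ} {K : ℳ ⥤ ℳ'}

/-- The comparison of right adjoints conjugate to a comparison of left adjoints is compatible with
the units. -/
theorem unit_comp_conjugate (a : S ⊣ L) (b : F ⊣ K) (A : U ⊣ R) (A' : U' ⊣ R')
    (e : U' ⋙ F ≅ S ⋙ U) (i : U ⋙ K ≅ L ⋙ U')
    (h : ∀ X, F.map (i.inv.app X) ≫ b.counit.app (U.obj X) =
      e.hom.app (L.obj X) ≫ U.map (a.counit.app X)) (X : 𝒞) :
    L.map (A.unit.app X) ≫
      (conjugateIsoEquiv (a.comp A) (A'.comp b) e).hom.app (U.obj X) ≫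
        R'.map (i.hom.app X) = A'.unit.app (L.obj X) := by
  -- Once i is moved to the right-hand side, both sides are maps into R'K(UX). Their transposes
  -- along F U' ⊣ R' K are the two sides of `h`.
  rw [← Category.assoc, ← IsIso.eq_comp_inv, ← Functor.map_inv]
  apply ((A'.comp b).homEquiv _ _).symm.injective
  rw [Adjunction.homEquiv_naturality_left_symm]
  simp only [Adjunction.homEquiv_counit]
  have := conjugateEquiv_counit (a.comp A) (A'.comp b) e.hom (U.obj X)
  -- Naturality of e and the triangle identity for U ⊣ R remove the unit here; the triangle identity
  -- for U' ⊣ R' does the same in `hR`.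
  have hL : (U' ⋙ F).map (L.map (A.unit.app X)) ≫ e.hom.app ((R ⋙ L).obj (U.obj X)) ≫
      (a.comp A).counit.app (U.obj X) = e.hom.app (L.obj X) ≫ U.map (a.counit.app X) := by
    have h1 := e.hom.naturality_assoc (L.map (A.unit.app X)) ((a.comp A).counit.app (U.obj X))
    refine h1.trans (congrArg (e.hom.app (L.obj X) ≫ ·) ?_)
    simp [← Functor.map_comp_assoc]
  have hR : (U' ⋙ F).map (A'.unit.app (L.obj X) ≫ R'.map (inv (i.hom.app X))) ≫
      (A'.comp b).counit.app (U.obj X) = F.map (i.inv.app X) ≫ b.counit.app (U.obj X) := by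
    simp only [Functor.comp_map, Functor.map_comp, Adjunction.comp_counit_app, Category.assoc]
    rw [← Functor.map_comp_assoc F, ← Functor.map_comp_assoc F, Category.assoc]
    simp
  rw [hR, h, ← hL]
  exact congrArg ((U' ⋙ F).map (L.map (A.unit.app X)) ≫ ·) this

end Units

/-! ### Oplax structures detected on underlying vector spaces -/

section Forget

open Functor.OplaxMonoidal

variable {k : Type u} [Field k] {C : Type u} [AddCommGroup C] [Module k C] [Coalgebra k C]

namespace Comod

/-- A bijective morphism of comodules is an isomorphism. -/
lemma isIso_of_bijective {V W : Comod k C} (f : V ⟶ W) (hf : Function.Bijective (toLin f)) :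
    IsIso f :=
  (isoMk f (LinearEquiv.ofBijective (toLin f) hf).symm.toLinearMap
    (LinearMap.ext fun x => (LinearEquiv.ofBijective (toLin f) hf).symm_apply_apply x)
    (LinearMap.ext fun x => (LinearEquiv.ofBijective (toLin f) hf).apply_symm_apply x)).isIso_hom

lemma bijective_of_isIso {V W : Comod k C} (f : V ⟶ W) [IsIso f] :
    Function.Bijective (toLin f) := by
  refine Function.bijective_iff_has_inverse.mpr ⟨toLin (inv f), fun x => ?_, fun x => ?_⟩
  · exact LinearMap.congr_fun (congrArg toLin (IsIso.hom_inv_id f)) x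
  · exact LinearMap.congr_fun (congrArg toLin (IsIso.inv_hom_id f)) x

variable [Coalgebra.IsCocomm k C]

/-- The structure maps are the inclusions V □ W ⊆ V ⊗ W and the counit C → k. Since the inclusions
are injective, identities between colinear maps into cotensor products can be checked in vector
spaces. -/
instance : (forgetVec (k := k) (C := C)).OplaxMonoidal where
  η := ηι
  δ := δι
  oplax_associativity V W X := by
    rw [δι_assoc]
  oplax_left_unitality V := by
    rw [← cancel_mono (λ_ (forgetVec.obj V)).hom, Iso.inv_hom_id, Category.assoc, Category.assoc,
      ← δι_leftUnitor, ← Functor.map_comp, Iso.inv_hom_id, CategoryTheory.Functor.map_id]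
  oplax_right_unitality V := by
    rw [← cancel_mono (ρ_ (forgetVec.obj V)).hom, Iso.inv_hom_id, Category.assoc, Category.assoc,
      ← δι_rightUnitor, ← Functor.map_comp, Iso.inv_hom_id, CategoryTheory.Functor.map_id]

universe v₁ u₁

/-- An oplax monoidal structure on a functor to comodules, from one on its composition with the
forgetful functor. -/
@[reducible] def oplaxOfForget {𝒟 : Type u₁} [Category.{v₁} 𝒟] [MonoidalCategory 𝒟]
    (F : 𝒟 ⥤ Comod k C) [(F ⋙ forgetVec).OplaxMonoidal]
    (e : F.obj (𝟙_ 𝒟) ⟶ 𝟙_ (Comod k C)) (d : ∀ X Y : 𝒟, F.obj (X ⊗ Y) ⟶ F.obj X ⊗ F.obj Y)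
    (he : forgetVec.map e ≫ ηι = η (F ⋙ forgetVec))
    (hd : ∀ X Y, forgetVec.map (d X Y) ≫ δι _ _ = δ (F ⋙ forgetVec) X Y) : F.OplaxMonoidal where
  η := e
  δ := d
  δ_natural_left {X Y} f X' := by
    apply hom_ext_δι
    rw [Functor.map_comp, Functor.map_comp, Category.assoc, Category.assoc, hd,
      ← Category.comp_id (δι (F.obj Y) _), forget_whiskerRight, Category.comp_id,
      ← Category.assoc, hd]
    exact δ_natural_left (F ⋙ forgetVec) f X'
  δ_natural_right {X Y} X' f := by
    apply hom_ext_δι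
    rw [Functor.map_comp, Functor.map_comp, Category.assoc, Category.assoc, hd,
      ← Category.comp_id (δι _ (F.obj Y)), forget_whiskerLeft, Category.comp_id,
      ← Category.assoc, hd]
    exact δ_natural_right (F ⋙ forgetVec) X' f
  oplax_associativity X Y Z := by
    -- The inclusion of a threefold cotensor product in the threefold tensor product is mono, so the
    -- associativity of the composite with the forgetful functor suffices.
    apply hom_ext_δι₂
    have h := oplax_associativity (F ⋙ forgetVec) X Y Z
    simp only [← hd] at h
    simp only [Functor.map_comp, Category.assoc]
    rw [δι_assoc, forget_whiskerRight, forget_whiskerLeft]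
    simpa using h
  oplax_left_unitality X := by
    have h := oplax_left_unitality (F ⋙ forgetVec) X
    rw [← cancel_mono (λ_ (F.obj X)).hom]
    apply forgetVec.map_injective
    simp only [← hd, ← he] at h
    rw [← cancel_mono (λ_ _).hom] at h
    simp only [Functor.map_comp, Category.assoc]
    rw [δι_leftUnitor, forget_whiskerRight, ← δι_leftUnitor, ← Functor.map_comp,
      Iso.inv_hom_id, CategoryTheory.Functor.map_id]
    simpa using h
  oplax_right_unitality X := by
    have h := oplax_right_unitality (F ⋙ forgetVec) X
    rw [← cancel_mono (ρ_ (F.obj X)).hom]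
    apply forgetVec.map_injective
    simp only [← hd, ← he] at h
    rw [← cancel_mono (ρ_ _).hom] at h
    simp only [Functor.map_comp, Category.assoc]
    rw [δι_rightUnitor, forget_whiskerLeft, ← δι_rightUnitor, ← Functor.map_comp,
      Iso.inv_hom_id, CategoryTheory.Functor.map_id]
    simpa using h

end Comod

end Forget

/-! ### Corestriction along f and its right adjoint f^* -/

section Corestrict

variable {k : Type u} [Field k] {C C' : Coalg k} (f : C' ⟶ C)

/-- The linear map underlying a morphism of cocommutative coalgebras. -/
abbrev Coalg.lin {C C' : Coalg k} (f : C' ⟶ C) : C'.obj →ₗ[k] C.obj := (Coalg.toHom f : _ →ₗ[k] _)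

lemma Coalg.map_lin_comul {C C' : Coalg k} (f : C' ⟶ C) (x : C'.obj) :
    TensorProduct.map (Coalg.lin f) (Coalg.lin f) (Coalgebra.comul x) =
      Coalgebra.comul (Coalg.lin f x) :=
  CoalgHomClass.map_comp_comul_apply (Coalg.toHom f) x

lemma Coalg.counit_lin {C C' : Coalg k} (f : C' ⟶ C) (x : C'.obj) :
    Coalgebra.counit (R := k) (Coalg.lin f x) = Coalgebra.counit (R := k) x :=
  CoalgHomClass.counit_comp_apply (Coalg.toHom f) x

/-- Corestriction of comodules along a coalgebra map `f : C' → C`. -/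
@[reducible] def corestrictObj (V : Comod k C'.obj) : Comod k C.obj where
  carrier := V.carrier
  coact := (Coalg.lin f).lTensor V.carrier ∘ₗ V.coact
  coassoc := by
    apply LinearMap.ext
    intro x
    have e1 : (TensorProduct.assoc k V.carrier C.obj C.obj).toLinearMap ∘ₗ
        ((Coalg.lin f).lTensor V.carrier ∘ₗ V.coact).rTensor C.obj ∘ₗ
          (Coalg.lin f).lTensor V.carrier =
        (TensorProduct.map (Coalg.lin f) (Coalg.lin f)).lTensor V.carrier ∘ₗ
        (TensorProduct.assoc k V.carrier C'.obj C'.obj).toLinearMap ∘ₗ V.coact.rTensor C'.obj := by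
      ext a b
      obtain ⟨s, hs⟩ := TensorProduct.exists_finset (V.coact a)
      simp [hs, TensorProduct.sum_tmul]
    have e2 : (Coalgebra.comul (R := k) (A := C.obj)).lTensor V.carrier ∘ₗ
          (Coalg.lin f).lTensor V.carrier =
        (TensorProduct.map (Coalg.lin f) (Coalg.lin f)).lTensor V.carrier ∘ₗ
        (Coalgebra.comul (R := k) (A := C'.obj)).lTensor V.carrier := by
      rw [← LinearMap.lTensor_comp, ← LinearMap.lTensor_comp]
      exact congrArg _ (LinearMap.ext fun y => (Coalg.map_lin_comul f y).symm)
    have h1 := LinearMap.congr_fun e1 (V.coact x)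
    have h2 := LinearMap.congr_fun e2 (V.coact x)
    simp only [LinearMap.comp_apply, LinearEquiv.coe_coe] at h1 h2 ⊢
    rw [h1, h2, V.coassoc_apply]
  counit := by
    apply LinearMap.ext
    intro x
    have e : (Coalgebra.counit (R := k) (A := C.obj)).lTensor V.carrier ∘ₗ
        (Coalg.lin f).lTensor V.carrier =
        (Coalgebra.counit (R := k) (A := C'.obj)).lTensor V.carrier := by
      rw [← LinearMap.lTensor_comp]
      exact congrArg _ (LinearMap.ext fun y => Coalg.counit_lin f y)
    have h := LinearMap.congr_fun e (V.coact x)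
    simp only [LinearMap.comp_apply] at h ⊢
    rw [h]
    exact V.counit_apply x

/-- The corestriction functor along a coalgebra map `f : C' → C`. -/
def corestrict : Comod k C'.obj ⥤ Comod k C.obj where
  obj V := corestrictObj f V
  map {V W} g := Comod.ofLin (V := corestrictObj f V) (W := corestrictObj f W)
    (Comod.toLin (V := V) (W := W) g) (by
    apply LinearMap.ext
    intro x
    have e : (Coalg.lin f).lTensor W.carrier ∘ₗ (Comod.toLin g).rTensor C'.obj =
        (Comod.toLin g).rTensor C.obj ∘ₗ (Coalg.lin f).lTensor V.carrier := by
      ext; simp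
    have h := LinearMap.congr_fun e (V.coact x)
    simp only [LinearMap.comp_apply] at h ⊢
    rw [Comod.toLin_comm_apply, h])

lemma pullbackIncl_injective (V : Comod k C.obj) : Function.Injective (pullbackIncl f V) :=
  cotensorIncl_injective V (Comod.regular k C'.obj) (isBicomod_leftCoact f)

lemma pullbackIncl_eq (V : Comod k C.obj) (x : ((comodPullback f).obj V).carrier) :
    TensorProduct.assoc k V.carrier C.obj C'.obj (V.coact.rTensor C'.obj (pullbackIncl f V x)) =
      (leftCoact f).lTensor V.carrier (pullbackIncl f V x) := x.2

lemma pullbackIncl_coact (V : Comod k C.obj) (x : ((comodPullback f).obj V).carrier) :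
    (pullbackIncl f V).rTensor C'.obj (((comodPullback f).obj V).coact x) =
      (TensorProduct.assoc k V.carrier C'.obj C'.obj).symm
        ((Coalgebra.comul (R := k) (A := C'.obj)).lTensor V.carrier (pullbackIncl f V x)) :=
  LinearMap.congr_fun
    (cotensor_coact V (Comod.regular k C'.obj) (isBicomod_leftCoact f)) x

/-- The unit of the adjunction between corestriction and pullback: the coaction. -/
def corestrictUnit (V : Comod k C'.obj) : V ⟶ (comodPullback f).obj ((corestrict f).obj V) :=
  Comod.ofLin (cotensorLift (corestrictObj f V) (Comod.regular k C'.obj) (isBicomod_leftCoact f)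
    V.coact (by
      apply LinearMap.ext
      intro x
      have e1 : (TensorProduct.assoc k V.carrier C.obj C'.obj).toLinearMap ∘ₗ
          ((Coalg.lin f).lTensor V.carrier ∘ₗ V.coact).rTensor C'.obj =
          ((Coalg.lin f).rTensor C'.obj).lTensor V.carrier ∘ₗ
          (TensorProduct.assoc k V.carrier C'.obj C'.obj).toLinearMap ∘ₗ
            V.coact.rTensor C'.obj := by
        ext a b
        obtain ⟨s, hs⟩ := TensorProduct.exists_finset (V.coact a)
        simp [hs, TensorProduct.sum_tmul]
      have h1 := LinearMap.congr_fun e1 (V.coact x)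
      simp only [LinearMap.comp_apply, LinearEquiv.coe_coe] at h1 ⊢
      rw [V.coassoc_apply] at h1
      refine h1.trans ?_
      rw [leftCoact, LinearMap.lTensor_comp]
      rfl))
    (cotensor_colinear (corestrictObj f V) (Comod.regular k C'.obj) (isBicomod_leftCoact f) _ (by
      rw [cotensorIncl_lift]
      apply LinearMap.ext
      intro x
      refine (TensorProduct.assoc k V.carrier C'.obj C'.obj).injective ?_
      exact ((TensorProduct.assoc k V.carrier C'.obj C'.obj).apply_symm_apply _).trans
        (V.coassoc_apply x).symm))

/-- The linear map `f^* V → V`, `v ⊗ c ↦ ε(c) v`. -/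
def pullbackCounit (V : Comod k C.obj) : ((comodPullback f).obj V).carrier →ₗ[k] V.carrier :=
  (TensorProduct.rid k V.carrier).toLinearMap ∘ₗ
    (Coalgebra.counit (R := k) (A := C'.obj)).lTensor V.carrier ∘ₗ pullbackIncl f V

/-- Both sides send v ⊗ c to v ⊗ f(c). On the left this is the cotensor equation ρ(v) ⊗ c = v ⊗
f(c₁) ⊗ c₂ with ε applied to the last leg; on the right it is counitality of Δ. -/
lemma pullbackCounit_colinear (V : Comod k C.obj) : V.coact ∘ₗ pullbackCounit f V =
    (pullbackCounit f V).rTensor C.obj ∘ₗ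
      (corestrictObj f ((comodPullback f).obj V)).coact := by
  apply LinearMap.ext
  intro x
  have e1 : V.coact ∘ₗ (TensorProduct.rid k V.carrier).toLinearMap ∘ₗ
      (Coalgebra.counit (R := k) (A := C'.obj)).lTensor V.carrier =
      ((TensorProduct.rid k C.obj).toLinearMap ∘ₗ
        (Coalgebra.counit (R := k) (A := C'.obj)).lTensor C.obj).lTensor V.carrier ∘ₗ
      (TensorProduct.assoc k V.carrier C.obj C'.obj).toLinearMap ∘ₗ
        V.coact.rTensor C'.obj := by
    ext a b
    obtain ⟨s, hs⟩ := TensorProduct.exists_finset (V.coact a)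
    simp [hs, TensorProduct.sum_tmul, Finset.smul_sum]
  have e2 : (TensorProduct.rid k C.obj).toLinearMap ∘ₗ
        (Coalgebra.counit (R := k) (A := C'.obj)).lTensor C.obj ∘ₗ leftCoact f =
      Coalg.lin f := by
    have e3 : (TensorProduct.rid k C.obj).toLinearMap ∘ₗ
        (Coalgebra.counit (R := k) (A := C'.obj)).lTensor C.obj ∘ₗ
        (Coalg.lin f).rTensor C'.obj = Coalg.lin f ∘ₗ (TensorProduct.rid k C'.obj).toLinearMap ∘ₗ
        (Coalgebra.counit (R := k) (A := C'.obj)).lTensor C'.obj := by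
      ext; simp
    apply LinearMap.ext
    intro c
    have := LinearMap.congr_fun e3 (Coalgebra.comul c)
    simp only [LinearMap.comp_apply, leftCoact] at this ⊢
    rw [this]
    simp
  have e4 : ((TensorProduct.rid k V.carrier).toLinearMap ∘ₗ
      (Coalgebra.counit (R := k) (A := C'.obj)).lTensor V.carrier).rTensor C.obj ∘ₗ
      (Coalg.lin f).lTensor (V.carrier ⊗[k] C'.obj) ∘ₗ
      (TensorProduct.assoc k V.carrier C'.obj C'.obj).symm.toLinearMap ∘ₗ
      (Coalgebra.comul (R := k) (A := C'.obj)).lTensor V.carrier =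
      (Coalg.lin f).lTensor V.carrier := by
    have e5 : ((TensorProduct.rid k V.carrier).toLinearMap ∘ₗ
      (Coalgebra.counit (R := k) (A := C'.obj)).lTensor V.carrier).rTensor C.obj ∘ₗ
      (Coalg.lin f).lTensor (V.carrier ⊗[k] C'.obj) ∘ₗ
      (TensorProduct.assoc k V.carrier C'.obj C'.obj).symm.toLinearMap =
      (Coalg.lin f ∘ₗ (TensorProduct.lid k C'.obj).toLinearMap ∘ₗ
        (Coalgebra.counit (R := k) (A := C'.obj)).rTensor C'.obj).lTensor V.carrier := by
      ext; simp [TensorProduct.smul_tmul]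
    apply LinearMap.ext
    intro y
    refine (LinearMap.congr_fun e5 _).trans ?_
    rw [← LinearMap.comp_apply, ← LinearMap.lTensor_comp]
    refine LinearMap.congr_fun (congrArg (LinearMap.lTensor V.carrier) ?_) y
    apply LinearMap.ext
    intro c
    simp
  have e6 : (pullbackIncl f V).rTensor C.obj ∘ₗ
      (Coalg.lin f).lTensor ((comodPullback f).obj V).carrier =
      (Coalg.lin f).lTensor (V.carrier ⊗[k] C'.obj) ∘ₗ (pullbackIncl f V).rTensor C'.obj := by
    ext; simp
  have h1 := LinearMap.congr_fun e1 (pullbackIncl f V x)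
  have h4 := LinearMap.congr_fun e4 (pullbackIncl f V x)
  have h6 := LinearMap.congr_fun e6 (((comodPullback f).obj V).coact x)
  have h7 := LinearMap.congr_fun (congrArg (LinearMap.lTensor V.carrier) e2)
    (pullbackIncl f V x)
  simp only [LinearMap.comp_apply, LinearEquiv.coe_coe, LinearMap.lTensor_comp,
    LinearMap.rTensor_comp, pullbackIncl_coact, pullbackIncl_eq, pullbackCounit]
    at h1 h4 h6 h7 ⊢
  rw [h1, h7, h6, h4]

/-- The counit of the adjunction between corestriction and pullback: `v ⊗ c ↦ ε(c) v`. -/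
def corestrictCounit (V : Comod k C.obj) : (corestrict f).obj ((comodPullback f).obj V) ⟶ V :=
  Comod.ofLin (V := corestrictObj f ((comodPullback f).obj V)) (W := V) (pullbackCounit f V)
    (pullbackCounit_colinear f V)

lemma pullbackCounit_map {V W : Comod k C.obj} (g : V ⟶ W) :
    pullbackCounit f W ∘ₗ Comod.toLin ((comodPullback f).map g) =
      Comod.toLin g ∘ₗ pullbackCounit f V := by
  have e : (TensorProduct.rid k W.carrier).toLinearMap ∘ₗ
      (Coalgebra.counit (R := k) (A := C'.obj)).lTensor W.carrier ∘ₗ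
      (Comod.toLin g).rTensor C'.obj = Comod.toLin g ∘ₗ
      (TensorProduct.rid k V.carrier).toLinearMap ∘ₗ
      (Coalgebra.counit (R := k) (A := C'.obj)).lTensor V.carrier := by
    ext; simp
  exact LinearMap.ext fun x => LinearMap.congr_fun e (pullbackIncl f V x)

/-- Corestriction is left adjoint to pullback. -/
def corestrictAdj : corestrict f ⊣ comodPullback f :=
  Adjunction.mkOfUnitCounit
    { unit :=
        { app := corestrictUnit f
          naturality := fun V W g => Comod.hom_ext (cotensor_hom_ext (LinearMap.ext fun x =>
            Comod.toLin_comm_apply (V := V) (W := W) g x)) }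
      counit :=
        { app := corestrictCounit f
          naturality := fun V W g => Comod.hom_ext (pullbackCounit_map f g) }
      -- This triangle is the counit axiom of the comodule V.
      left_triangle := by
        ext V : 2
        exact Comod.hom_ext (LinearMap.ext fun x => V.counit_apply x)
      -- The coaction of f^*V is id ⊗ Δ, so this triangle is (ε ⊗ id)Δ = id on C'.
      right_triangle := by
        ext V : 2
        refine Comod.hom_ext (LinearMap.ext fun x => pullbackIncl_injective f V ?_)
        have e : ((TensorProduct.rid k V.carrier).toLinearMap ∘ₗ
            (Coalgebra.counit (R := k) (A := C'.obj)).lTensor V.carrier).rTensor C'.obj ∘ₗ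
            (TensorProduct.assoc k V.carrier C'.obj C'.obj).symm.toLinearMap =
            ((TensorProduct.lid k C'.obj).toLinearMap ∘ₗ
            (Coalgebra.counit (R := k) (A := C'.obj)).rTensor C'.obj).lTensor V.carrier := by
          ext; simp [TensorProduct.smul_tmul]
        have e2 : ((TensorProduct.lid k C'.obj).toLinearMap ∘ₗ
            (Coalgebra.counit (R := k) (A := C'.obj)).rTensor C'.obj).lTensor V.carrier ∘ₗ
            (Coalgebra.comul (R := k) (A := C'.obj)).lTensor V.carrier = LinearMap.id := by
          rw [← LinearMap.lTensor_comp, ← LinearMap.lTensor_id]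
          congr 1
          apply LinearMap.ext
          intro c
          simp
        have h := LinearMap.congr_fun e
          ((Coalgebra.comul (R := k) (A := C'.obj)).lTensor V.carrier (pullbackIncl f V x))
        have h2 := LinearMap.congr_fun e2 (pullbackIncl f V x)
        simp only [LinearMap.comp_apply, LinearEquiv.coe_coe, LinearMap.id_apply] at h h2
        rw [h2, ← pullbackIncl_coact, ← LinearMap.comp_apply, ← LinearMap.rTensor_comp] at h
        exact h }

end Corestrict

/-! ### The oplax structure of corestriction and the lax structure of f^* -/

section CorestrictMonoidal

open Functor.OplaxMonoidal

variable {k : Type u} [Field k] {C C' : Coalg k} (f : C' ⟶ C)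

open Comod

lemma corestrict_lcoact (V : Comod k C'.obj) :
    (corestrictObj f V).lcoact = (Coalg.lin f).rTensor V.carrier ∘ₗ V.lcoact := by
  have e : (TensorProduct.comm k V.carrier C.obj).toLinearMap ∘ₗ
      (Coalg.lin f).lTensor V.carrier = (Coalg.lin f).rTensor V.carrier ∘ₗ
      (TensorProduct.comm k V.carrier C'.obj).toLinearMap := by
    ext; simp
  exact congrArg (· ∘ₗ V.coact) e

/-- The equation over C is the image under f of the equation over C', applied to the middle leg.
Hence V □_{C'} W ⊆ V □_C W. -/
lemma incl_mem_corestrict (V W : Comod k C'.obj) :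
    (TensorProduct.assoc k V.carrier C.obj W.carrier).toLinearMap ∘ₗ
      (corestrictObj f V).coact.rTensor W.carrier ∘ₗ incl V W =
    (corestrictObj f W).lcoact.lTensor V.carrier ∘ₗ incl V W := by
  have e1 : (TensorProduct.assoc k V.carrier C.obj W.carrier).toLinearMap ∘ₗ
      ((Coalg.lin f).lTensor V.carrier).rTensor W.carrier =
      ((Coalg.lin f).rTensor W.carrier).lTensor V.carrier ∘ₗ
      (TensorProduct.assoc k V.carrier C'.obj W.carrier).toLinearMap := by
    ext; simp
  apply LinearMap.ext
  intro z
  have h1 := LinearMap.congr_fun e1 (V.coact.rTensor W.carrier (incl V W z))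
  simp only [LinearMap.comp_apply, LinearEquiv.coe_coe, LinearMap.rTensor_comp,
    LinearMap.lTensor_comp, corestrict_lcoact, incl_eq] at h1 ⊢
  exact h1

/-- The inclusion of the cotensor product over `C'` into the cotensor product over `C`. -/
def corestrictδ (V W : Comod k C'.obj) :
    (corestrict f).obj (V ⊗ W) ⟶ (corestrict f).obj V ⊗ (corestrict f).obj W :=
  ofLin (V := corestrictObj f (cten V W)) (W := cten (corestrictObj f V) (corestrictObj f W))
    (cotensorLift (corestrictObj f V) (corestrictObj f W) (isBicomod_lcoact _) (incl V W)
      (incl_mem_corestrict f V W))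
    (cotensor_colinear (corestrictObj f V) (corestrictObj f W) (isBicomod_lcoact _)
      (Z := corestrictObj f (cten V W)) _ (by
      rw [cotensorIncl_lift]
      have e1 : (TensorProduct.assoc k V.carrier W.carrier C.obj).symm.toLinearMap ∘ₗ
          ((Coalg.lin f).lTensor W.carrier).lTensor V.carrier =
          (Coalg.lin f).lTensor (V.carrier ⊗[k] W.carrier) ∘ₗ
          (TensorProduct.assoc k V.carrier W.carrier C'.obj).symm.toLinearMap := by
        ext; simp
      have e2 : (incl V W).rTensor C.obj ∘ₗ (Coalg.lin f).lTensor (cten V W).carrier =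
          (Coalg.lin f).lTensor (V.carrier ⊗[k] W.carrier) ∘ₗ (incl V W).rTensor C'.obj := by
        ext; simp
      apply LinearMap.ext
      intro z
      have h1 := LinearMap.congr_fun e1 (W.coact.lTensor V.carrier (incl V W z))
      have h2 := LinearMap.congr_fun e2 ((cten V W).coact z)
      simp only [LinearMap.comp_apply, LinearEquiv.coe_coe,
        LinearMap.lTensor_comp, incl_coact] at h1 h2 ⊢
      rw [h1, h2]))

/-- The coalgebra map `f : C' → C` as a map of `C`-comodules. -/
def corestrictη : (corestrict f).obj (𝟙_ (Comod k C'.obj)) ⟶ 𝟙_ (Comod k C.obj) :=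
  ofLin (V := corestrictObj f (regular k C'.obj)) (W := regular k C.obj) (Coalg.lin f) (by
    apply LinearMap.ext
    intro x
    have e : (Coalg.lin f).rTensor C.obj ∘ₗ (Coalg.lin f).lTensor C'.obj =
        TensorProduct.map (Coalg.lin f) (Coalg.lin f) := by
      ext; simp
    exact (LinearMap.congr_fun e (Coalgebra.comul x)).trans (Coalg.map_lin_comul f x) |>.symm)

/-- Corestriction changes neither underlying spaces nor underlying maps, so the composite is the
forgetful functor from C'-comodules. -/
instance : (corestrict f ⋙ forgetVec).OplaxMonoidal :=
  inferInstanceAs (forgetVec (k := k) (C := C'.obj)).OplaxMonoidal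

instance : (corestrict f).OplaxMonoidal :=
  oplaxOfForget (corestrict f) (corestrictη f) (corestrictδ f)
    (by
      apply ModuleCat.hom_ext
      exact LinearMap.ext fun x => Coalg.counit_lin f x)
    (fun V W => rfl)

instance : (comodPullback f).LaxMonoidal := (corestrictAdj f).rightAdjointLaxMonoidal

instance : (corestrictAdj f).IsMonoidal :=
  inferInstanceAs (letI := (corestrictAdj f).rightAdjointLaxMonoidal; (corestrictAdj f).IsMonoidal)

/-- Both symmetries restrict the flip of V ⊗ W, so corestriction respects them, and its right
adjoint inherits the property. -/
instance : (comodPullback f).LaxBraided :=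
  laxBraidedOfAdjunction (corestrictAdj f) fun V W => by
    apply hom_ext_δι
    rfl

/-- The Frobenius morphism is `v ⊗ c ⊗ x ↦ ε(c) v ⊗ x`. -/
lemma incl_frobenius (V : Comod k C.obj) (X : Comod k C'.obj)
    (z : (cten ((comodPullback f).obj V) X).carrier) :
    incl V (corestrictObj f X) (toLin (frobenius (corestrictAdj f) V X) z) =
      (pullbackCounit f V).rTensor X.carrier (incl ((comodPullback f).obj V) X z) := rfl

end CorestrictMonoidal

/-! ### The projection formula for comodules -/

section Frobenius

variable {k : Type u} [Field k] {C C' : Coalg k} (f : C' ⟶ C)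

open Comod

/-- The map `v ⊗ x ↦ v ⊗ x₋₁ ⊗ x₀`. -/
def coactAssoc (V : Type u) [AddCommGroup V] [Module k V] (X : Comod k C'.obj) :
    V ⊗[k] X.carrier →ₗ[k] (V ⊗[k] C'.obj) ⊗[k] X.carrier :=
  (TensorProduct.assoc k V C'.obj X.carrier).symm.toLinearMap ∘ₗ X.lcoact.lTensor V

lemma coactAssoc_tmul (V : Type u) [AddCommGroup V] [Module k V] (X : Comod k C'.obj) (v : V)
    (x : X.carrier) : coactAssoc V X (v ⊗ₜ x) =
      (TensorProduct.assoc k V C'.obj X.carrier).symm (v ⊗ₜ X.lcoact x) := rfl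

lemma coactAssoc_mem (V : Comod k C.obj) (X : Comod k C'.obj)
    (z : (cten V (corestrictObj f X)).carrier) :
    coactAssoc V.carrier X (incl V (corestrictObj f X) z) ∈
      LinearMap.range ((pullbackIncl f V).rTensor X.carrier) := by
  -- Since X is flat over k, f^*V ⊗ X is again an equalizer; it remains to verify its defining
  -- equation for v ⊗ x₋₁ ⊗ x₀.
  refine (mem_range_rTensor X.carrier _ _ _).mpr ?_
  -- This map coacts on X once more. The two sides of the required equation are Φ applied to the two
  -- sides of the equation defining V □_C f_!X; for the second one this uses coassociativity of X.
  let Φ : V.carrier ⊗[k] (C.obj ⊗[k] X.carrier) →ₗ[k]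
      (V.carrier ⊗[k] (C.obj ⊗[k] C'.obj)) ⊗[k] X.carrier :=
    (TensorProduct.assoc k V.carrier (C.obj ⊗[k] C'.obj) X.carrier).symm.toLinearMap ∘ₗ
      ((TensorProduct.assoc k C.obj C'.obj X.carrier).symm.toLinearMap ∘ₗ
        X.lcoact.lTensor C.obj).lTensor V.carrier
  have e1 : ((TensorProduct.assoc k V.carrier C.obj C'.obj).toLinearMap ∘ₗ
      V.coact.rTensor C'.obj).rTensor X.carrier ∘ₗ coactAssoc V.carrier X =
      Φ ∘ₗ (TensorProduct.assoc k V.carrier C.obj X.carrier).toLinearMap ∘ₗ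
        V.coact.rTensor X.carrier := by
    ext v x
    obtain ⟨s, hs⟩ := TensorProduct.exists_finset (V.coact v)
    obtain ⟨t, ht⟩ := TensorProduct.exists_finset (X.lcoact x)
    simp [Φ, coactAssoc, hs, ht, TensorProduct.tmul_sum, TensorProduct.sum_tmul]
    try rw [Finset.sum_comm]
  have e2 : ((leftCoact f).lTensor V.carrier).rTensor X.carrier ∘ₗ coactAssoc V.carrier X =
      Φ ∘ₗ (corestrictObj f X).lcoact.lTensor V.carrier := by
    have e3 : (leftCoact f).rTensor X.carrier ∘ₗ X.lcoact =
        (TensorProduct.assoc k C.obj C'.obj X.carrier).symm.toLinearMap ∘ₗ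
          X.lcoact.lTensor C.obj ∘ₗ (corestrictObj f X).lcoact := by
      have e4 : X.lcoact.lTensor C.obj ∘ₗ (Coalg.lin f).rTensor X.carrier =
          (Coalg.lin f).rTensor (C'.obj ⊗[k] X.carrier) ∘ₗ X.lcoact.lTensor C'.obj := by
        ext; simp
      have e5 : (TensorProduct.assoc k C.obj C'.obj X.carrier).symm.toLinearMap ∘ₗ
          (Coalg.lin f).rTensor (C'.obj ⊗[k] X.carrier) ∘ₗ
          (TensorProduct.assoc k C'.obj C'.obj X.carrier).toLinearMap =
          ((Coalg.lin f).rTensor C'.obj).rTensor X.carrier := by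
        ext; simp
      rw [corestrict_lcoact, ← LinearMap.comp_assoc (X.lcoact), e4, LinearMap.comp_assoc,
        ← lcoact_coassoc, leftCoact, LinearMap.rTensor_comp, ← e5]
      rfl
    apply TensorProduct.ext'
    intro v x
    have h3 := LinearMap.congr_fun e3 x
    simp only [LinearMap.comp_apply, LinearEquiv.coe_coe] at h3
    simp only [Φ, LinearMap.comp_apply, LinearEquiv.coe_coe, coactAssoc_tmul,
      LinearMap.lTensor_tmul]
    rw [← h3]
    generalize X.lcoact x = y
    induction y using TensorProduct.induction_on with
    | zero => simp
    | add p q hp hq => simp only [TensorProduct.tmul_add, map_add, hp, hq]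
    | tmul c x => simp
  have h1 := LinearMap.congr_fun e1 (incl V (corestrictObj f X) z)
  have h2 := LinearMap.congr_fun e2 (incl V (corestrictObj f X) z)
  simp only [LinearMap.comp_apply (f := Φ)] at h1 h2
  refine h1.trans (Eq.trans ?_ h2.symm)
  exact congrArg Φ (incl_eq V (corestrictObj f X) z)

lemma rTensor_pullbackIncl_injective (V : Comod k C.obj) (X : Type u) [AddCommGroup X]
    [Module k X] : Function.Injective ((pullbackIncl f V).rTensor X) :=
  Module.Flat.rTensor_preserves_injective_linearMap _ (pullbackIncl_injective f V)

/-- First lift of the inverse of the Frobenius morphism. -/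
def frobeniusInvAux (V : Comod k C.obj) (X : Comod k C'.obj) :
    (cten V (corestrictObj f X)).carrier →ₗ[k] ((comodPullback f).obj V).carrier ⊗[k] X.carrier :=
  factorThrough ((pullbackIncl f V).rTensor X.carrier)
    (rTensor_pullbackIncl_injective f V X.carrier)
    (coactAssoc V.carrier X ∘ₗ incl V (corestrictObj f X)) (coactAssoc_mem f V X)

lemma rTensor_frobeniusInvAux (V : Comod k C.obj) (X : Comod k C'.obj)
    (z : (cten V (corestrictObj f X)).carrier) :
    (pullbackIncl f V).rTensor X.carrier (frobeniusInvAux f V X z) =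
      coactAssoc V.carrier X (incl V (corestrictObj f X) z) :=
  factorThrough_apply _ _ _ _ z

/-- By coassociativity of X, both sides are v ⊗ x₋₂ ⊗ x₋₁ ⊗ x₀. -/
lemma frobeniusInvAux_eq (V : Comod k C.obj) (X : Comod k C'.obj) :
    (TensorProduct.assoc k ((comodPullback f).obj V).carrier C'.obj X.carrier).toLinearMap ∘ₗ
      ((comodPullback f).obj V).coact.rTensor X.carrier ∘ₗ frobeniusInvAux f V X =
    X.lcoact.lTensor ((comodPullback f).obj V).carrier ∘ₗ frobeniusInvAux f V X := by
  apply LinearMap.ext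
  intro z
  apply rTensor_pullbackIncl_injective f V (C'.obj ⊗[k] X.carrier)
  have e3 : (pullbackIncl f V).rTensor (C'.obj ⊗[k] X.carrier) ∘ₗ
      (TensorProduct.assoc k ((comodPullback f).obj V).carrier C'.obj X.carrier).toLinearMap ∘ₗ
      ((comodPullback f).obj V).coact.rTensor X.carrier =
      (TensorProduct.assoc k (V.carrier ⊗[k] C'.obj) C'.obj X.carrier).toLinearMap ∘ₗ
      ((TensorProduct.assoc k V.carrier C'.obj C'.obj).symm.toLinearMap ∘ₗ
        (Coalgebra.comul (R := k) (A := C'.obj)).lTensor V.carrier).rTensor X.carrier ∘ₗ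
      (pullbackIncl f V).rTensor X.carrier := by
    apply TensorProduct.ext'
    intro v x
    have h := pullbackIncl_coact f V v
    simp only [LinearMap.comp_apply, LinearEquiv.coe_coe, LinearMap.rTensor_tmul]
    rw [← h]
    generalize ((comodPullback f).obj V).coact v = y
    induction y using TensorProduct.induction_on with
    | zero => simp
    | add p q hp hq => simp only [TensorProduct.add_tmul, map_add, hp, hq]
    | tmul c x => simp
  have e4 : (pullbackIncl f V).rTensor (C'.obj ⊗[k] X.carrier) ∘ₗ
      X.lcoact.lTensor ((comodPullback f).obj V).carrier =
      X.lcoact.lTensor (V.carrier ⊗[k] C'.obj) ∘ₗ (pullbackIncl f V).rTensor X.carrier := by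
    ext; simp
  have e5 : (TensorProduct.assoc k (V.carrier ⊗[k] C'.obj) C'.obj X.carrier).toLinearMap ∘ₗ
      ((TensorProduct.assoc k V.carrier C'.obj C'.obj).symm.toLinearMap ∘ₗ
        (Coalgebra.comul (R := k) (A := C'.obj)).lTensor V.carrier).rTensor X.carrier ∘ₗ
      coactAssoc V.carrier X =
      X.lcoact.lTensor (V.carrier ⊗[k] C'.obj) ∘ₗ coactAssoc V.carrier X := by
    apply TensorProduct.ext'
    intro v x
    have h := LinearMap.congr_fun (lcoact_coassoc X) x
    have a1 : X.lcoact.lTensor (V.carrier ⊗[k] C'.obj) ∘ₗ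
        (TensorProduct.assoc k V.carrier C'.obj X.carrier).symm.toLinearMap =
        (TensorProduct.assoc k V.carrier C'.obj (C'.obj ⊗[k] X.carrier)).symm.toLinearMap ∘ₗ
          (X.lcoact.lTensor C'.obj).lTensor V.carrier := by
      ext; simp
    have h1 := LinearMap.congr_fun a1 (v ⊗ₜ X.lcoact x)
    simp only [LinearMap.comp_apply, LinearEquiv.coe_coe, LinearMap.lTensor_tmul,
      coactAssoc_tmul] at h h1 ⊢
    rw [h1, ← h]
    generalize X.lcoact x = y
    induction y using TensorProduct.induction_on with
    | zero => simp
    | add p q hp hq => simp only [TensorProduct.tmul_add, map_add, hp, hq]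
    | tmul c x =>
      obtain ⟨s, hs⟩ := TensorProduct.exists_finset (Coalgebra.comul (R := k) c)
      simp [hs, TensorProduct.sum_tmul, TensorProduct.tmul_sum]
  have h3 := LinearMap.congr_fun e3 (frobeniusInvAux f V X z)
  have h4 := LinearMap.congr_fun e4 (frobeniusInvAux f V X z)
  have h5 := LinearMap.congr_fun e5 (incl V (corestrictObj f X) z)
  simp only [LinearMap.comp_apply, rTensor_frobeniusInvAux] at h3 h4 h5 ⊢
  rw [h3, h4, h5]

/-- The inverse of the Frobenius morphism: `v ⊗ x ↦ v ⊗ x₋₁ ⊗ x₀`. -/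
def frobeniusInv (V : Comod k C.obj) (X : Comod k C'.obj) :
    (cten V (corestrictObj f X)).carrier →ₗ[k] (cten ((comodPullback f).obj V) X).carrier :=
  cotensorLift ((comodPullback f).obj V) X X.isBicomod_lcoact (frobeniusInvAux f V X)
    (frobeniusInvAux_eq f V X)

lemma incl_frobeniusInv (V : Comod k C.obj) (X : Comod k C'.obj)
    (z : (cten V (corestrictObj f X)).carrier) :
    (pullbackIncl f V).rTensor X.carrier
      (incl ((comodPullback f).obj V) X (frobeniusInv f V X z)) =
      coactAssoc V.carrier X (incl V (corestrictObj f X) z) :=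
  rTensor_frobeniusInvAux f V X z

/-- The candidate inverse is v ⊗ x ↦ v ⊗ x₋₁ ⊗ x₀. One composite is the identity by the cotensor
equation over C' and counitality of C', the other by counitality of X. -/
instance isIso_frobenius (V : Comod k C.obj) (X : Comod k C'.obj) :
    IsIso (frobenius (corestrictAdj f) V X) := by
  apply isIso_of_bijective
  refine Function.bijective_iff_has_inverse.mpr ⟨frobeniusInv f V X, fun z => ?_, fun z => ?_⟩
  · apply incl_injective
    apply rTensor_pullbackIncl_injective f V X.carrier
    refine (incl_frobeniusInv f V X _).trans
      ((congrArg (coactAssoc V.carrier X) (incl_frobenius f V X z)).trans ?_)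
    have e1 : coactAssoc V.carrier X ∘ₗ (pullbackCounit f V).rTensor X.carrier =
        (((TensorProduct.rid k V.carrier).toLinearMap ∘ₗ
          (Coalgebra.counit (R := k) (A := C'.obj)).lTensor V.carrier).rTensor C'.obj).rTensor
            X.carrier ∘ₗ
        (TensorProduct.assoc k (V.carrier ⊗[k] C'.obj) C'.obj X.carrier).symm.toLinearMap ∘ₗ
        X.lcoact.lTensor (V.carrier ⊗[k] C'.obj) ∘ₗ (pullbackIncl f V).rTensor X.carrier := by
      apply TensorProduct.ext'
      intro v x
      obtain ⟨s, hs⟩ := TensorProduct.exists_finset (X.lcoact x)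
      simp [coactAssoc, hs, TensorProduct.tmul_sum, pullbackCounit]
    have e2 : ((TensorProduct.rid k V.carrier).toLinearMap ∘ₗ
          (Coalgebra.counit (R := k) (A := C'.obj)).lTensor V.carrier).rTensor C'.obj ∘ₗ
        (TensorProduct.assoc k V.carrier C'.obj C'.obj).symm.toLinearMap ∘ₗ
          (Coalgebra.comul (R := k) (A := C'.obj)).lTensor V.carrier = LinearMap.id := by
      have e : ((TensorProduct.rid k V.carrier).toLinearMap ∘ₗ
          (Coalgebra.counit (R := k) (A := C'.obj)).lTensor V.carrier).rTensor C'.obj ∘ₗ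
          (TensorProduct.assoc k V.carrier C'.obj C'.obj).symm.toLinearMap =
          ((TensorProduct.lid k C'.obj).toLinearMap ∘ₗ
          (Coalgebra.counit (R := k) (A := C'.obj)).rTensor C'.obj).lTensor V.carrier := by
        ext; simp [TensorProduct.smul_tmul]
      rw [← LinearMap.comp_assoc, e, ← LinearMap.lTensor_comp, ← LinearMap.lTensor_id]
      congr 1
      apply LinearMap.ext
      intro c
      simp
    have e3 : (pullbackIncl f V).rTensor (C'.obj ⊗[k] X.carrier) ∘ₗ
        X.lcoact.lTensor ((comodPullback f).obj V).carrier =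
        X.lcoact.lTensor (V.carrier ⊗[k] C'.obj) ∘ₗ (pullbackIncl f V).rTensor X.carrier := by
      ext; simp
    have e4 : (TensorProduct.assoc k (V.carrier ⊗[k] C'.obj) C'.obj X.carrier).symm.toLinearMap ∘ₗ
        (pullbackIncl f V).rTensor (C'.obj ⊗[k] X.carrier) ∘ₗ
        (TensorProduct.assoc k ((comodPullback f).obj V).carrier C'.obj X.carrier).toLinearMap =
        ((pullbackIncl f V).rTensor C'.obj).rTensor X.carrier := by
      ext; simp
    have e5 : ((pullbackIncl f V).rTensor C'.obj ∘ₗ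
        ((comodPullback f).obj V).coact) =
        (TensorProduct.assoc k V.carrier C'.obj C'.obj).symm.toLinearMap ∘ₗ
          (Coalgebra.comul (R := k) (A := C'.obj)).lTensor V.carrier ∘ₗ pullbackIncl f V :=
      LinearMap.ext fun x => pullbackIncl_coact f V x
    -- The equation over C' reads v ⊗ c₁ ⊗ c₂ ⊗ x = v ⊗ c ⊗ x₋₁ ⊗ x₀. Applying ε to the first C'-leg
    -- turns the left side into v ⊗ c ⊗ x and the right side into the composite being computed.
    have h0 := incl_eq ((comodPullback f).obj V) X z
    revert h0
    generalize incl ((comodPullback f).obj V) X z = y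
    intro h0
    have h1 := LinearMap.congr_fun e1 y
    have h3 := LinearMap.congr_fun e3 y
    have h4 := LinearMap.congr_fun e4 (((comodPullback f).obj V).coact.rTensor X.carrier y)
    have h5 := LinearMap.congr_fun (congrArg (LinearMap.rTensor X.carrier) e5) y
    have h2 := LinearMap.congr_fun (congrArg (LinearMap.rTensor X.carrier) e2)
      ((pullbackIncl f V).rTensor X.carrier y)
    simp only [LinearMap.comp_apply, LinearEquiv.coe_coe, LinearMap.rTensor_comp,
      LinearMap.rTensor_id, LinearMap.id_apply] at h1 h2 h3 h4 h5
    rw [h0, h3, h5] at h4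
    rw [h1, h4, h2]
  · change (cten V (corestrictObj f X)).carrier at z
    apply incl_injective
    refine (incl_frobenius f V X (frobeniusInv f V X z)).trans ?_
    rw [pullbackCounit, LinearMap.rTensor_comp, LinearMap.rTensor_comp]
    simp only [LinearMap.comp_apply]
    rw [incl_frobeniusInv]
    -- The second composite is v ⊗ x ↦ v ⊗ ε(x₋₁)x₀, the identity already on all of V ⊗ X.
    have e1 : ((TensorProduct.rid k V.carrier).toLinearMap.rTensor X.carrier) ∘ₗ
        ((Coalgebra.counit (R := k) (A := C'.obj)).lTensor V.carrier).rTensor X.carrier ∘ₗ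
        coactAssoc V.carrier X = LinearMap.id := by
      have a1 : ((TensorProduct.rid k V.carrier).toLinearMap.rTensor X.carrier) ∘ₗ
          ((Coalgebra.counit (R := k) (A := C'.obj)).lTensor V.carrier).rTensor X.carrier ∘ₗ
          (TensorProduct.assoc k V.carrier C'.obj X.carrier).symm.toLinearMap =
          ((TensorProduct.rid k X.carrier).toLinearMap ∘ₗ
            (Coalgebra.counit (R := k) (A := C'.obj)).lTensor X.carrier ∘ₗ
            (TensorProduct.comm k C'.obj X.carrier).toLinearMap).lTensor V.carrier := by
        ext; simp [TensorProduct.smul_tmul]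
      apply TensorProduct.ext'
      intro v x
      have h1 := LinearMap.congr_fun a1 (v ⊗ₜ X.lcoact x)
      have h2 := X.counit_apply x
      simp only [LinearMap.comp_apply, LinearEquiv.coe_coe, LinearMap.lTensor_tmul, coactAssoc_tmul,
        lcoact, LinearMap.id_apply] at h1 ⊢
      rw [h1]
      rw [← TensorProduct.comm_symm, LinearEquiv.symm_apply_apply, h2]
    exact LinearMap.congr_fun e1 (incl V (corestrictObj f X) z)

end Frobenius

/-! ### The projection formula and strong monoidal right adjoints -/

section FormalStrong

universe v₁ v₂ u₁ u₂

open Functor.LaxMonoidal Functor.OplaxMonoidal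

variable {ℳ : Type u₁} [Category.{v₁} ℳ] [MonoidalCategory ℳ]
  {ℳ' : Type u₂} [Category.{v₂} ℳ'] [MonoidalCategory ℳ']
  {F : ℳ' ⥤ ℳ} {K : ℳ ⥤ ℳ'} (adj : F ⊣ K) [F.OplaxMonoidal]

/-- If the Frobenius morphisms are isomorphisms and the left adjoint is conservative, then the
right adjoint preserves the unit. -/
theorem isIso_ε_of_frobenius [K.LaxMonoidal] [adj.IsMonoidal] [F.ReflectsIsomorphisms]
    [∀ V X, IsIso (frobenius adj V X)] : IsIso (ε K) := by
  -- Frobenius at the unit gives F K I ≅ I ⊗ F I' ≅ F I'. This isomorphism is a retraction of F(ε),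
  -- which is therefore invertible.
  have h : F.map (ε K) ≫ F.map (ρ_ _).inv ≫ frobenius adj (𝟙_ ℳ) (𝟙_ ℳ') ≫ (λ_ _).hom =
      𝟙 _ := by
    rw [← Functor.map_comp_assoc, MonoidalCategory.rightUnitor_inv_naturality,
      Functor.map_comp_assoc, frobenius, Category.assoc, ← δ_natural_left_assoc,
      ← MonoidalCategory.comp_whiskerRight_assoc, adj.map_ε_comp_counit_app_unit,
      ← MonoidalCategory.unitors_inv_equal]
    have := oplax_left_unitality F (𝟙_ ℳ')
    rw [← Category.assoc, ← Category.assoc, Category.assoc (F.map _), ← this, Iso.inv_hom_id]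
  have : IsIso (F.map (ε K) ≫ F.map (ρ_ _).inv ≫ frobenius adj (𝟙_ ℳ) (𝟙_ ℳ') ≫ (λ_ _).hom) := by
    rw [h]; infer_instance
  have := IsIso.of_isIso_comp_right (F.map (ε K))
    (F.map (ρ_ _).inv ≫ frobenius adj (𝟙_ ℳ) (𝟙_ ℳ') ≫ (λ_ _).hom)
  exact isIso_of_reflects_iso (ε K) F

/-- If the Frobenius morphisms are isomorphisms and the left adjoint is conservative, then the
right adjoint preserves tensor products. -/
theorem isIso_μ_of_frobenius [K.LaxMonoidal] [adj.IsMonoidal] [F.ReflectsIsomorphisms]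
    [∀ V X, IsIso (frobenius adj V X)] (V W : ℳ) : IsIso (μ K V W) := by
  -- Via F K V ≅ V ⊗ F I', both F(KV ⊗ KW) and F K(V ⊗ W) become V ⊗ (W ⊗ F I'). The identity says
  -- that F(μ) respects these identifications, so it is invertible.
  have h : F.map (μ K V W) ≫ F.map (ρ_ _).inv ≫ frobenius adj (V ⊗ W) (𝟙_ ℳ') ≫ (α_ _ _ _).hom =
      frobenius adj V (K.obj W) ≫ V ◁ (F.map (ρ_ _).inv ≫ frobenius adj W (𝟙_ ℳ')) := by
    rw [← Functor.map_comp_assoc, MonoidalCategory.rightUnitor_inv_naturality,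
      Functor.map_comp_assoc, frobenius, Category.assoc, ← δ_natural_left_assoc,
      ← MonoidalCategory.comp_whiskerRight_assoc, adj.map_μ_comp_counit_app_tensor]
    rw [← MonoidalCategory.tensorHom_id (δ F _ _ ≫ _),
      ← Category.comp_id (𝟙 (F.obj (𝟙_ ℳ'))), ← MonoidalCategory.tensorHom_comp_tensorHom,
      Category.assoc]
    have hα := MonoidalCategory.associator_naturality (X₁ := F.obj (K.obj V)) (Y₁ := V)
      (X₂ := F.obj (K.obj W)) (Y₂ := W) (adj.counit.app V) (adj.counit.app W) (𝟙 (F.obj (𝟙_ ℳ')))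
    dsimp only [Functor.comp_obj, Functor.id_obj] at hα ⊢
    rw [hα, MonoidalCategory.tensorHom_id, Functor.OplaxMonoidal.associativity_assoc, ← Functor.map_comp_assoc, MonoidalCategory.rightUnitor_tensor_inv,
      Category.assoc, Iso.inv_hom_id, Category.comp_id, ← δ_natural_right_assoc, frobenius,
      frobenius]
    simp only [MonoidalCategory.whiskerLeft_comp, Category.assoc, MonoidalCategory.tensorHom_def,
      MonoidalCategory.whiskerLeft_id, Category.comp_id]
    simp only [MonoidalCategory.whisker_exchange_assoc]
  have : IsIso (F.map (μ K V W) ≫ F.map (ρ_ _).inv ≫ frobenius adj (V ⊗ W) (𝟙_ ℳ') ≫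
      (α_ _ _ _).hom) := by
    rw [h]; infer_instance
  have := IsIso.of_isIso_comp_right (F.map (μ K V W))
    (F.map (ρ_ _).inv ≫ frobenius adj (V ⊗ W) (𝟙_ ℳ') ≫ (α_ _ _ _).hom)
  exact isIso_of_reflects_iso (μ K V W) F

end FormalStrong

/-! ### f^* is strong symmetric monoidal, with explicit structure maps -/

section PullbackStrong

variable {k : Type u} [Field k] {C C' : Coalg k} (f : C' ⟶ C)

open Comod

/-- For comodules over any coalgebra, an isomorphism is a bijective colinear map, and corestriction
keeps the underlying linear map. -/
instance : (corestrict f).ReflectsIsomorphisms where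
  reflects g _ := isIso_of_bijective g (bijective_of_isIso ((corestrict f).map g))

instance : IsIso (Functor.LaxMonoidal.ε (comodPullback f)) :=
  isIso_ε_of_frobenius (corestrictAdj f)

instance (V W : Comod k C.obj) : IsIso (Functor.LaxMonoidal.μ (comodPullback f) V W) :=
  isIso_μ_of_frobenius (corestrictAdj f) V W

/-- The pullback functor of comodules is strong symmetric monoidal. -/
@[reducible] def comodPullbackBraided : (comodPullback f).Braided :=
  { Functor.Monoidal.ofLaxMonoidal (comodPullback f) with
    braided := Functor.LaxBraided.braided }

/-- This is a triangle identity of the adjunction, read inside V ⊗ C'. -/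
lemma rTensor_pullbackCounit_coact (V : Comod k C.obj)
    (x : ((comodPullback f).obj V).carrier) :
    (pullbackCounit f V).rTensor C'.obj (((comodPullback f).obj V).coact x) =
      pullbackIncl f V x :=
  congrArg (pullbackIncl f V) (LinearMap.congr_fun
    (congrArg toLin ((corestrictAdj f).right_triangle_components V)) x)

lemma pullbackIncl_ε (c : C'.obj) : pullbackIncl f (𝟙_ (Comod k C.obj))
    (toLin (Functor.LaxMonoidal.ε (comodPullback f)) c) = leftCoact f c := rfl

/-- The map μ is the transpose of the oplax map followed by the two counits, and transposition
starts with the unit, which is the coaction. So μ coacts with C' and then applies ε to both original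
C'-legs. -/
lemma pullbackIncl_μ (V W : Comod k C.obj)
    (x : (cten ((comodPullback f).obj V) ((comodPullback f).obj W)).carrier) :
    (incl V W).rTensor C'.obj (pullbackIncl f (V ⊗ W)
        (toLin (Functor.LaxMonoidal.μ (comodPullback f) V W) x)) =
      mulCounit V.carrier W.carrier C'.obj
        (TensorProduct.map (pullbackIncl f V) (pullbackIncl f W)
          (incl ((comodPullback f).obj V) ((comodPullback f).obj W) x)) := by
  have h0 : (incl V W).rTensor C'.obj (pullbackIncl f (V ⊗ W)
        (toLin (Functor.LaxMonoidal.μ (comodPullback f) V W) x)) =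
      (TensorProduct.map (pullbackCounit f V) (pullbackCounit f W)).rTensor C'.obj
        ((incl ((comodPullback f).obj V) ((comodPullback f).obj W)).rTensor C'.obj
          ((cten ((comodPullback f).obj V) ((comodPullback f).obj W)).coact x)) := by
    have e : incl V W ∘ₗ toLin (Functor.OplaxMonoidal.δ (corestrict f) ((comodPullback f).obj V)
          ((comodPullback f).obj W) ≫
        ((corestrictAdj f).counit.app V ⊗ₘ (corestrictAdj f).counit.app W)) =
        TensorProduct.map (pullbackCounit f V) (pullbackCounit f W) ∘ₗ
          incl ((comodPullback f).obj V) ((comodPullback f).obj W) := rfl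
    have h := congrArg (fun t => t.rTensor C'.obj
      ((cten ((comodPullback f).obj V) ((comodPullback f).obj W)).coact x)) e
    exact ((LinearMap.rTensor_comp_apply C'.obj _ _ _).symm.trans h).trans
      (LinearMap.rTensor_comp_apply C'.obj _ _ _)
  -- The coaction of a cotensor product is that of its second factor, so the triangle identity
  -- restores the C'-leg of W, while the one of V is lost to ε.
  rw [h0, incl_coact]
  have e : (TensorProduct.map (pullbackCounit f V) (pullbackCounit f W)).rTensor C'.obj ∘ₗ
      (TensorProduct.assoc k ((comodPullback f).obj V).carrier
        ((comodPullback f).obj W).carrier C'.obj).symm.toLinearMap ∘ₗ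
      ((comodPullback f).obj W).coact.lTensor ((comodPullback f).obj V).carrier =
      mulCounit V.carrier W.carrier C'.obj ∘ₗ
        TensorProduct.map (pullbackIncl f V) (pullbackIncl f W) := by
    apply TensorProduct.ext'
    intro v w
    have a1 : (TensorProduct.map (pullbackCounit f V) (pullbackCounit f W)).rTensor C'.obj ∘ₗ
      (TensorProduct.assoc k ((comodPullback f).obj V).carrier
        ((comodPullback f).obj W).carrier C'.obj).symm.toLinearMap =
        (TensorProduct.assoc k V.carrier W.carrier C'.obj).symm.toLinearMap ∘ₗ
        TensorProduct.map (pullbackCounit f V) ((pullbackCounit f W).rTensor C'.obj) := by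
      ext; simp
    have a2 : mulCounit V.carrier W.carrier C'.obj =
        (TensorProduct.assoc k V.carrier W.carrier C'.obj).symm.toLinearMap ∘ₗ
        TensorProduct.map ((TensorProduct.rid k V.carrier).toLinearMap ∘ₗ
          (Coalgebra.counit (R := k) (A := C'.obj)).lTensor V.carrier) LinearMap.id := by
      ext
      simp [mulCounit, TensorProduct.smul_tmul]
    have h1 := LinearMap.congr_fun a1 (v ⊗ₜ ((comodPullback f).obj W).coact w)
    simp only [LinearMap.comp_apply, LinearMap.lTensor_tmul, TensorProduct.map_tmul,
      LinearEquiv.coe_coe, rTensor_pullbackCounit_coact] at h1 ⊢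
    rw [h1, a2]
    simp [pullbackCounit]
  exact LinearMap.congr_fun e _

end PullbackStrong

/-! ### Pairings, and equalizers of cocommutative coalgebras -/

section PullbackCoalg

variable {k : Type u} [Field k]

/-- The pairing `(p ⊗ q) ∘ Δ` as a linear map. -/
def pair {P D E : Coalg k} (p : P ⟶ D) (q : P ⟶ E) : P.obj →ₗ[k] D.obj ⊗[k] E.obj :=
  TensorProduct.map (Coalg.lin p) (Coalg.lin q) ∘ₗ Coalgebra.comul

lemma pair_apply {P D E : Coalg k} (p : P ⟶ D) (q : P ⟶ E) (x : P.obj) :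
    pair p q x = TensorProduct.map (Coalg.lin p) (Coalg.lin q) (Coalgebra.comul x) := rfl

lemma Coalg.lin_comp {P D E : Coalg k} (p : P ⟶ D) (q : D ⟶ E) :
    Coalg.lin (p ≫ q) = Coalg.lin q ∘ₗ Coalg.lin p := rfl

lemma pair_lin {Q P D E : Coalg k} (g : Q ⟶ P) (p : P ⟶ D) (q : P ⟶ E) (x : Q.obj) :
    pair p q (Coalg.lin g x) = pair (g ≫ p) (g ≫ q) x := by
  rw [pair_apply, pair_apply, ← Coalg.map_lin_comul, Coalg.lin_comp, Coalg.lin_comp,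
    TensorProduct.map_comp]
  rfl

lemma pair_comp {P D E D' E' : Coalg k} (p : P ⟶ D) (q : P ⟶ E) (a : D ⟶ D') (b : E ⟶ E')
    (x : P.obj) : pair (p ≫ a) (q ≫ b) x =
      TensorProduct.map (Coalg.lin a) (Coalg.lin b) (pair p q x) := by
  rw [pair_apply, pair_apply, Coalg.lin_comp, Coalg.lin_comp, TensorProduct.map_comp]
  rfl

/-- Coassociativity makes both sides p(x₁) ⊗ q(x₂) ⊗ r(x₃). -/
lemma pair_assoc {P D E F : Coalg k} (p : P ⟶ D) (q : P ⟶ E) (r : P ⟶ F) (x : P.obj) :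
    TensorProduct.assoc k D.obj E.obj F.obj
      (TensorProduct.map (pair p q) (Coalg.lin r) (Coalgebra.comul x)) =
    TensorProduct.map (Coalg.lin p) (pair q r) (Coalgebra.comul x) := by
  have e1 : (TensorProduct.assoc k D.obj E.obj F.obj).toLinearMap ∘ₗ
      TensorProduct.map (pair p q) (Coalg.lin r) =
      TensorProduct.map (Coalg.lin p) (TensorProduct.map (Coalg.lin q) (Coalg.lin r)) ∘ₗ
      (TensorProduct.assoc k P.obj P.obj P.obj).toLinearMap ∘ₗ
        (Coalgebra.comul (R := k) (A := P.obj)).rTensor P.obj := by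
    ext a b
    obtain ⟨s, hs⟩ := TensorProduct.exists_finset (Coalgebra.comul (R := k) a)
    simp [pair, hs, TensorProduct.sum_tmul]
  have e2 : TensorProduct.map (Coalg.lin p) (pair q r) =
      TensorProduct.map (Coalg.lin p) (TensorProduct.map (Coalg.lin q) (Coalg.lin r)) ∘ₗ
        (Coalgebra.comul (R := k) (A := P.obj)).lTensor P.obj := by
    ext a b
    simp [pair]
  have h1 := LinearMap.congr_fun e1 (Coalgebra.comul x)
  have h2 := LinearMap.congr_fun e2 (Coalgebra.comul x)
  simp only [LinearMap.comp_apply, LinearEquiv.coe_coe] at h1 h2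
  rw [h1, h2, Coalgebra.coassoc_apply]

section Equalizer

variable {M C : Coalg k} (g h : M ⟶ C)

/-- The comodule `x ↦ x₁ ⊗ g(x₂)` of a coalgebra map. -/
def coactOf (g : M ⟶ C) : M.obj →ₗ[k] M.obj ⊗[k] C.obj :=
  (Coalg.lin g).lTensor M.obj ∘ₗ Coalgebra.comul

lemma coactOf_lTensor (x : M.obj) : (coactOf g).lTensor M.obj (Coalgebra.comul x) =
    TensorProduct.assoc k M.obj M.obj C.obj
      ((Coalgebra.comul (R := k) (A := M.obj)).rTensor C.obj (coactOf g x)) := by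
  have e : (TensorProduct.assoc k M.obj M.obj C.obj).toLinearMap ∘ₗ
      (Coalgebra.comul (R := k) (A := M.obj)).rTensor C.obj ∘ₗ (Coalg.lin g).lTensor M.obj =
      ((Coalg.lin g).lTensor M.obj).lTensor M.obj ∘ₗ
      (TensorProduct.assoc k M.obj M.obj M.obj).toLinearMap ∘ₗ
      (Coalgebra.comul (R := k) (A := M.obj)).rTensor M.obj := by
    ext a b
    obtain ⟨s, hs⟩ := TensorProduct.exists_finset (Coalgebra.comul (R := k) a)
    simp [hs, TensorProduct.sum_tmul]
  have h1 := LinearMap.congr_fun e (Coalgebra.comul x)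
  simp only [LinearMap.comp_apply, LinearEquiv.coe_coe, coactOf, LinearMap.lTensor_comp] at h1 ⊢
  rw [h1, Coalgebra.coassoc_apply]

lemma coactOf_rTensor (x : M.obj) : (coactOf g).rTensor M.obj (Coalgebra.comul x) =
    TensorProduct.comm k M.obj (M.obj ⊗[k] C.obj)
      ((coactOf g).lTensor M.obj (Coalgebra.comul x)) := by
  have e : (TensorProduct.comm k M.obj (M.obj ⊗[k] C.obj)).toLinearMap ∘ₗ
      (coactOf g).lTensor M.obj = (coactOf g).rTensor M.obj ∘ₗ
      (TensorProduct.comm k M.obj M.obj).toLinearMap := by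
    ext; simp
  have h1 := LinearMap.congr_fun e (Coalgebra.comul x)
  simp only [LinearMap.comp_apply, LinearEquiv.coe_coe, Coalgebra.comm_comul] at h1
  exact h1.symm

/-- Let K be this equalizer. If x₁ ⊗ g(x₂) = x₁ ⊗ h(x₂), coassociativity puts the second leg of Δx
in K, and cocommutativity puts the first leg there. Flatness turns the two conditions into Δx ∈ K ⊗
K. -/
lemma isSubcoalgebra_eqLocus_coactOf :
    IsSubcoalgebra (LinearMap.eqLocus (coactOf g) (coactOf h)) := by
  intro x hx
  have hx' : coactOf g x = coactOf h x := hx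
  set K := LinearMap.eqLocus (coactOf g) (coactOf h) with hK
  -- The condition on the first leg is flipped to the second by cocommutativity, giving a preimage y
  -- of Δx in K ⊗ M.
  obtain ⟨y, hy⟩ := (mem_range_rTensor M.obj (coactOf g) (coactOf h) (Coalgebra.comul x)).mpr
    (by rw [coactOf_rTensor, coactOf_rTensor, coactOf_lTensor, coactOf_lTensor, hx'])
  have hl : (coactOf g).lTensor M.obj (Coalgebra.comul x) =
      (coactOf h).lTensor M.obj (Coalgebra.comul x) := by
    rw [coactOf_lTensor, coactOf_lTensor, hx']
  -- The condition on the second leg is known in M ⊗ M ⊗ C. It descends to K ⊗ M ⊗ C because K → M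
  -- stays injective after tensoring.
  obtain ⟨z, hz⟩ := (mem_range_lTensor K (coactOf g) (coactOf h) y).mpr (by
    apply Module.Flat.rTensor_preserves_injective_linearMap (M := M.obj ⊗[k] C.obj) K.subtype
      K.injective_subtype
    have e (t : M ⟶ C) : K.subtype.rTensor (M.obj ⊗[k] C.obj) ∘ₗ (coactOf t).lTensor K =
        (coactOf t).lTensor M.obj ∘ₗ K.subtype.rTensor M.obj := by
      ext; simp
    have e1 := LinearMap.congr_fun (e g) y
    have e2 := LinearMap.congr_fun (e h) y
    simp only [LinearMap.comp_apply] at e1 e2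
    rw [e1, e2]
    rw [← hy] at hl
    exact hl)
  refine ⟨z, ?_⟩
  have e : TensorProduct.map K.subtype K.subtype =
      K.subtype.rTensor M.obj ∘ₗ K.subtype.lTensor K := by
    ext; simp
  rw [e, LinearMap.comp_apply]
  exact (congrArg _ hz).trans hy

/-- The equalizer of two maps of cocommutative coalgebras is the equalizer of the induced
coactions. -/
lemma eqSub_eq : eqSub g h = LinearMap.eqLocus (coactOf g) (coactOf h) := by
  apply le_antisymm
  -- Here Δx lies in S ⊗ S for S = `eqSub g h`, and g and h agree on its second leg.
  · intro x hx
    obtain ⟨y, hy⟩ := eqSub_isSubcoalgebra g h x hx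
    have e : (Coalg.lin g).lTensor M.obj ∘ₗ
        TensorProduct.map (eqSub g h).subtype (eqSub g h).subtype =
        (Coalg.lin h).lTensor M.obj ∘ₗ
        TensorProduct.map (eqSub g h).subtype (eqSub g h).subtype := by
      apply TensorProduct.ext'
      intro a b
      simp only [LinearMap.comp_apply, TensorProduct.map_tmul, LinearMap.lTensor_tmul]
      exact congrArg _ (eqSub_le g h b.2)
    have h1 := LinearMap.congr_fun e y
    simp only [LinearMap.comp_apply, hy] at h1
    exact h1
  -- Applying ε to the first leg of x₁ ⊗ g(x₂) recovers g(x), so g and h agree on this subcoalgebra.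
  · refine le_sSup ⟨isSubcoalgebra_eqLocus_coactOf g h, fun x hx => ?_⟩
    have e (t : M ⟶ C) : (TensorProduct.lid k C.obj).toLinearMap ∘ₗ
        (Coalgebra.counit (R := k) (A := M.obj)).rTensor C.obj ∘ₗ coactOf t = Coalg.lin t := by
      have a1 : (TensorProduct.lid k C.obj).toLinearMap ∘ₗ
        (Coalgebra.counit (R := k) (A := M.obj)).rTensor C.obj ∘ₗ (Coalg.lin t).lTensor M.obj =
        Coalg.lin t ∘ₗ (TensorProduct.lid k M.obj).toLinearMap ∘ₗ
        (Coalgebra.counit (R := k) (A := M.obj)).rTensor M.obj := by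
        ext; simp
      apply LinearMap.ext
      intro y
      have := LinearMap.congr_fun a1 (Coalgebra.comul y)
      simp only [LinearMap.comp_apply, coactOf] at this ⊢
      rw [this]
      simp
    have h1 := LinearMap.congr_fun (e g) x
    have h2 := LinearMap.congr_fun (e h) x
    simp only [LinearMap.comp_apply] at h1 h2
    rw [show coactOf g x = coactOf h x from hx] at h1
    exact h1.symm.trans h2

end Equalizer
end PullbackCoalg

/-! ### Pullbacks of coalgebras as cotensor products -/

section PullbackCoalg

variable {k : Type u} [Field k] {P D E C : Coalg k} {p : P ⟶ D} {q : P ⟶ E} {a : D ⟶ C} {b : E ⟶ C}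

lemma lin_prodLift (p : P ⟶ D) (q : P ⟶ E) : Coalg.lin (prodLift p q) = pair p q := rfl

lemma pair_mem_eqSub (h : IsPullback p q a b) (x : P.obj) :
    pair p q x ∈ eqSub (prodFst D E ≫ a) (prodSnd D E ≫ b) :=
  range_le_eqSub (h := prodLift p q)
    (by rw [← Category.assoc, ← Category.assoc, prodLift_fst, prodLift_snd, h.w]) x

lemma eqIncl_w (a : D ⟶ C) (b : E ⟶ C) :
    (eqIncl (prodFst D E ≫ a) (prodSnd D E ≫ b) ≫ prodFst D E) ≫ a =
      (eqIncl (prodFst D E ≫ a) (prodSnd D E ≫ b) ≫ prodSnd D E) ≫ b := by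
  rw [Category.assoc, Category.assoc, eqIncl_condition]

lemma pair_lift (h : IsPullback p q a b)
    (z : (eqObj (prodFst D E ≫ a) (prodSnd D E ≫ b)).obj) :
    pair p q (Coalg.lin (h.lift _ _ (eqIncl_w a b)) z) = Coalg.lin (eqIncl _ _) z := by
  rw [pair_lin, h.lift_fst, h.lift_snd, ← lin_prodLift, prodLift_eta]

/-- The pullback maps to the concrete equalizer inside D ⊗ E, and the universal property gives a
retraction of that map. The equalizer is a subspace, so (p ⊗ q)Δ is injective on elements. -/
lemma pair_injective (h : IsPullback p q a b) : Function.Injective (pair p q) := by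
  have w : prodLift p q ≫ prodFst D E ≫ a = prodLift p q ≫ prodSnd D E ≫ b := by
    rw [← Category.assoc, ← Category.assoc, prodLift_fst, prodLift_snd, h.w]
  have hid : eqLift (prodLift p q) w ≫ h.lift _ _ (eqIncl_w a b) = 𝟙 P := by
    have e : eqLift (prodLift p q) w ≫ eqIncl _ _ = prodLift p q := rfl
    apply h.hom_ext
    · rw [Category.assoc, h.lift_fst, reassoc_of% e, prodLift_fst, Category.id_comp]
    · rw [Category.assoc, h.lift_snd, reassoc_of% e, prodLift_snd, Category.id_comp]
  intro x y hxy
  have hx : Coalg.lin (eqLift (prodLift p q) w) x = Coalg.lin (eqLift (prodLift p q) w) y :=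
    Subtype.ext hxy
  have h1 := LinearMap.congr_fun (congrArg Coalg.lin hid) x
  have h2 := LinearMap.congr_fun (congrArg Coalg.lin hid) y
  rw [Coalg.lin_comp, LinearMap.comp_apply] at h1 h2
  rw [hx] at h1
  exact h1.symm.trans h2

lemma range_pair (h : IsPullback p q a b) :
    LinearMap.range (pair p q) = eqSub (prodFst D E ≫ a) (prodSnd D E ≫ b) := by
  apply le_antisymm
  · rintro _ ⟨x, rfl⟩
    exact pair_mem_eqSub h x
  · intro z hz
    exact ⟨_, pair_lift h ⟨z, hz⟩⟩

/-- The rearrangement `D ⊗ (C ⊗ E) ≃ (D ⊗ E) ⊗ C`. -/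
def rearrange (D C E : Type u) [AddCommGroup D] [Module k D] [AddCommGroup C] [Module k C]
    [AddCommGroup E] [Module k E] : D ⊗[k] (C ⊗[k] E) ≃ₗ[k] (D ⊗[k] E) ⊗[k] C :=
  (TensorProduct.comm k C E).lTensor D ≪≫ₗ (TensorProduct.assoc k D E C).symm

/-- In Δ(d ⊗ e), projection to D kills the second copy of e by counitality. What remains is d₁ ⊗ e ⊗
a(d₂), the right coaction on D up to reordering. -/
lemma coactOf_prodFst (a : D ⟶ C) (z : D.obj ⊗[k] E.obj) :
    coactOf (prodFst D E ≫ a) z = rearrange D.obj C.obj E.obj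
      (TensorProduct.assoc k D.obj C.obj E.obj ((coactOf a).rTensor E.obj z)) := by
  have e1 : (Coalg.lin (prodFst D E ≫ a)).lTensor (D.obj ⊗[k] E.obj) ∘ₗ
      (TensorProduct.tensorTensorTensorComm k D.obj D.obj E.obj E.obj).toLinearMap =
      (rearrange D.obj C.obj E.obj).toLinearMap ∘ₗ
      (TensorProduct.assoc k D.obj C.obj E.obj).toLinearMap ∘ₗ
      TensorProduct.map ((Coalg.lin a).lTensor D.obj) ((TensorProduct.rid k E.obj).toLinearMap ∘ₗ
        (Coalgebra.counit (R := k) (A := E.obj)).lTensor E.obj) := by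
    ext d d' e e'
    have h := prodFst_tmul D E d' e'
    simp only [TensorProduct.AlgebraTensorModule.curry_apply, LinearMap.restrictScalars_self,
      TensorProduct.curry_apply, LinearMap.comp_apply, LinearEquiv.coe_coe, Coalg.lin_comp,
      TensorProduct.tensorTensorTensorComm_tmul, LinearMap.lTensor_tmul, TensorProduct.map_tmul,
      TensorProduct.assoc_tmul, CoalgHom.coe_toLinearMap, h, TensorProduct.rid_tmul, rearrange]
    simp
  have h1 := LinearMap.congr_fun e1 (TensorProduct.map Coalgebra.comul Coalgebra.comul z)
  have e2 : TensorProduct.map ((Coalg.lin a).lTensor D.obj)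
      ((TensorProduct.rid k E.obj).toLinearMap ∘ₗ
        (Coalgebra.counit (R := k) (A := E.obj)).lTensor E.obj) ∘ₗ
      TensorProduct.map Coalgebra.comul Coalgebra.comul = (coactOf a).rTensor E.obj := by
    ext d e
    simp [coactOf]
  have h2 := LinearMap.congr_fun e2 z
  simp only [LinearMap.comp_apply, LinearEquiv.coe_coe] at h1 h2
  rw [← h2, ← h1]
  rfl

/-- Projection to E leaves d ⊗ e₁ ⊗ b(e₂). Cocommutativity of E identifies this with the reordering
of d ⊗ b(e₁) ⊗ e₂, the left coaction used in the cotensor product. -/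
lemma coactOf_prodSnd (b : E ⟶ C) (z : D.obj ⊗[k] E.obj) :
    coactOf (prodSnd D E ≫ b) z = rearrange D.obj C.obj E.obj
      ((leftCoact b).lTensor D.obj z) := by
  have e1 : (Coalg.lin (prodSnd D E ≫ b)).lTensor (D.obj ⊗[k] E.obj) ∘ₗ
      (TensorProduct.tensorTensorTensorComm k D.obj D.obj E.obj E.obj).toLinearMap =
      (TensorProduct.assoc k D.obj E.obj C.obj).symm.toLinearMap ∘ₗ
      TensorProduct.map ((TensorProduct.rid k D.obj).toLinearMap ∘ₗ
        (Coalgebra.counit (R := k) (A := D.obj)).lTensor D.obj) ((Coalg.lin b).lTensor E.obj) := by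
    ext d d' e e'
    have h := prodSnd_tmul D E d' e'
    simp only [TensorProduct.AlgebraTensorModule.curry_apply, LinearMap.restrictScalars_self,
      TensorProduct.curry_apply, LinearMap.comp_apply, LinearEquiv.coe_coe, Coalg.lin_comp,
      TensorProduct.tensorTensorTensorComm_tmul, LinearMap.lTensor_tmul, TensorProduct.map_tmul,
      CoalgHom.coe_toLinearMap, h, TensorProduct.rid_tmul]
    simp [TensorProduct.smul_tmul]
  have h1 := LinearMap.congr_fun e1 (TensorProduct.map Coalgebra.comul Coalgebra.comul z)
  have e2 : TensorProduct.map ((TensorProduct.rid k D.obj).toLinearMap ∘ₗ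
        (Coalgebra.counit (R := k) (A := D.obj)).lTensor D.obj) ((Coalg.lin b).lTensor E.obj) ∘ₗ
      TensorProduct.map Coalgebra.comul Coalgebra.comul =
      ((TensorProduct.comm k C.obj E.obj).toLinearMap ∘ₗ leftCoact b).lTensor D.obj := by
    have e3 : (TensorProduct.comm k C.obj E.obj).toLinearMap ∘ₗ
        (Coalg.lin b).rTensor E.obj = (Coalg.lin b).lTensor E.obj ∘ₗ
        (TensorProduct.comm k E.obj E.obj).toLinearMap := by
      ext; simp
    ext d e
    have h3 := LinearMap.congr_fun e3 (Coalgebra.comul e)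
    simp only [LinearMap.comp_apply, LinearEquiv.coe_coe, Coalgebra.comm_comul] at h3
    simp only [TensorProduct.AlgebraTensorModule.curry_apply, LinearMap.restrictScalars_self,
      TensorProduct.curry_apply, LinearMap.comp_apply, LinearEquiv.coe_coe, leftCoact,
      LinearMap.lTensor_tmul, TensorProduct.map_tmul, h3]
    simp
  have h2 := LinearMap.congr_fun e2 z
  simp only [LinearMap.comp_apply, LinearEquiv.coe_coe, LinearMap.lTensor_comp] at h1 h2
  rw [h2] at h1
  exact h1

/-- The image of a pullback of cocommutative coalgebras in the tensor product is the cotensor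
product. -/
lemma mem_range_pair (h : IsPullback p q a b) (z : D.obj ⊗[k] E.obj) :
    z ∈ LinearMap.range (pair p q) ↔
      TensorProduct.assoc k D.obj C.obj E.obj ((coactOf a).rTensor E.obj z) =
        (leftCoact b).lTensor D.obj z := by
  rw [range_pair h, eqSub_eq]
  refine Iff.trans (b := coactOf (prodFst D E ≫ a) z = coactOf (prodSnd D E ≫ b) z) Iff.rfl ?_
  rw [coactOf_prodFst, coactOf_prodSnd, EmbeddingLike.apply_eq_iff_eq]

end PullbackCoalg

/-! ### Fibre products over C and the oplax structure of U^C on vector spaces -/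

section ToComod

open CartesianMonoidalCategory Comod

variable {k : Type u} [Field k] {C : Coalg k}

lemma leftCoact_eq {D : Coalg k} (a : D ⟶ C) :
    (ofCoalgHom (Coalg.toHom a)).lcoact = leftCoact a := by
  have e : (TensorProduct.comm k D.obj C.obj).toLinearMap ∘ₗ (Coalg.lin a).lTensor D.obj =
      (Coalg.lin a).rTensor D.obj ∘ₗ (TensorProduct.comm k D.obj D.obj).toLinearMap := by
    ext; simp
  apply LinearMap.ext
  intro x
  have h := LinearMap.congr_fun e (Coalgebra.comul x)
  simp only [LinearMap.comp_apply, LinearEquiv.coe_coe, Coalgebra.comm_comul] at h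
  exact h

lemma comm_pair {P D E : Coalg k} (p : P ⟶ D) (q : P ⟶ E) (x : P.obj) :
    TensorProduct.comm k D.obj E.obj (pair p q x) = pair q p x := by
  have e : (TensorProduct.comm k D.obj E.obj).toLinearMap ∘ₗ
      TensorProduct.map (Coalg.lin p) (Coalg.lin q) =
      TensorProduct.map (Coalg.lin q) (Coalg.lin p) ∘ₗ
        (TensorProduct.comm k P.obj P.obj).toLinearMap := by
    ext; simp
  have h := LinearMap.congr_fun e (Coalgebra.comul x)
  simp only [LinearMap.comp_apply, LinearEquiv.coe_coe, Coalgebra.comm_comul] at h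
  exact h

lemma isPullback_tensor (X Y : Over C) :
    IsPullback (fst X Y).left (snd X Y).left X.hom Y.hom :=
  IsPullback.of_hasPullback X.hom Y.hom

/-- The map `X ⊗ Y → X □ Y` for coalgebras over `C`. -/
def toComodδLin (X Y : Over C) : (X ⊗ Y).left.obj →ₗ[k] X.left.obj ⊗[k] Y.left.obj :=
  pair (fst X Y).left (snd X Y).left

lemma pair_whisker {P D E : Coalg k} (p : P ⟶ D) (q : P ⟶ E) {M : Type u} [AddCommGroup M]
    [Module k M] (s : D.obj →ₗ[k] M) (x : P.obj) :
    s.rTensor E.obj (pair p q x) =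
      TensorProduct.map (s ∘ₗ Coalg.lin p) (Coalg.lin q) (Coalgebra.comul x) := by
  rw [pair_apply, ← LinearMap.comp_apply, LinearMap.rTensor_comp_map]

lemma whisker_pair {P D E : Coalg k} (p : P ⟶ D) (q : P ⟶ E) {M : Type u} [AddCommGroup M]
    [Module k M] (s : E.obj →ₗ[k] M) (x : P.obj) :
    s.lTensor D.obj (pair p q x) =
      TensorProduct.map (Coalg.lin p) (s ∘ₗ Coalg.lin q) (Coalgebra.comul x) := by
  rw [pair_apply, ← LinearMap.comp_apply, LinearMap.lTensor_comp_map]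

lemma pair_comp_lin {Q P D E : Coalg k} (g : Q ⟶ P) (p : P ⟶ D) (q : P ⟶ E) :
    pair p q ∘ₗ Coalg.lin g = pair (g ≫ p) (g ≫ q) :=
  LinearMap.ext (pair_lin g p q)

lemma counit_comp_lin {P D : Coalg k} (p : P ⟶ D) :
    Coalgebra.counit (R := k) ∘ₗ Coalg.lin p = Coalgebra.counit :=
  LinearMap.ext (Coalg.counit_lin p)

/-- The structure maps are (p ⊗ q)Δ for the two projections of X ×_C Y, and ε on the terminal object
C. Composing such a pairing with a coalgebra map pairs the composites, so naturality reduces to the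
universal property, associativity to coassociativity, and unitality to the counit laws. -/
instance : (toComod C ⋙ forgetVec).OplaxMonoidal where
  η := ModuleCat.ofHom (Coalgebra.counit (R := k) (A := C.obj))
  δ X Y := ModuleCat.ofHom (toComodδLin X Y)
  δ_natural_left {X Y} g Z := by
    apply ModuleCat.hom_ext
    apply LinearMap.ext
    intro x
    have h := pair_lin (g ▷ Z).left (fst Y Z).left (snd Y Z).left x
    rw [← Over.comp_left, ← Over.comp_left, whiskerRight_fst, whiskerRight_snd] at h
    refine Eq.trans ?_ h.symm
    exact (pair_whisker _ _ _ x)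
  δ_natural_right {X Y} Z g := by
    apply ModuleCat.hom_ext
    apply LinearMap.ext
    intro x
    have h := pair_lin (Z ◁ g).left (fst Z Y).left (snd Z Y).left x
    rw [← Over.comp_left, ← Over.comp_left, whiskerLeft_fst, whiskerLeft_snd] at h
    refine Eq.trans ?_ h.symm
    exact (whisker_pair _ _ _ x)
  oplax_associativity X Y Z := by
    apply ModuleCat.hom_ext
    apply LinearMap.ext
    intro x
    have h1 := pair_whisker (fst (X ⊗ Y) Z).left (snd (X ⊗ Y) Z).left (toComodδLin X Y) x
    have h2 := whisker_pair ((α_ X Y Z).hom ≫ fst X (Y ⊗ Z)).left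
      ((α_ X Y Z).hom ≫ snd X (Y ⊗ Z)).left (toComodδLin Y Z) x
    rw [toComodδLin, pair_comp_lin] at h1 h2
    simp only [← Over.comp_left] at h1
    simp only [← Over.comp_left, Category.assoc, associator_hom_snd_fst,
      associator_hom_snd_snd] at h2
    have h3 := pair_assoc (fst (X ⊗ Y) Z ≫ fst X Y).left (fst (X ⊗ Y) Z ≫ snd X Y).left
      (snd (X ⊗ Y) Z).left x
    rw [← h1, ← associator_hom_fst] at h3
    refine h3.trans (h2.symm.trans ?_)
    exact congrArg ((toComodδLin Y Z).lTensor X.left.obj)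
      (pair_lin (α_ X Y Z).hom.left (fst X (Y ⊗ Z)).left (snd X (Y ⊗ Z)).left x).symm
  oplax_left_unitality X := by
    apply ModuleCat.hom_ext
    apply LinearMap.ext
    intro x
    have h := pair_whisker ((λ_ X).inv ≫ fst (𝟙_ (Over C)) X).left
      ((λ_ X).inv ≫ snd (𝟙_ (Over C)) X).left (Coalgebra.counit (R := k)) x
    rw [counit_comp_lin, leftUnitor_inv_snd] at h
    refine Eq.trans ?_ (h.symm.trans (congrArg
      ((Coalgebra.counit (R := k) (A := C.obj)).rTensor X.left.obj) ((congrArg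
        (fun t => pair ((λ_ X).inv ≫ fst (𝟙_ (Over C)) X).left t x) (congrArg CommaMorphism.left
          (leftUnitor_inv_snd X).symm)).trans
      (pair_lin (λ_ X).inv.left (fst (𝟙_ (Over C)) X).left (snd (𝟙_ (Over C)) X).left x).symm)))
    exact (Coalgebra.rTensor_counit_comul (R := k) (A := X.left.obj) x).symm
  oplax_right_unitality X := by
    apply ModuleCat.hom_ext
    apply LinearMap.ext
    intro x
    have h := whisker_pair ((ρ_ X).inv ≫ fst X (𝟙_ (Over C))).left
      ((ρ_ X).inv ≫ snd X (𝟙_ (Over C))).left (Coalgebra.counit (R := k)) x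
    rw [counit_comp_lin, rightUnitor_inv_fst] at h
    refine Eq.trans ?_ (h.symm.trans (congrArg
      ((Coalgebra.counit (R := k) (A := C.obj)).lTensor X.left.obj) ((congrArg
        (fun t => pair t ((ρ_ X).inv ≫ snd X (𝟙_ (Over C))).left x) (congrArg CommaMorphism.left
          (rightUnitor_inv_fst X).symm)).trans
      (pair_lin (ρ_ X).inv.left (fst X (𝟙_ (Over C))).left (snd X (𝟙_ (Over C))).left x).symm)))
    exact (Coalgebra.lTensor_counit_comul (R := k) (A := X.left.obj) x).symm

end ToComod

/-! ### U^C is strong symmetric monoidal -/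

section ToComodMonoidal

open CartesianMonoidalCategory Comod

variable {k : Type u} [Field k] {C : Coalg k}

/-- Both sides are p(x₁) ⊗ q(x₂) ⊗ b(q(x₃)). This is what makes (p ⊗ q)Δ colinear. -/
lemma lTensor_coact_pair {P D E C : Coalg k} (p : P ⟶ D) (q : P ⟶ E) (b : E ⟶ C) (x : P.obj) :
    (TensorProduct.assoc k D.obj E.obj C.obj).symm ((coactOf b).lTensor D.obj (pair p q x)) =
      (pair p q).rTensor C.obj (coactOf (q ≫ b) x) := by
  have e : (pair p q).rTensor C.obj ∘ₗ (Coalg.lin (q ≫ b)).lTensor P.obj =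
      TensorProduct.map (pair p q) (Coalg.lin (q ≫ b)) := by
    ext; simp
  have h := LinearMap.congr_fun e (Coalgebra.comul x)
  rw [LinearEquiv.symm_apply_eq]
  refine Eq.trans ?_ (congrArg (TensorProduct.assoc k D.obj E.obj C.obj) h.symm)
  rw [pair_assoc, whisker_pair]
  have e2 : coactOf b ∘ₗ Coalg.lin q = pair q (q ≫ b) := by
    apply LinearMap.ext
    intro y
    have e3 : (Coalg.lin b).lTensor E.obj ∘ₗ TensorProduct.map (Coalg.lin q) (Coalg.lin q) =
        TensorProduct.map (Coalg.lin q) (Coalg.lin (q ≫ b)) := by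
      ext; simp [Coalg.lin_comp]
    have h3 := LinearMap.congr_fun e3 (Coalgebra.comul y)
    rw [LinearMap.comp_apply, Coalg.map_lin_comul] at h3
    exact h3
  rw [e2]

lemma pair_mem_cotensor {P D E C : Coalg k} {p : P ⟶ D} {q : P ⟶ E} {a : D ⟶ C} {b : E ⟶ C}
    (h : IsPullback p q a b) :
    (TensorProduct.assoc k D.obj C.obj E.obj).toLinearMap ∘ₗ
      (coactOf a).rTensor E.obj ∘ₗ pair p q = (leftCoact b).lTensor D.obj ∘ₗ pair p q :=
  LinearMap.ext fun x => (mem_range_pair h _).mp ⟨x, rfl⟩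

lemma pair_mem_cten (X Y : Over C) :
    (TensorProduct.assoc k X.left.obj C.obj Y.left.obj).toLinearMap ∘ₗ
      ((toComod C).obj X).coact.rTensor Y.left.obj ∘ₗ toComodδLin X Y =
    ((toComod C).obj Y).lcoact.lTensor X.left.obj ∘ₗ toComodδLin X Y :=
  (pair_mem_cotensor (isPullback_tensor X Y)).trans
    (congrArg (fun t => t.lTensor X.left.obj ∘ₗ toComodδLin X Y) (leftCoact_eq Y.hom).symm)

/-- The comparison of the fibre product of coalgebras with the cotensor product. -/
def toComodδ (X Y : Over C) : (toComod C).obj (X ⊗ Y) ⟶ (toComod C).obj X ⊗ (toComod C).obj Y :=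
  ofLin (W := cten ((toComod C).obj X) ((toComod C).obj Y))
    (cotensorLift _ _ (isBicomod_lcoact _) (toComodδLin X Y) (pair_mem_cten X Y))
    (cotensor_colinear _ _ (isBicomod_lcoact _) (Z := (toComod C).obj (X ⊗ Y)) _ (by
      apply LinearMap.ext
      intro x
      refine (lTensor_coact_pair (fst X Y).left (snd X Y).left Y.hom x).trans ?_
      rw [Over.w]
      rfl))

/-- The fibre product over C is a pullback, so `pair_injective` and `mem_range_pair` give
bijectivity onto the cotensor product. -/
instance (X Y : Over C) : IsIso (toComodδ X Y) := by
  apply isIso_of_bijective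
  constructor
  · intro x y hxy
    exact pair_injective (isPullback_tensor X Y)
      (congrArg (incl ((toComod C).obj X) ((toComod C).obj Y)) hxy)
  · intro z
    obtain ⟨x, hx⟩ := (mem_range_pair (isPullback_tensor X Y)
      (incl ((toComod C).obj X) ((toComod C).obj Y) z)).mpr
        ((incl_eq ((toComod C).obj X) ((toComod C).obj Y) z).trans
          (congrArg (fun t => t.lTensor X.left.obj
            (incl ((toComod C).obj X) ((toComod C).obj Y) z)) (leftCoact_eq Y.hom)))
    exact ⟨x, incl_injective _ _ hx⟩

/-- The terminal coalgebra over `C`, as a comodule, is the regular comodule. -/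
def toComodη : (toComod C).obj (𝟙_ (Over C)) ⟶ 𝟙_ (Comod k C.obj) :=
  ofLin (V := (toComod C).obj (𝟙_ (Over C))) (W := regular k C.obj) LinearMap.id (by
    apply LinearMap.ext
    intro x
    have e : (LinearMap.id (R := k) (M := C.obj)).rTensor C.obj ∘ₗ
        (LinearMap.id (R := k) (M := C.obj)).lTensor C.obj = LinearMap.id := by
      ext; simp
    exact (LinearMap.congr_fun e (Coalgebra.comul (R := k) (A := C.obj) x)).symm)

instance : IsIso (toComodη (C := C)) :=
  isIso_of_bijective _ Function.bijective_id

/-- The oplax monoidal structure of `toComod C` given by `toComodδ`. -/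
@[reducible] def toComodOplax : (toComod C).OplaxMonoidal :=
  oplaxOfForget (toComod C) toComodη toComodδ rfl (fun _ _ => rfl)

/-- An oplax structure whose structure maps are invertible is strong. -/
instance : (toComod C).Monoidal :=
  letI := toComodOplax (C := C)
  haveI : IsIso (Functor.OplaxMonoidal.η (toComod C)) := inferInstanceAs (IsIso toComodη)
  haveI (X Y : Over C) : IsIso (Functor.OplaxMonoidal.δ (toComod C) X Y) :=
    inferInstanceAs (IsIso (toComodδ X Y))
  Functor.Monoidal.ofOplaxMonoidal (toComod C)

lemma toComod_braid (X Y : Over C) : (toComod C).map (β_ X Y).hom ≫ toComodδ Y X =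
    toComodδ X Y ≫ (β_ ((toComod C).obj X) ((toComod C).obj Y)).hom := by
  apply hom_ext_δι
  apply ModuleCat.hom_ext
  apply LinearMap.ext
  intro x
  have h := pair_lin (β_ X Y).hom.left (fst Y X).left (snd Y X).left x
  rw [← Over.comp_left, ← Over.comp_left, braiding_hom_fst, braiding_hom_snd] at h
  exact h.trans (comm_pair _ _ x).symm

instance : (toComod C).Braided where
  braided X Y := by
    rw [← cancel_epi (Functor.OplaxMonoidal.δ (toComod C) X Y), Functor.Monoidal.δ_μ_assoc]
    rw [← cancel_mono (Functor.OplaxMonoidal.δ (toComod C) Y X)]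
    simp only [Category.assoc, Functor.Monoidal.μ_δ, Category.comp_id]
    exact toComod_braid X Y

end ToComodMonoidal

/-! ### The isomorphism α and its compatibility with counits -/

section Comparison

open Comod

variable {k : Type u} [Field k] {C C' : Coalg k} (f : C' ⟶ C)

/-- The comparison of the pullback of coalgebras with the pullback of comodules. -/
def pullbackComparison (X : Over C) :
    (toComod C').obj ((Over.pullback f).obj X) ⟶ (comodPullback f).obj ((toComod C).obj X) :=
  ofLin (V := (toComod C').obj ((Over.pullback f).obj X))
    (W := cotensorComod ((toComod C).obj X) (regular k C'.obj) (isBicomod_leftCoact f))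
    (cotensorLift _ _ (isBicomod_leftCoact f) (pair (pullback.fst X.hom f) (pullback.snd X.hom f))
      (pair_mem_cotensor (IsPullback.of_hasPullback X.hom f)))
    (cotensor_colinear _ _ (isBicomod_leftCoact f)
      (Z := (toComod C').obj ((Over.pullback f).obj X)) _ (by
      apply LinearMap.ext
      intro x
      have h := lTensor_coact_pair (pullback.fst X.hom f) (pullback.snd X.hom f) (𝟙 C') x
      rw [Category.comp_id] at h
      refine Eq.trans ?_ h
      have e : coactOf (𝟙 C') = Coalgebra.comul (R := k) (A := C'.obj) := by
        refine Eq.trans ?_ (LinearMap.id_comp _)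
        exact congrArg (· ∘ₗ _) (LinearMap.lTensor_id _ _)
      rw [e]
      rfl))

instance (X : Over C) : IsIso (pullbackComparison f X) := by
  apply isIso_of_bijective
  constructor
  · intro x y hxy
    exact pair_injective (IsPullback.of_hasPullback X.hom f)
      (congrArg (pullbackIncl f ((toComod C).obj X)) hxy)
  · intro z
    obtain ⟨x, hx⟩ := (mem_range_pair (IsPullback.of_hasPullback X.hom f)
      (pullbackIncl f ((toComod C).obj X) z)).mpr (pullbackIncl_eq f ((toComod C).obj X) z)
    exact ⟨x, pullbackIncl_injective f _ hx⟩

/-- The isomorphism of the pullback of coalgebras with the pullback of comodules. -/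
def pullbackComparisonIso : toComod C ⋙ comodPullback f ≅ Over.pullback f ⋙ toComod C' :=
  (NatIso.ofComponents (fun X => asIso (pullbackComparison f X)) (fun {X Y} g => by
    apply hom_ext
    apply LinearMap.ext
    intro x
    apply pullbackIncl_injective f
    have h := pair_lin ((Over.pullback f).map g).left (pullback.fst Y.hom f)
      (pullback.snd Y.hom f) x
    have h1 : ((Over.pullback f).map g).left ≫ pullback.fst Y.hom f =
        pullback.fst X.hom f ≫ g.left := pullback.lift_fst _ _ _
    have h2 : ((Over.pullback f).map g).left ≫ pullback.snd Y.hom f =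
        pullback.snd X.hom f ≫ 𝟙 _ :=
      (pullback.lift_snd _ _ _).trans (Category.comp_id _).symm
    rw [h1, h2] at h
    exact h.trans (pair_comp _ _ _ _ x))).symm

/-- Corestriction of comodules corresponds to composition of coalgebra maps. -/
def mapComparisonIso : toComod C' ⋙ corestrict f ≅ Over.map f ⋙ toComod C :=
  NatIso.ofComponents (fun X => isoMk
    (ofLin (V := corestrictObj f ((toComod C').obj X)) (W := (toComod C).obj ((Over.map f).obj X))
      LinearMap.id (by
        have e : coactOf (X.hom ≫ f) = (Coalg.lin f).lTensor X.left.obj ∘ₗ coactOf X.hom := by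
          rw [coactOf, Coalg.lin_comp, LinearMap.lTensor_comp, LinearMap.comp_assoc]
          rfl
        refine (LinearMap.comp_id _).trans (e.trans ?_)
        exact (LinearMap.id_comp _).symm.trans (congrArg (· ∘ₗ
          (corestrictObj f ((toComod C').obj X)).coact) (LinearMap.rTensor_id _ _).symm))) LinearMap.id rfl rfl) (fun _ => rfl)

/-- Both sides are the projection of the pullback to D: on the left as (id ⊗ ε)(p ⊗ q)Δ = p, on the
right as the counit of Σ_f ⊣ L_f. -/
lemma comparison_compat (X : Over C) :
    (corestrict f).map ((pullbackComparisonIso f).inv.app X) ≫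
        (corestrictAdj f).counit.app ((toComod C).obj X) =
      (mapComparisonIso f).hom.app ((Over.pullback f).obj X) ≫
        (toComod C).map ((Over.mapPullbackAdj f).counit.app X) := by
  apply hom_ext
  apply LinearMap.ext
  intro x
  rw [Over.mapPullbackAdj_counit_app]
  exact LinearMap.congr_fun (congrArg Coalg.lin
    (prodLift_fst (pullback.fst X.hom f) (pullback.snd X.hom f))) x

end Comparison

/-! ### Separating families and tensor products -/

section Separating

variable {k : Type u} [Field k]

/-- If the maps `f x` separate the points of `M`, then the maps `f x ⊗ N` separate the points
of `M ⊗ N`. -/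
lemma eq_zero_of_forall_rTensor {X : Type*} {M W N : Type*} [AddCommGroup M] [Module k M]
    [AddCommGroup W] [Module k W] [AddCommGroup N] [Module k N] (f : X → M →ₗ[k] W)
    (hf : ∀ m, (∀ x, f x m = 0) → m = 0) (z : M ⊗[k] N)
    (hz : ∀ x, (f x).rTensor N z = 0) : z = 0 := by
  classical
  -- A basis of N identifies M ⊗ N with finitely supported families in M, and f x ⊗ N acts on each
  -- coordinate by f x.
  let b := Module.Basis.ofVectorSpace k N
  have key (x : X) (i) (z : M ⊗[k] N) : f x (TensorProduct.equivFinsuppOfBasisRight b z i) =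
      TensorProduct.equivFinsuppOfBasisRight b ((f x).rTensor N z) i := by
    induction z using TensorProduct.induction_on with
    | zero => simp
    | tmul m n => simp
    | add p q hp hq => simp only [map_add, Finsupp.add_apply, hp, hq]
  apply (TensorProduct.equivFinsuppOfBasisRight b).injective
  rw [map_zero]
  ext i
  refine hf _ fun x => ?_
  rw [key, hz, map_zero]
  rfl

lemma injective_of_forall {M N : Type*} [AddCommGroup M] [Module k M] [AddCommMonoid N]
    [Module k N] (f : M →ₗ[k] N) (h : ∀ z, f z = 0 → z = 0) : Function.Injective f := by
  intro x y hxy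
  refine sub_eq_zero.mp (h _ ?_)
  rw [sub_eq_add_neg, map_add, hxy, ← map_add, add_neg_cancel, map_zero]

end Separating

/-! ### Coalgebras spanned by images of coalgebras -/

section Generated

variable {k : Type u} [Field k] {P : Type u} [AddCommGroup P] [Module k P] {I : Type*}
  {E : I → Type u} [∀ i, AddCommGroup (E i)] [∀ i, Module k (E i)]
  (θ : ∀ i, E i →ₗ[k] P)

/-- The span of the images of a family of linear maps. -/
def genSub : Submodule k P := ⨆ i, LinearMap.range (θ i)

/-- The maps into the span of the images. -/
def genMap (i : I) : E i →ₗ[k] genSub θ :=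
  (θ i).codRestrict _ fun x => le_iSup (fun i => LinearMap.range (θ i)) i ⟨x, rfl⟩

lemma genSub_induction {p : genSub θ → Prop} (hg : ∀ i x, p (genMap θ i x)) (h0 : p 0)
    (ha : ∀ x y, p x → p y → p (x + y)) (x : genSub θ) : p x := by
  refine Submodule.iSup_induction' (fun i => LinearMap.range (θ i))
    (motive := fun x hx => p ⟨x, hx⟩) ?_ h0 (fun x y hx hy => ha _ _) x.2
  rintro i _ ⟨x, rfl⟩
  exact hg i x

variable {θ} in
lemma genSub_hom_ext {Q : Type*} [AddCommMonoid Q] [Module k Q] {f g : genSub θ →ₗ[k] Q}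
    (h : ∀ i, f ∘ₗ genMap θ i = g ∘ₗ genMap θ i) : f = g := by
  apply LinearMap.ext
  intro x
  refine genSub_induction θ (p := fun x => f x = g x) (fun i x => LinearMap.congr_fun (h i) x)
    (by simp) (fun x y hx hy => by rw [map_add, map_add, hx, hy]) x

/-- A map out of the span that lands in the image of an injective map on generators. -/
lemma genSub_mem_range {Q R : Type*} [AddCommMonoid Q] [Module k Q] [AddCommMonoid R]
    [Module k R]
    (M : genSub θ →ₗ[k] Q) (j : R →ₗ[k] Q) (h : ∀ i x, ∃ r, j r = M (genMap θ i x))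
    (x : genSub θ) : M x ∈ LinearMap.range j := by
  refine genSub_induction θ (p := fun x => M x ∈ LinearMap.range j) h (by simp)
    (fun x y hx hy => by rw [map_add]; exact add_mem hx hy) x

variable [∀ i, Coalgebra k (E i)]

variable {θ} in
/-- A coalgebra structure on a space spanned by images of coalgebras. -/
@[reducible] def genCoalgebra (Δ : genSub θ →ₗ[k] genSub θ ⊗[k] genSub θ) (ε : genSub θ →ₗ[k] k)
    (hΔ : ∀ i, Δ ∘ₗ genMap θ i = TensorProduct.map (genMap θ i) (genMap θ i) ∘ₗ Coalgebra.comul)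
    (hε : ∀ i, ε ∘ₗ genMap θ i = Coalgebra.counit) : Coalgebra k (genSub θ) where
  comul := Δ
  counit := ε
  coassoc := by
    apply genSub_hom_ext
    intro i
    have h1 : Δ.rTensor (genSub θ) ∘ₗ TensorProduct.map (genMap θ i) (genMap θ i) =
        TensorProduct.map (TensorProduct.map (genMap θ i) (genMap θ i)) (genMap θ i) ∘ₗ
          (Coalgebra.comul (R := k) (A := E i)).rTensor (E i) := by
      rw [LinearMap.rTensor_comp_map, LinearMap.map_comp_rTensor, hΔ]
    have h2 : Δ.lTensor (genSub θ) ∘ₗ TensorProduct.map (genMap θ i) (genMap θ i) =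
        TensorProduct.map (genMap θ i) (TensorProduct.map (genMap θ i) (genMap θ i)) ∘ₗ
          (Coalgebra.comul (R := k) (A := E i)).lTensor (E i) := by
      rw [LinearMap.lTensor_comp_map, LinearMap.map_comp_lTensor, hΔ]
    have h3 : (TensorProduct.assoc k (genSub θ) (genSub θ) (genSub θ)).toLinearMap ∘ₗ
        TensorProduct.map (TensorProduct.map (genMap θ i) (genMap θ i)) (genMap θ i) =
        TensorProduct.map (genMap θ i) (TensorProduct.map (genMap θ i) (genMap θ i)) ∘ₗ
          (TensorProduct.assoc k (E i) (E i) (E i)).toLinearMap := by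
      apply TensorProduct.ext_threefold
      intros
      rfl
    apply LinearMap.ext
    intro x
    have e := LinearMap.congr_fun (hΔ i) x
    have e1 := LinearMap.congr_fun h1 (Coalgebra.comul x)
    have e2 := LinearMap.congr_fun h2 (Coalgebra.comul x)
    have e3 := LinearMap.congr_fun h3 (Coalgebra.comul.rTensor (E i) (Coalgebra.comul x))
    simp only [LinearMap.comp_apply, LinearEquiv.coe_coe] at e e1 e2 e3 ⊢
    rw [e, e1, e2, e3, Coalgebra.coassoc_apply]
  rTensor_counit_comp_comul := by
    apply genSub_hom_ext
    intro i
    have h1 : ε.rTensor (genSub θ) ∘ₗ TensorProduct.map (genMap θ i) (genMap θ i) =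
        (genMap θ i).lTensor k ∘ₗ (Coalgebra.counit (R := k) (A := E i)).rTensor (E i) := by
      rw [LinearMap.rTensor_comp_map, hε, LinearMap.lTensor_comp_rTensor]
    rw [LinearMap.comp_assoc, hΔ, ← LinearMap.comp_assoc, h1, LinearMap.comp_assoc,
      Coalgebra.rTensor_counit_comp_comul]
    rfl
  lTensor_counit_comp_comul := by
    apply genSub_hom_ext
    intro i
    have h1 : ε.lTensor (genSub θ) ∘ₗ TensorProduct.map (genMap θ i) (genMap θ i) =
        (genMap θ i).rTensor k ∘ₗ (Coalgebra.counit (R := k) (A := E i)).lTensor (E i) := by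
      rw [LinearMap.lTensor_comp_map, hε, LinearMap.rTensor_comp_lTensor]
    rw [LinearMap.comp_assoc, hΔ, ← LinearMap.comp_assoc, h1, LinearMap.comp_assoc,
      Coalgebra.lTensor_counit_comp_comul]
    apply LinearMap.ext
    intro x
    rfl

end Generated

/-! ### Convolution products along words of functionals -/

section Words

variable {k : Type u} [Field k] {E E' W : Type u} [AddCommGroup E] [Module k E] [Coalgebra k E]
  [AddCommGroup E'] [Module k E'] [Coalgebra k E'] [AddCommGroup W] [Module k W]

/-- The convolution product of two functionals on a coalgebra. -/
def conv (a b : Module.Dual k E) : Module.Dual k E :=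
  LinearMap.mul' k k ∘ₗ TensorProduct.map a b ∘ₗ Coalgebra.comul

lemma conv_assoc (a b c : Module.Dual k E) : conv (conv a b) c = conv a (conv b c) := by
  have e : LinearMap.mul' k k ∘ₗ TensorProduct.map (conv a b) c =
      LinearMap.mul' k k ∘ₗ TensorProduct.map a (LinearMap.mul' k k ∘ₗ TensorProduct.map b c) ∘ₗ
        (TensorProduct.assoc k E E E).toLinearMap ∘ₗ
        (Coalgebra.comul (R := k) (A := E)).rTensor E := by
    ext x y
    obtain ⟨s, hs⟩ := TensorProduct.exists_finset (Coalgebra.comul (R := k) x)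
    simp [conv, hs, TensorProduct.sum_tmul, mul_assoc]
  have e' : LinearMap.mul' k k ∘ₗ TensorProduct.map a (conv b c) =
      LinearMap.mul' k k ∘ₗ TensorProduct.map a (LinearMap.mul' k k ∘ₗ TensorProduct.map b c) ∘ₗ
        (Coalgebra.comul (R := k) (A := E)).lTensor E := by
    ext x y
    simp [conv]
  apply LinearMap.ext
  intro x
  have h := LinearMap.congr_fun e (Coalgebra.comul x)
  have h' := LinearMap.congr_fun e' (Coalgebra.comul x)
  simp only [LinearMap.comp_apply, LinearEquiv.coe_coe, Coalgebra.coassoc_apply] at h h'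
  exact h.trans h'.symm

lemma counit_conv (a : Module.Dual k E) : conv Coalgebra.counit a = a := by
  have e : LinearMap.mul' k k ∘ₗ TensorProduct.map (Coalgebra.counit (R := k) (A := E)) a =
      LinearMap.mul' k k ∘ₗ a.lTensor k ∘ₗ (Coalgebra.counit (R := k) (A := E)).rTensor E := by
    ext; simp
  apply LinearMap.ext
  intro x
  have h := LinearMap.congr_fun e (Coalgebra.comul x)
  simp only [LinearMap.comp_apply, Coalgebra.rTensor_counit_comul] at h
  exact h.trans (by simp)

lemma conv_counit (a : Module.Dual k E) : conv a Coalgebra.counit = a := by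
  have e : LinearMap.mul' k k ∘ₗ TensorProduct.map a (Coalgebra.counit (R := k) (A := E)) =
      LinearMap.mul' k k ∘ₗ a.rTensor k ∘ₗ (Coalgebra.counit (R := k) (A := E)).lTensor E := by
    ext; simp
  apply LinearMap.ext
  intro x
  have h := LinearMap.congr_fun e (Coalgebra.comul x)
  simp only [LinearMap.comp_apply, Coalgebra.lTensor_counit_comul] at h
  exact h.trans (by simp)

lemma conv_comp (a b : Module.Dual k E') (g : E →ₗc[k] E') :
    conv a b ∘ₗ (g : E →ₗ[k] E') = conv (a ∘ₗ (g : E →ₗ[k] E')) (b ∘ₗ (g : E →ₗ[k] E')) := by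
  apply LinearMap.ext
  intro x
  have h := CoalgHomClass.map_comp_comul_apply g x
  simp only [conv, LinearMap.comp_apply, TensorProduct.map_comp]
  exact congrArg (fun t => LinearMap.mul' k k (TensorProduct.map a b t)) h.symm

/-- The convolution product of the pullbacks along `G` of a list of functionals. -/
def word (G : E →ₗ[k] W) : List (Module.Dual k W) → Module.Dual k E
  | [] => Coalgebra.counit
  | a :: l => conv (a ∘ₗ G) (word G l)

/-- Convolution is associative with unit ε, so words act as monomials in the dual algebra of E. This
identity makes concatenation dual to Δ. -/
lemma word_append (G : E →ₗ[k] W) (l l' : List (Module.Dual k W)) :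
    word G (l ++ l') = conv (word G l) (word G l') := by
  induction l with
  | nil => exact (counit_conv _).symm
  | cons a l ih => rw [List.cons_append, word, word, ih, conv_assoc]

lemma word_singleton (G : E →ₗ[k] W) (a : Module.Dual k W) : word G [a] = a ∘ₗ G :=
  conv_counit _

lemma word_comp (G : E' →ₗ[k] W) (g : E →ₗc[k] E') (l : List (Module.Dual k W)) :
    word G l ∘ₗ (g : E →ₗ[k] E') = word (G ∘ₗ (g : E →ₗ[k] E')) l := by
  induction l with
  | nil => exact CoalgHomClass.counit_comp g
  | cons a l ih => rw [word, word, conv_comp, ih]; rfl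

/-- The map to functions on lists of functionals given by the convolution products. -/
def wordMap (G : E →ₗ[k] W) : E →ₗ[k] (List (Module.Dual k W) → k) :=
  LinearMap.pi (word G)

lemma wordMap_comp (G : E' →ₗ[k] W) (g : E →ₗc[k] E') :
    wordMap G ∘ₗ (g : E →ₗ[k] E') = wordMap (G ∘ₗ (g : E →ₗ[k] E')) := by
  apply LinearMap.ext
  intro x
  funext l
  exact LinearMap.congr_fun (word_comp G g l) x

end Words

/-! ### The coalgebra of functions on words -/

section WordCoalgebra

variable {k : Type u} [Field k] {W : Type u} [AddCommGroup W] [Module k W] {I : Type*}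
  {E : I → Type u} [∀ i, AddCommGroup (E i)] [∀ i, Module k (E i)] [∀ i, Coalgebra k (E i)]
  (G : ∀ i, E i →ₗ[k] W)

/-- The span of the images of the maps to functions on lists. -/
abbrev WordSpan := genSub fun i => wordMap (G i)

/-- The maps into the span of the images. -/
abbrev wordGen (i : I) : E i →ₗ[k] WordSpan G := genMap (fun i => wordMap (G i)) i

/-- Evaluation at a list. -/
def wordEval (l : List (Module.Dual k W)) : WordSpan G →ₗ[k] k :=
  LinearMap.proj l ∘ₗ (WordSpan G).subtype

/-- The inclusion of `T ⊗ T` in the functions on pairs of lists. -/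
def wordPair : WordSpan G ⊗[k] WordSpan G →ₗ[k]
    (List (Module.Dual k W) → List (Module.Dual k W) → k) :=
  LinearMap.pi fun l => LinearMap.pi fun l' =>
    LinearMap.mul' k k ∘ₗ TensorProduct.map (wordEval G l) (wordEval G l')

/-- Evaluations at words separate the points of the span T; used on one tensor leg and then on the
other, they separate the points of T ⊗ T. -/
lemma wordPair_injective : Function.Injective (wordPair G) := by
  refine injective_of_forall (M := WordSpan G ⊗[k] WordSpan G) (wordPair G) fun z hz => ?_
  refine eq_zero_of_forall_rTensor (wordEval G) (fun m hm => Subtype.ext (funext hm)) z fun l => ?_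
  apply (TensorProduct.lid k (WordSpan G)).injective
  rw [map_zero]
  refine Subtype.ext (funext fun l' => ?_)
  have e : wordEval G l' ∘ₗ (TensorProduct.lid k (WordSpan G)).toLinearMap ∘ₗ
      (wordEval G l).rTensor (WordSpan G) =
      LinearMap.mul' k k ∘ₗ TensorProduct.map (wordEval G l) (wordEval G l') := by
    apply TensorProduct.ext'
    intro a b
    simp
  exact (LinearMap.congr_fun e z).trans (congrFun (congrFun hz l) l')

/-- The map to functions on pairs of lists given by concatenation. -/
def wordConcat : WordSpan G →ₗ[k] (List (Module.Dual k W) → List (Module.Dual k W) → k) :=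
  LinearMap.pi fun l => LinearMap.pi fun l' => wordEval G (l ++ l')

/-- On a generator, evaluating Δx at the pair (l, l') is evaluating x at the concatenation. Hence
concatenation lands in the image of T ⊗ T, and a comultiplication on T can be read off. -/
lemma wordConcat_gen (i : I) (x : E i) : wordPair G (TensorProduct.map (wordGen G i) (wordGen G i)
    (Coalgebra.comul x)) = wordConcat G (wordGen G i x) := by
  funext l l'
  have h := LinearMap.congr_fun (word_append (G i) l l') x
  refine Eq.trans ?_ h.symm
  have e : TensorProduct.map (wordEval G l) (wordEval G l') ∘ₗ
      TensorProduct.map (wordGen G i) (wordGen G i) =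
      TensorProduct.map (word (G i) l) (word (G i) l') := by
    rw [← TensorProduct.map_comp]
    rfl
  exact congrArg (LinearMap.mul' k k) (LinearMap.congr_fun e (Coalgebra.comul x))

/-- The comultiplication dual to the concatenation of lists. -/
def wordComul : WordSpan G →ₗ[k] WordSpan G ⊗[k] WordSpan G :=
  factorThrough (wordPair G) (wordPair_injective G) (wordConcat G)
    (genSub_mem_range (fun i => wordMap (G i)) (wordConcat G) (wordPair G)
      fun i x => ⟨_, wordConcat_gen G i x⟩)

lemma wordComul_gen (i : I) : wordComul G ∘ₗ wordGen G i =
    TensorProduct.map (wordGen G i) (wordGen G i) ∘ₗ Coalgebra.comul := by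
  apply LinearMap.ext
  intro x
  apply wordPair_injective G
  refine (factorThrough_apply _ (wordPair_injective G) _ _ _).trans (wordConcat_gen G i x).symm

instance : Coalgebra k (WordSpan G) :=
  genCoalgebra (wordComul G) (wordEval G []) (wordComul_gen G) (fun _ => rfl)

/-- The map from a coalgebra to the coalgebra spanned by the images. -/
def wordHom (i : I) : E i →ₗc[k] WordSpan G :=
  { wordGen G i with
    counit_comp := rfl
    map_comp_comul := (wordComul_gen G i).symm }

lemma wordHom_lin (i : I) : (wordHom G i : E i →ₗ[k] WordSpan G) = wordGen G i := rfl

instance [∀ i, Coalgebra.IsCocomm k (E i)] : Coalgebra.IsCocomm k (WordSpan G) where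
  comm_comp_comul := by
    refine genSub_hom_ext (θ := fun i => wordMap (G i)) fun i => ?_
    have e : (TensorProduct.comm k (WordSpan G) (WordSpan G)).toLinearMap ∘ₗ
        TensorProduct.map (wordGen G i) (wordGen G i) =
        TensorProduct.map (wordGen G i) (wordGen G i) ∘ₗ
          (TensorProduct.comm k (E i) (E i)).toLinearMap := by
      apply TensorProduct.ext'
      intros
      rfl
    apply LinearMap.ext
    intro x
    have h := LinearMap.congr_fun (wordComul_gen G i) x
    have h1 := LinearMap.congr_fun e (Coalgebra.comul x)
    simp only [LinearMap.comp_apply, LinearEquiv.coe_coe, Coalgebra.comm_comul] at h h1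
    exact (congrArg (TensorProduct.comm k (WordSpan G) (WordSpan G)) h).trans (h1.trans h.symm)

/-- The embedding of a vector space in the functions on its dual. -/
def dualEmbed (W : Type u) [AddCommGroup W] [Module k W] : W →ₗ[k] (Module.Dual k W → k) :=
  LinearMap.pi fun a => a

lemma dualEmbed_injective : Function.Injective (dualEmbed (k := k) W) := by
  refine injective_of_forall (dualEmbed W) fun w hw => ?_
  exact (Module.forall_dual_apply_eq_zero_iff k w).mp fun a => congrFun hw a

/-- The map to `W` given by evaluation at lists of length one. -/
def wordProj : WordSpan G →ₗ[k] W :=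
  factorThrough (dualEmbed W) dualEmbed_injective (LinearMap.pi fun a => wordEval G [a])
    (genSub_mem_range (fun i => wordMap (G i)) _ (dualEmbed W) fun i x => ⟨G i x, funext fun a =>
      (LinearMap.congr_fun (word_singleton (G i) a) x).symm⟩)

lemma wordProj_gen (i : I) : wordProj G ∘ₗ wordGen G i = G i := by
  apply LinearMap.ext
  intro x
  apply dualEmbed_injective (k := k)
  refine (factorThrough_apply _ dualEmbed_injective _ _ _).trans ?_
  exact funext fun a => LinearMap.congr_fun (word_singleton (G i) a) x

/-- The values of an element of T at words are already convolution products of its length-one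
values. So a coalgebra map into T is determined by its composite with the projection to W, which
gives uniqueness in the cofree property. -/
lemma wordMap_wordProj : wordMap (wordProj G) = (WordSpan G).subtype := by
  apply genSub_hom_ext
  intro i
  have h := wordMap_comp (wordProj G) (wordHom G i)
  rw [wordHom_lin, wordProj_gen] at h
  exact h

end WordCoalgebra

/-! ### The right adjoint of U^C -/

section Cofree

open Comod

variable {k : Type u} [Field k] {C : Coalg k} (V : Comod k C.obj)

/-- The two structure maps of a coalgebra over `C` with a colinear map to `V`. -/
def cofreeData (Y : CostructuredArrow (toComod C) V) :
    Y.left.left.obj →ₗ[k] V.carrier × C.obj :=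
  (toLin Y.hom).prod (Coalg.lin Y.left.hom)

/-- The coalgebra underlying the cofree cocommutative coalgebra over `C` on a comodule. -/
abbrev cofreeCoalg : Coalg k := Coalg.of (WordSpan (cofreeData V))

/-- The universal linear map from the cofree coalgebra to the comodule. -/
def cofreeFst : (cofreeCoalg V).obj →ₗ[k] V.carrier :=
  LinearMap.fst k V.carrier C.obj ∘ₗ wordProj (cofreeData V)

/-- The map from the cofree coalgebra to the base, as a linear map. -/
def cofreeSnd : (cofreeCoalg V).obj →ₗ[k] C.obj :=
  LinearMap.snd k V.carrier C.obj ∘ₗ wordProj (cofreeData V)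

lemma cofreeFst_gen (Y : CostructuredArrow (toComod C) V) :
    cofreeFst V ∘ₗ wordGen (cofreeData V) Y = toLin Y.hom :=
  congrArg (LinearMap.fst k V.carrier C.obj ∘ₗ ·) (wordProj_gen (cofreeData V) Y)

lemma cofreeSnd_gen (Y : CostructuredArrow (toComod C) V) :
    cofreeSnd V ∘ₗ wordGen (cofreeData V) Y = Coalg.lin Y.left.hom :=
  congrArg (LinearMap.snd k V.carrier C.obj ∘ₗ ·) (wordProj_gen (cofreeData V) Y)

lemma Coalg.map_lin_comp_comul {D E : Coalg k} (f : D ⟶ E) :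
    TensorProduct.map (Coalg.lin f) (Coalg.lin f) ∘ₗ Coalgebra.comul =
      Coalgebra.comul ∘ₗ Coalg.lin f :=
  LinearMap.ext (Coalg.map_lin_comul f)

lemma map_comul_gen {M N : Type u} [AddCommGroup M] [Module k M] [AddCommGroup N] [Module k N]
    (a : (cofreeCoalg V).obj →ₗ[k] M) (b : (cofreeCoalg V).obj →ₗ[k] N)
    (Y : CostructuredArrow (toComod C) V) :
    (TensorProduct.map a b ∘ₗ Coalgebra.comul) ∘ₗ wordGen (cofreeData V) Y =
      TensorProduct.map (a ∘ₗ wordGen (cofreeData V) Y) (b ∘ₗ wordGen (cofreeData V) Y) ∘ₗ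
        Coalgebra.comul := by
  rw [TensorProduct.map_comp]
  exact congrArg (TensorProduct.map a b ∘ₗ ·) (wordComul_gen (cofreeData V) Y)

/-- The map from the cofree coalgebra to the base. -/
def cofreeHom : cofreeCoalg V ⟶ C :=
  Coalg.ofHom (C := cofreeCoalg V)
    { cofreeSnd V with
      counit_comp := by
        -- The images of the coalgebras Y span, so identities need only be checked on each Y, where
        -- the map to C is the given coalgebra map.
        refine genSub_hom_ext (θ := fun i => wordMap (cofreeData V i)) fun Y => ?_
        refine (congrArg (Coalgebra.counit (R := k) (A := C.obj) ∘ₗ ·) (cofreeSnd_gen V Y)).trans ?_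
        exact counit_comp_lin Y.left.hom
      map_comp_comul := by
        refine genSub_hom_ext (θ := fun i => wordMap (cofreeData V i)) fun Y => ?_
        refine (map_comul_gen V (cofreeSnd V) (cofreeSnd V) Y).trans ?_
        rw [cofreeSnd_gen]
        refine (Coalg.map_lin_comp_comul Y.left.hom).trans ?_
        exact (congrArg (Coalgebra.comul (R := k) (A := C.obj) ∘ₗ ·) (cofreeSnd_gen V Y)).symm }

/-- The universal colinear map from the cofree coalgebra to the comodule. -/
def cofreeCounit : (toComod C).obj (Over.mk (cofreeHom V)) ⟶ V :=
  ofLin (V := (toComod C).obj (Over.mk (cofreeHom V))) (cofreeFst V) (by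
    refine genSub_hom_ext (θ := fun i => wordMap (cofreeData V i)) fun Y => ?_
    -- Colinearity of a, for the comodule of a coalgebra map b, is the equation ρ_V a = (a ⊗ b)Δ; in
    -- this form it transfers from the generators Y to their span.
    have e {D : Type u} [AddCommGroup D] [Module k D] (a : D →ₗ[k] V.carrier) (b : D →ₗ[k] C.obj) :
        a.rTensor C.obj ∘ₗ b.lTensor D = TensorProduct.map a b := by
      ext; simp
    refine (congrArg (V.coact ∘ₗ ·) (cofreeFst_gen V Y)).trans ?_
    refine (toLin_comm Y.hom).trans ?_
    refine (congrArg (· ∘ₗ Coalgebra.comul (R := k) (A := Y.left.left.obj))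
      (e (toLin Y.hom) (Coalg.lin Y.left.hom))).trans ?_
    refine (congrArg₂ (fun a b => TensorProduct.map a b ∘ₗ
      Coalgebra.comul (R := k) (A := Y.left.left.obj)) (cofreeFst_gen V Y).symm
      (cofreeSnd_gen V Y).symm).trans ?_
    refine (map_comul_gen V (cofreeFst V) (cofreeSnd V) Y).symm.trans ?_
    exact congrArg (fun t => (t ∘ₗ Coalgebra.comul (R := k) (A := (cofreeCoalg V).obj)) ∘ₗ
      wordGen (cofreeData V) Y) (e (cofreeFst V) (cofreeSnd V)).symm)

/-- The cofree coalgebra as an object of the comma category. -/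
def cofreeArrow : CostructuredArrow (toComod C) V := CostructuredArrow.mk (cofreeCounit V)

/-- The universal property of the cofree coalgebra: existence. -/
def toCofree (Y : CostructuredArrow (toComod C) V) : Y ⟶ cofreeArrow V :=
  CostructuredArrow.homMk (Over.homMk (V := Over.mk (cofreeHom V))
    (Coalg.ofHom (D := cofreeCoalg V) (wordHom (cofreeData V) Y))
    (Coalg.hom_ext fun x => LinearMap.congr_fun (cofreeSnd_gen V Y) x))
    (hom_ext (cofreeFst_gen V Y))

/-- The two commuting triangles fix the components of m in V and in C, hence its composite with
`wordProj`; `wordMap_wordProj` then recovers m. -/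
lemma eq_toCofree (Y : CostructuredArrow (toComod C) V) (m : Y ⟶ cofreeArrow V) :
    m = toCofree V Y := by
  apply CostructuredArrow.hom_ext
  apply Over.OverMorphism.ext
  apply Coalg.hom_ext
  intro x
  have h1 : cofreeFst V ∘ₗ Coalg.lin m.left.left = toLin Y.hom :=
    congrArg toLin (CostructuredArrow.w m)
  have h2 : cofreeSnd V ∘ₗ Coalg.lin m.left.left = Coalg.lin Y.left.hom :=
    congrArg Coalg.lin (Over.w m.left)
  have h3 : wordProj (cofreeData V) ∘ₗ Coalg.lin m.left.left = cofreeData V Y := by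
    apply LinearMap.ext
    intro y
    exact Prod.ext (LinearMap.congr_fun h1 y) (LinearMap.congr_fun h2 y)
  have h4 := wordMap_comp (wordProj (cofreeData V)) (Coalg.toHom m.left.left)
  rw [wordMap_wordProj] at h4
  refine Subtype.ext ((LinearMap.congr_fun h4 x).trans ?_)
  exact LinearMap.congr_fun (congrArg wordMap h3) x

/-- The cofree coalgebras are terminal in the comma categories. The family of all coalgebras over C
mapping to V is large, but its images span a subspace of one fixed function space. -/
theorem toComod_isLeftAdjoint (C : Coalg k) : (toComod C).IsLeftAdjoint := by
  have (V : Comod k C.obj) : HasTerminal (CostructuredArrow (toComod C) V) :=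
    (IsTerminal.ofUniqueHom (toCofree V) (eq_toCofree V)).hasTerminal
  exact isLeftAdjoint_of_costructuredArrowTerminals (toComod C)

end Cofree

/-! ### Comodules as modules over the free algebra on the dual -/

section DualAction

open Comod

variable {k : Type u} [Field k] {C : Type u} [AddCommGroup C] [Module k C]

/-- Functionals separate the points of C, hence, applied to the C-leg, those of M ⊗ C. A coaction is
therefore determined by the action of the functionals. -/
lemma eq_of_forall_dual_lTensor {M : Type u} [AddCommGroup M] [Module k M] {z z' : M ⊗[k] C}
    (h : ∀ a : Module.Dual k C, TensorProduct.rid k M (a.lTensor M z) =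
      TensorProduct.rid k M (a.lTensor M z')) : z = z' := by
  rw [← sub_eq_zero]
  apply (TensorProduct.comm k M C).injective
  rw [map_zero]
  refine eq_zero_of_forall_rTensor (W := k) (fun a : Module.Dual k C => a)
    (fun m hm => (Module.forall_dual_apply_eq_zero_iff k m).mp hm) _ fun a => ?_
  have e : (TensorProduct.comm k M k).toLinearMap ∘ₗ a.lTensor M =
      a.rTensor M ∘ₗ (TensorProduct.comm k M C).toLinearMap := by
    ext; simp
  refine (LinearMap.congr_fun e (z - z')).symm.trans ?_
  have h1 := (TensorProduct.rid k M).injective (h a)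
  rw [LinearMap.comp_apply, map_sub, h1, sub_self, map_zero]

/-- By exactness of the tensor product it suffices that z vanishes in (M/N) ⊗ C, which functionals
on C detect. -/
lemma mem_range_rTensor_of_dual {M : Type u} [AddCommGroup M] [Module k M] (N : Submodule k M)
    (z : M ⊗[k] C)
    (h : ∀ a : Module.Dual k C, TensorProduct.rid k M (a.lTensor M z) ∈ N) :
    z ∈ LinearMap.range (N.subtype.rTensor C) := by
  refine (rTensor_exact C (LinearMap.exact_subtype_mkQ N) N.mkQ_surjective z).mp ?_
  refine eq_of_forall_dual_lTensor fun a => ?_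
  have e : (TensorProduct.rid k (M ⧸ N)).toLinearMap ∘ₗ a.lTensor (M ⧸ N) ∘ₗ N.mkQ.rTensor C =
      N.mkQ ∘ₗ (TensorProduct.rid k M).toLinearMap ∘ₗ a.lTensor M := by
    ext; simp
  refine (LinearMap.congr_fun e z).trans ?_
  rw [map_zero, map_zero]
  exact (Submodule.Quotient.mk_eq_zero N).mpr (h a)

variable [Coalgebra k C]

/-- The action of the functionals on the coalgebra on a comodule. -/
def dualAct (V : Comod k C) (a : Module.Dual k C) : Module.End k V.carrier :=
  (TensorProduct.rid k V.carrier).toLinearMap ∘ₗ a.lTensor V.carrier ∘ₗ V.coact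

lemma dualAct_toLin {V W : Comod k C} (f : V ⟶ W) (a : Module.Dual k C) (v : V.carrier) :
    dualAct W a (toLin f v) = toLin f (dualAct V a v) := by
  have e : (TensorProduct.rid k W.carrier).toLinearMap ∘ₗ a.lTensor W.carrier ∘ₗ
      (toLin f).rTensor C = toLin f ∘ₗ (TensorProduct.rid k V.carrier).toLinearMap ∘ₗ
        a.lTensor V.carrier := by
    ext; simp
  have h := LinearMap.congr_fun e (V.coact v)
  simp only [LinearMap.comp_apply, ← toLin_comm_apply] at h
  exact h

/-- With `dualAct_toLin`, this makes colinear maps the same as maps commuting with all functionals.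
The free algebra therefore captures them without any relations. -/
lemma colinear_of_dualAct {V W : Comod k C} (g : V.carrier →ₗ[k] W.carrier)
    (h : ∀ a v, dualAct W a (g v) = g (dualAct V a v)) :
    W.coact ∘ₗ g = g.rTensor C ∘ₗ V.coact := by
  apply LinearMap.ext
  intro v
  refine eq_of_forall_dual_lTensor fun a => (h a v).trans ?_
  have e : (TensorProduct.rid k W.carrier).toLinearMap ∘ₗ a.lTensor W.carrier ∘ₗ
      g.rTensor C = g ∘ₗ (TensorProduct.rid k V.carrier).toLinearMap ∘ₗ
        a.lTensor V.carrier := by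
    ext; simp
  exact (LinearMap.congr_fun e (V.coact v)).symm

variable (k C) in
/-- The free algebra on the functionals on a coalgebra. -/
abbrev DualAlg : Type u := FreeAlgebra k (Module.Dual k C)

/-- The action of the free algebra on the functionals on a comodule. -/
def dualHom (V : Comod k C) : DualAlg k C →ₐ[k] Module.End k V.carrier :=
  FreeAlgebra.lift k (dualAct V)

/-- A comodule as a module over the free algebra on the functionals. -/
def DualMod (V : Comod k C) : Type u := V.carrier

instance (V : Comod k C) : AddCommGroup (DualMod V) := inferInstanceAs (AddCommGroup V.carrier)

instance (V : Comod k C) : Module k (DualMod V) := inferInstanceAs (Module k V.carrier)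

instance (V : Comod k C) : Module (DualAlg k C) (DualMod V) :=
  Module.compHom V.carrier (dualHom V).toRingHom

lemma dualAlg_smul (V : Comod k C) (x : DualAlg k C) (v : DualMod V) : x • v = dualHom V x v := rfl

lemma ι_smul (V : Comod k C) (a : Module.Dual k C) (v : DualMod V) :
    FreeAlgebra.ι k a • v = dualAct V a v := by
  rw [dualAlg_smul, dualHom, FreeAlgebra.lift_ι_apply]

instance (V : Comod k C) : IsScalarTower k (DualAlg k C) (DualMod V) where
  smul_assoc c x v := by
    rw [dualAlg_smul, dualAlg_smul, map_smul]
    rfl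

lemma dualHom_toLin {V W : Comod k C} (f : V ⟶ W) (x : DualAlg k C) (v : V.carrier) :
    dualHom W x (toLin f v) = toLin f (dualHom V x v) := by
  induction x using FreeAlgebra.induction generalizing v with
  | grade0 c => simp
  | grade1 a => simp only [dualHom, FreeAlgebra.lift_ι_apply, dualAct_toLin]
  | mul x y hx hy => rw [map_mul, map_mul, Module.End.mul_apply, Module.End.mul_apply, hy, hx]
  | add x y hx hy =>
    rw [map_add, map_add, LinearMap.add_apply, LinearMap.add_apply, hx, hy, map_add]

/-- A colinear map is linear for the action of the functionals. -/
def toDualHom {V W : Comod k C} (f : V ⟶ W) : DualMod V →ₗ[DualAlg k C] DualMod W where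
  toFun := toLin f
  map_add' := map_add (toLin f)
  map_smul' x v := (dualHom_toLin f x v).symm

/-- A map that is linear for the action of the functionals is colinear. -/
def ofDualHom {V W : Comod k C} (g : DualMod V →ₗ[DualAlg k C] DualMod W) : V ⟶ W :=
  ofLin (g.restrictScalars k) (colinear_of_dualAct _ fun a v =>
    (ι_smul W a (g v)).symm.trans ((g.map_smul (FreeAlgebra.ι k a) v).symm.trans
      (congrArg g (ι_smul V a v))))

/-- In a semisimple module the identity of V extends along the injection i, and the resulting linear
map over the free algebra is colinear. -/
lemma exists_retraction {V M : Comod k C} [IsSemisimpleModule (DualAlg k C) (DualMod M)] (i : V ⟶ M)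
    (hi : Function.Injective (toLin i)) : ∃ r : M ⟶ V, i ≫ r = 𝟙 V := by
  obtain ⟨g, hg⟩ := IsSemisimpleModule.extension_property (toDualHom i) hi LinearMap.id
  exact ⟨ofDualHom g, hom_ext (LinearMap.ext fun v => LinearMap.congr_fun hg v)⟩

lemma isSemisimple_of_span {J : Type*} {N : J → Comod k C} {M : Comod k C} (f : ∀ j, N j ⟶ M)
    (hN : ∀ j, IsSemisimpleModule (DualAlg k C) (DualMod (N j)))
    (h : ⨆ j, LinearMap.range (toLin (f j)) = ⊤) :
    IsSemisimpleModule (DualAlg k C) (DualMod M) := by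
  refine isSemisimpleModule_of_isSemisimpleModule_submodule'
    (p := fun j => LinearMap.range (toDualHom (f j))) (fun j => ?_) ?_
  · have := hN j
    exact IsSemisimpleModule.range _
  have hle : (⊤ : Submodule k M.carrier) ≤
      (⨆ j, LinearMap.range (toDualHom (f j))).restrictScalars k := by
    rw [← h]
    refine iSup_le fun j => ?_
    rintro _ ⟨x, rfl⟩
    exact (le_iSup (fun j => LinearMap.range (toDualHom (f j))) j) ⟨x, rfl⟩
  exact eq_top_iff.mpr fun x _ => hle trivial

/-- The coaction involves only W, so V ⊗ W is the sum of the images of W under the colinear maps w ↦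
v ⊗ w. -/
lemma isSemisimple_tmul (V : Type u) [AddCommGroup V] [Module k V] (W : Comod k C)
    [IsSemisimpleModule (DualAlg k C) (DualMod W)] :
    IsSemisimpleModule (DualAlg k C) (DualMod (tmul V W)) := by
  refine isSemisimple_of_span (N := fun _ : V => W) (fun v => ofLin (W := tmul V W)
    (TensorProduct.mk k V W.carrier v) ?_) (fun _ => inferInstance) ?_
  · apply LinearMap.ext
    intro w
    have e : (TensorProduct.assoc k V W.carrier C).symm.toLinearMap ∘ₗ
        TensorProduct.mk k V (W.carrier ⊗[k] C) v =
        (TensorProduct.mk k V W.carrier v).rTensor C := by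
      ext; simp
    exact LinearMap.congr_fun e (W.coact w)
  · rw [eq_top_iff, ← TensorProduct.span_tmul_eq_top, Submodule.span_le]
    rintro _ ⟨v, w, rfl⟩
    exact le_iSup (fun v => LinearMap.range (TensorProduct.mk k V W.carrier v)) v ⟨w, rfl⟩

/-- The coaction as a map to a cofree comodule. -/
def coactHom (V : Comod k C) : V ⟶ tmul V.carrier (regular k C) :=
  ofLin (W := tmul V.carrier (regular k C)) V.coact (by
    apply LinearMap.ext
    intro v
    apply (TensorProduct.assoc k V.carrier C C).injective
    exact ((TensorProduct.assoc k V.carrier C C).apply_symm_apply _).trans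
      (V.coassoc_apply v).symm)

lemma coact_injective (V : Comod k C) : Function.Injective V.coact :=
  Function.LeftInverse.injective (g := fun z => TensorProduct.rid k V.carrier
    ((Coalgebra.counit (R := k) (A := C)).lTensor V.carrier z)) V.counit_apply

/-- A subcoalgebra is stable under the action of the functionals. -/
lemma dualAct_mem_of_isSubcoalgebra {N : Submodule k C} (hN : IsSubcoalgebra N)
    (a : Module.Dual k C) {x : C} (hx : x ∈ N) : dualAct (regular k C) a x ∈ N := by
  obtain ⟨y, hy⟩ := hN x hx
  have e : (TensorProduct.rid k C).toLinearMap ∘ₗ a.lTensor C ∘ₗ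
      TensorProduct.map N.subtype N.subtype = N.subtype ∘ₗ (TensorProduct.rid k N).toLinearMap ∘ₗ
        (a ∘ₗ N.subtype).lTensor N := by
    ext; simp
  have h := LinearMap.congr_fun e y
  rw [LinearMap.comp_apply, LinearMap.comp_apply, hy] at h
  exact h ▸ Subtype.property _

lemma dualHom_mem_of_isSubcoalgebra {N : Submodule k C} (hN : IsSubcoalgebra N)
    (x : DualAlg k C) {v : C} (hv : v ∈ N) : dualHom (regular k C) x v ∈ N := by
  induction x using FreeAlgebra.induction generalizing v with
  | grade0 c =>
    rw [AlgHom.commutes]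
    exact N.smul_mem c hv
  | grade1 a =>
    rw [dualHom, FreeAlgebra.lift_ι_apply]
    exact dualAct_mem_of_isSubcoalgebra hN a hv
  | mul x y hx hy =>
    rw [map_mul]
    exact hx (hy hv)
  | add x y hx hy =>
    rw [map_add]
    exact N.add_mem (hx hv) (hy hv)

end DualAction

/-! ### Cosemisimple coalgebras and splitting of coactions -/

section Cosemisimple

open Comod

variable {k : Type u} [Field k] {C : Type u} [AddCommGroup C] [Module k C] [Coalgebra k C]
  [Coalgebra.IsCocomm k C]

/-- A subspace that is stable under the action of the functionals is a subcoalgebra. -/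
lemma isSubcoalgebra_of_dualAct (N : Submodule k C)
    (h : ∀ a, ∀ x ∈ N, dualAct (regular k C) a x ∈ N) : IsSubcoalgebra N := by
  intro x hx
  -- Stability under the functionals gives Δx ∈ N ⊗ C.
  obtain ⟨y, hy⟩ := mem_range_rTensor_of_dual N (Coalgebra.comul x) fun a => h a x hx
  have e1 : (TensorProduct.comm k C C).toLinearMap ∘ₗ N.subtype.lTensor C =
      N.subtype.rTensor C ∘ₗ (TensorProduct.comm k C N).toLinearMap := by
    ext; simp
  -- Cocommutativity gives Δx ∈ C ⊗ N as well, so its image in C ⊗ (C/N) vanishes; the image of y in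
  -- N ⊗ (C/N) injects there.
  have hz : N.mkQ.lTensor N y = 0 := by
    apply Module.Flat.rTensor_preserves_injective_linearMap (M := C ⧸ N) N.subtype
      N.injective_subtype
    have e2 : N.subtype.rTensor (C ⧸ N) ∘ₗ N.mkQ.lTensor N =
        N.mkQ.lTensor C ∘ₗ N.subtype.rTensor C := by
      ext; simp
    refine (LinearMap.congr_fun e2 y).trans ?_
    rw [LinearMap.comp_apply, hy, map_zero]
    refine (lTensor_exact C (LinearMap.exact_subtype_mkQ N) N.mkQ_surjective _).mpr ?_
    refine ⟨TensorProduct.comm k N C y, ?_⟩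
    apply (TensorProduct.comm k C C).injective
    have h1 := LinearMap.congr_fun e1 (TensorProduct.comm k N C y)
    simp only [LinearMap.comp_apply, LinearEquiv.coe_coe] at h1
    rw [h1, Coalgebra.comm_comul, ← hy]
    congr 1
    exact (TensorProduct.comm k N C).symm_apply_apply y
  obtain ⟨w, hw⟩ := (lTensor_exact N (LinearMap.exact_subtype_mkQ N) N.mkQ_surjective y).mp hz
  refine ⟨w, ?_⟩
  have e3 : TensorProduct.map N.subtype N.subtype = N.subtype.rTensor C ∘ₗ N.subtype.lTensor N := by
    ext; simp
  rw [e3, LinearMap.comp_apply, hw, hy]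

/-- A subcoalgebra as a submodule for the action of the functionals. -/
def dualSubmodule {N : Submodule k C} (hN : IsSubcoalgebra N) :
    Submodule (DualAlg k C) (DualMod (regular k C)) where
  carrier := (N : Set C)
  add_mem' := N.add_mem
  zero_mem' := N.zero_mem
  smul_mem' x _ hv := dualHom_mem_of_isSubcoalgebra hN x hv

/-- The subspace underlying a submodule for the action of the functionals. -/
def dualRestrict (T : Submodule (DualAlg k C) (DualMod (regular k C))) : Submodule k C :=
  T.restrictScalars k

lemma isSubcoalgebra_dualRestrict (T : Submodule (DualAlg k C) (DualMod (regular k C))) :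
    IsSubcoalgebra (dualRestrict T) :=
  isSubcoalgebra_of_dualAct _ fun a x hx =>
    (congrArg (· ∈ T) (ι_smul (regular k C) a x)).mp (T.smul_mem (FreeAlgebra.ι k a) hx)

/-- In the cocommutative case, submodules of C for the dual action are exactly subcoalgebras, so a
simple subcoalgebra is a minimal nonzero submodule. -/
lemma isAtom_dualSubmodule {N : Submodule k C} (hN : IsSimpleSubcoalgebra N) :
    IsAtom (dualSubmodule hN.1) := by
  refine ⟨fun h => hN.2.1 ?_, fun T hT => ?_⟩
  · refine (Submodule.eq_bot_iff _).mpr fun x (hx : x ∈ dualSubmodule hN.1) => ?_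
    rw [h] at hx
    exact (Submodule.mem_bot (R := DualAlg k C) (M := DualMod (regular k C))).mp hx
  · rcases hN.2.2 (dualRestrict T) (isSubcoalgebra_dualRestrict T) hT.le with h | h
    · refine (Submodule.eq_bot_iff _).mpr fun x (hx : x ∈ dualRestrict T) => ?_
      rw [h] at hx
      exact (Submodule.mem_bot (R := k) (M := C)).mp hx
    · refine absurd (fun x (hx : x ∈ N) => ?_) (not_le_of_gt hT)
      rw [← h] at hx
      exact hx

/-- A cosemisimple cocommutative coalgebra is a semisimple comodule over itself. -/
lemma isSemisimple_regular (hC : IsCosemisimple k C) :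
    IsSemisimpleModule (DualAlg k C) (DualMod (regular k C)) := by
  obtain ⟨I, _, S, hS, hint⟩ := hC
  refine isSemisimpleModule_of_isSemisimpleModule_submodule'
    (p := fun i => dualSubmodule (hS i).1) (fun i => ?_) ?_
  · have := isSimpleModule_iff_isAtom.mpr (isAtom_dualSubmodule (hS i))
    infer_instance
  · have hle : (⊤ : Submodule k C) ≤
        dualRestrict (⨆ i, dualSubmodule (hS i).1) := by
      rw [← hint.submodule_iSup_eq_top]
      exact iSup_le fun i x hx => (le_iSup (fun i => dualSubmodule (hS i).1) i :) hx
    exact eq_top_iff.mpr fun x _ => hle trivial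

/-- Every comodule over a cosemisimple cocommutative coalgebra is a retract of a cofree one. -/
lemma exists_coact_retraction (hC : IsCosemisimple k C) (V : Comod k C) :
    ∃ r : tmul V.carrier (regular k C) ⟶ V, coactHom V ≫ r = 𝟙 V := by
  have := isSemisimple_regular hC
  have := isSemisimple_tmul V.carrier (regular k C)
  exact exists_retraction (coactHom V) (coact_injective V)

end Cosemisimple

/-! ### Comodules spanned by images of comodules -/

section GeneratedComodule

variable {k : Type u} [Field k] {C : Type u} [AddCommGroup C] [Module k C] [Coalgebra k C]
  {P : Type u} [AddCommGroup P] [Module k P] {I : Type*} {X : I → Comod k C}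
  {θ : ∀ i, (X i).carrier →ₗ[k] P}

/-- A comodule structure on a space spanned by images of comodules. -/
@[reducible] def genComod (δ : genSub θ →ₗ[k] genSub θ ⊗[k] C)
    (hδ : ∀ i, δ ∘ₗ genMap θ i = (genMap θ i).rTensor C ∘ₗ (X i).coact) : Comod k C where
  carrier := genSub θ
  coact := δ
  coassoc := by
    apply genSub_hom_ext
    intro i
    have h1 : (TensorProduct.assoc k (genSub θ) C C).toLinearMap ∘ₗ δ.rTensor C ∘ₗ
        (genMap θ i).rTensor C = (genMap θ i).rTensor (C ⊗[k] C) ∘ₗ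
          (TensorProduct.assoc k (X i).carrier C C).toLinearMap ∘ₗ (X i).coact.rTensor C := by
      rw [← LinearMap.rTensor_comp, hδ, LinearMap.rTensor_comp, ← LinearMap.comp_assoc,
        ← LinearMap.comp_assoc]
      congr 1
      ext; simp
    have h2 : (Coalgebra.comul (R := k) (A := C)).lTensor (genSub θ) ∘ₗ (genMap θ i).rTensor C =
        (genMap θ i).rTensor (C ⊗[k] C) ∘ₗ
          (Coalgebra.comul (R := k) (A := C)).lTensor (X i).carrier := by
      ext; simp
    apply LinearMap.ext
    intro x
    have e := LinearMap.congr_fun (hδ i) x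
    have e1 := LinearMap.congr_fun h1 ((X i).coact x)
    have e2 := LinearMap.congr_fun h2 ((X i).coact x)
    simp only [LinearMap.comp_apply, LinearEquiv.coe_coe] at e e1 e2 ⊢
    rw [e, e1, e2, Comod.coassoc_apply]
  counit := by
    apply genSub_hom_ext
    intro i
    have h1 : (TensorProduct.rid k (genSub θ)).toLinearMap ∘ₗ
        (Coalgebra.counit (R := k) (A := C)).lTensor (genSub θ) ∘ₗ (genMap θ i).rTensor C =
        genMap θ i ∘ₗ (TensorProduct.rid k (X i).carrier).toLinearMap ∘ₗ
          (Coalgebra.counit (R := k) (A := C)).lTensor (X i).carrier := by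
      ext; simp
    apply LinearMap.ext
    intro x
    have e := LinearMap.congr_fun (hδ i) x
    have e1 := LinearMap.congr_fun h1 ((X i).coact x)
    simp only [LinearMap.comp_apply, LinearEquiv.coe_coe] at e e1 ⊢
    rw [e, e1, Comod.counit_apply]
    rfl

end GeneratedComodule

/-! ### V □ X as a natural retract of V ⊗ X -/

section TensorRetraction

open Comod

variable {k : Type u} [Field k] {C : Type u} [AddCommGroup C] [Module k C] [Coalgebra k C]
  [Coalgebra.IsCocomm k C] {V : Comod k C} (r : tmul V.carrier (regular k C) ⟶ V)

/-- The map `v ⊗ x ↦ r(v ⊗ x₋₁) ⊗ x₀` of `V ⊗ X`. -/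
def tensorProj (X : Comod k C) : V.carrier ⊗[k] X.carrier →ₗ[k] V.carrier ⊗[k] X.carrier :=
  (toLin r).rTensor X.carrier ∘ₗ (TensorProduct.assoc k V.carrier C X.carrier).symm.toLinearMap ∘ₗ
    X.lcoact.lTensor V.carrier

/-- Colinearity of r and coassociativity of X make both sides r(v ⊗ x₋₂) ⊗ x₋₁ ⊗ x₀. -/
lemma tensorProj_mem (X : Comod k C) :
    (TensorProduct.assoc k V.carrier C X.carrier).toLinearMap ∘ₗ
      V.coact.rTensor X.carrier ∘ₗ tensorProj r X =
    X.lcoact.lTensor V.carrier ∘ₗ tensorProj r X := by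
  have e1 : (TensorProduct.assoc k V.carrier C X.carrier).toLinearMap ∘ₗ
      V.coact.rTensor X.carrier ∘ₗ (toLin r).rTensor X.carrier ∘ₗ
      (TensorProduct.assoc k V.carrier C X.carrier).symm.toLinearMap =
      (toLin r).rTensor (C ⊗[k] X.carrier) ∘ₗ
      (TensorProduct.assoc k V.carrier C (C ⊗[k] X.carrier)).symm.toLinearMap ∘ₗ
      ((TensorProduct.assoc k C C X.carrier).toLinearMap ∘ₗ
        (Coalgebra.comul (R := k) (A := C)).rTensor X.carrier).lTensor V.carrier := by
    ext v c x
    have h := toLin_comm_apply r (v ⊗ₜ c)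
    obtain ⟨s, hs⟩ := TensorProduct.exists_finset (Coalgebra.comul (R := k) c)
    simp [h, hs, TensorProduct.tmul_sum, TensorProduct.sum_tmul]
  have e2 : X.lcoact.lTensor V.carrier ∘ₗ (toLin r).rTensor X.carrier ∘ₗ
      (TensorProduct.assoc k V.carrier C X.carrier).symm.toLinearMap =
      (toLin r).rTensor (C ⊗[k] X.carrier) ∘ₗ
      (TensorProduct.assoc k V.carrier C (C ⊗[k] X.carrier)).symm.toLinearMap ∘ₗ
      (X.lcoact.lTensor C).lTensor V.carrier := by
    ext; simp
  apply LinearMap.ext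
  intro z
  have h1 := LinearMap.congr_fun e1 (X.lcoact.lTensor V.carrier z)
  have h2 := LinearMap.congr_fun e2 (X.lcoact.lTensor V.carrier z)
  refine h1.trans (Eq.trans ?_ h2.symm)
  simp only [LinearMap.comp_apply, ← LinearMap.lTensor_comp_apply]
  rw [← lcoact_coassoc, LinearMap.comp_assoc]

/-- The retraction of the tensor product to the cotensor product. -/
def tensorRetract (X : Comod k C) : tmul V.carrier X ⟶ cten V X :=
  ofLin (V := tmul V.carrier X) (cotensorLift V X X.isBicomod_lcoact (tensorProj r X)
      (tensorProj_mem r X))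
    (cotensor_colinear V X X.isBicomod_lcoact (Z := tmul V.carrier X) _ (by
      rw [cotensorIncl_lift]
      have e1 : (TensorProduct.assoc k V.carrier X.carrier C).symm.toLinearMap ∘ₗ
          X.coact.lTensor V.carrier ∘ₗ (toLin r).rTensor X.carrier ∘ₗ
          (TensorProduct.assoc k V.carrier C X.carrier).symm.toLinearMap =
          ((toLin r).rTensor X.carrier ∘ₗ
            (TensorProduct.assoc k V.carrier C X.carrier).symm.toLinearMap).rTensor C ∘ₗ
          (TensorProduct.assoc k V.carrier (C ⊗[k] X.carrier) C).symm.toLinearMap ∘ₗ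
          ((TensorProduct.assoc k C X.carrier C).symm.toLinearMap ∘ₗ
            X.coact.lTensor C).lTensor V.carrier := by
        ext v c x
        obtain ⟨s, hs⟩ := TensorProduct.exists_finset (X.coact x)
        simp [hs, TensorProduct.tmul_sum]
      have e2 : (X.lcoact.lTensor V.carrier).rTensor C ∘ₗ
          (TensorProduct.assoc k V.carrier X.carrier C).symm.toLinearMap =
          (TensorProduct.assoc k V.carrier (C ⊗[k] X.carrier) C).symm.toLinearMap ∘ₗ
          (X.lcoact.rTensor C).lTensor V.carrier := by
        ext; simp
      have e3 : (TensorProduct.assoc k C X.carrier C).symm.toLinearMap ∘ₗ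
          X.coact.lTensor C ∘ₗ X.lcoact = X.lcoact.rTensor C ∘ₗ X.coact := by
        rw [← X.isBicomod_lcoact]
        apply LinearMap.ext
        intro x
        exact (TensorProduct.assoc k C X.carrier C).symm_apply_apply _
      apply LinearMap.ext
      intro z
      have h1 := LinearMap.congr_fun e1 (X.lcoact.lTensor V.carrier z)
      have h2 := LinearMap.congr_fun e2 (X.coact.lTensor V.carrier z)
      have h3 := congrArg (fun t => t.lTensor V.carrier z) e3
      simp only [LinearMap.comp_apply, LinearEquiv.coe_coe, LinearMap.lTensor_comp,
        tensorProj, LinearMap.rTensor_comp] at h1 h2 h3 ⊢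
      rw [h1, h2, h3]))

lemma incl_tensorRetract (X : Comod k C) (z : V.carrier ⊗[k] X.carrier) :
    incl V X (toLin (tensorRetract r X) z) = tensorProj r X z := rfl

variable {r} in
-- On the cotensor product v ⊗ x₋₁ ⊗ x₀ equals ρ(v) ⊗ x, and r undoes ρ.
lemma tensorRetract_incl (hr : coactHom V ≫ r = 𝟙 V) (X : Comod k C) (z : (cten V X).carrier) :
    toLin (tensorRetract r X) (incl V X z) = z := by
  apply incl_injective
  have e : (toLin r).rTensor X.carrier ∘ₗ V.coact.rTensor X.carrier = LinearMap.id := by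
    have hr' : toLin r ∘ₗ V.coact = LinearMap.id := congrArg toLin hr
    rw [← LinearMap.rTensor_comp, hr', LinearMap.rTensor_id]
  rw [incl_tensorRetract, tensorProj, LinearMap.comp_apply, LinearMap.comp_apply, ← incl_eq]
  refine Eq.trans ?_ (LinearMap.congr_fun e (incl V X z))
  exact congrArg _ ((TensorProduct.assoc k V.carrier C X.carrier).symm_apply_apply _)

lemma tensorRetract_natural {X Y : Comod k C} (g : X ⟶ Y) (z : V.carrier ⊗[k] X.carrier) :
    toLin (tensorRetract r Y) ((toLin g).lTensor V.carrier z) =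
      toLin (V ◁ g) (toLin (tensorRetract r X) z) := by
  apply incl_injective
  have e : (toLin r).rTensor Y.carrier ∘ₗ
      (TensorProduct.assoc k V.carrier C Y.carrier).symm.toLinearMap ∘ₗ
      ((toLin g).lTensor C).lTensor V.carrier = (toLin g).lTensor V.carrier ∘ₗ
      (toLin r).rTensor X.carrier ∘ₗ
      (TensorProduct.assoc k V.carrier C X.carrier).symm.toLinearMap := by
    ext; simp
  have h := LinearMap.congr_fun e (X.lcoact.lTensor V.carrier z)
  have h1 := congrArg (fun t => t.lTensor V.carrier z) (toLin_lcoact g)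
  simp only [LinearMap.comp_apply, LinearMap.lTensor_comp] at h h1
  have h2 : tensorProj r Y ((toLin g).lTensor V.carrier z) =
      (toLin g).lTensor V.carrier (tensorProj r X z) := by
    rw [tensorProj, LinearMap.comp_apply, LinearMap.comp_apply, h1]
    exact h
  exact h2

end TensorRetraction

/-! ### The internal hom inside Hom(V, W) -/

section InternalHom

open Comod

variable {k : Type u} [Field k] {C : Coalg k} {V : Comod k C.obj}
  (r : tmul V.carrier (regular k C.obj) ⟶ V) (W : Comod k C.obj)

/-- The linear map `X → Hom(V, W)` of a colinear map `V ⊗ X → W`. -/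
def homData (Y : CostructuredArrow (tensorLeft V) W) :
    Y.left.carrier →ₗ[k] V.carrier →ₗ[k] W.carrier :=
  (TensorProduct.curry (toLin Y.hom ∘ₗ toLin (tensorRetract r Y.left))).flip

/-- The space underlying the internal hom. -/
abbrev HomSpan := genSub (homData r W)

/-- Evaluation on the space underlying the internal hom. -/
def homEval : V.carrier ⊗[k] HomSpan r W →ₗ[k] W.carrier :=
  TensorProduct.lift (HomSpan r W).subtype.flip

lemma homEval_gen (Y : CostructuredArrow (tensorLeft V) W) (z : V.carrier ⊗[k] Y.left.carrier) :
    homEval r W ((genMap (homData r W) Y).lTensor V.carrier z) =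
      toLin Y.hom (toLin (tensorRetract r Y.left) z) := by
  have e : homEval r W ∘ₗ (genMap (homData r W) Y).lTensor V.carrier =
      toLin Y.hom ∘ₗ toLin (tensorRetract r Y.left) := by
    apply TensorProduct.ext'
    intro v x
    rfl
  exact LinearMap.congr_fun e z

/-- The inclusion of `T ⊗ C` in `Hom(V, W ⊗ C)`. -/
def homPair : HomSpan r W ⊗[k] C.obj →ₗ[k] V.carrier →ₗ[k] W.carrier ⊗[k] C.obj :=
  (TensorProduct.curry ((homEval r W).rTensor C.obj ∘ₗ
    (TensorProduct.assoc k V.carrier (HomSpan r W) C.obj).symm.toLinearMap)).flip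

/-- Evaluations at vectors of V separate the elements of the span T ⊆ Hom(V, W), hence they separate
T ⊗ C. A coaction on T is thus determined by what it does after evaluation. -/
lemma homPair_injective : Function.Injective (homPair r W) := by
  refine injective_of_forall (M := HomSpan r W ⊗[k] C.obj) (homPair r W) fun z hz => ?_
  refine eq_zero_of_forall_rTensor
    (fun v : V.carrier => homEval r W ∘ₗ TensorProduct.mk k V.carrier (HomSpan r W) v)
    (fun m hm => Subtype.ext (LinearMap.ext hm)) z fun v => ?_
  have e : (homEval r W ∘ₗ TensorProduct.mk k V.carrier (HomSpan r W) v).rTensor C.obj =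
      (homEval r W).rTensor C.obj ∘ₗ
      (TensorProduct.assoc k V.carrier (HomSpan r W) C.obj).symm.toLinearMap ∘ₗ
      TensorProduct.mk k V.carrier (HomSpan r W ⊗[k] C.obj) v := by
    ext; simp
  rw [e]
  exact LinearMap.congr_fun hz v

/-- The map V ⊗ X → V □ X → W is colinear for the coaction of X. So composing the map of x with ρ_W
amounts to coacting on x, and ρ_W ∘ (-) lands in T ⊗ C. -/
lemma homPair_gen (Y : CostructuredArrow (tensorLeft V) W) (x : Y.left.carrier) :
    homPair r W ((genMap (homData r W) Y).rTensor C.obj (Y.left.coact x)) =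
      W.coact ∘ₗ (genMap (homData r W) Y x : V.carrier →ₗ[k] W.carrier) := by
  apply LinearMap.ext
  intro v
  have e1 : (homEval r W).rTensor C.obj ∘ₗ
      (TensorProduct.assoc k V.carrier (HomSpan r W) C.obj).symm.toLinearMap ∘ₗ
      TensorProduct.mk k V.carrier (HomSpan r W ⊗[k] C.obj) v ∘ₗ
      (genMap (homData r W) Y).rTensor C.obj =
      (toLin Y.hom ∘ₗ toLin (tensorRetract r Y.left)).rTensor C.obj ∘ₗ
      (TensorProduct.assoc k V.carrier Y.left.carrier C.obj).symm.toLinearMap ∘ₗ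
      TensorProduct.mk k V.carrier (Y.left.carrier ⊗[k] C.obj) v := by
    apply TensorProduct.ext'
    intro x c
    rfl
  refine (LinearMap.congr_fun e1 (Y.left.coact x)).trans ?_
  exact (toLin_comm_apply (tensorRetract r Y.left ≫ Y.hom) (v ⊗ₜ x)).symm

/-- The coaction on the space underlying the internal hom. -/
def homCoact : HomSpan r W →ₗ[k] HomSpan r W ⊗[k] C.obj :=
  factorThrough (homPair r W) (homPair_injective r W)
    (LinearMap.llcomp k V.carrier W.carrier (W.carrier ⊗[k] C.obj) W.coact ∘ₗ
      (HomSpan r W).subtype)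
    (genSub_mem_range (homData r W) _ (homPair r W) fun Y x => ⟨_, homPair_gen r W Y x⟩)

lemma homPair_homCoact (t : HomSpan r W) : homPair r W (homCoact r W t) =
    W.coact ∘ₗ (t : V.carrier →ₗ[k] W.carrier) :=
  factorThrough_apply _ (homPair_injective r W) _ _ t

lemma homCoact_gen (Y : CostructuredArrow (tensorLeft V) W) :
    homCoact r W ∘ₗ genMap (homData r W) Y =
      (genMap (homData r W) Y).rTensor C.obj ∘ₗ Y.left.coact :=
  LinearMap.ext fun x => homPair_injective r W
    ((homPair_homCoact r W _).trans (homPair_gen r W Y x).symm)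

/-- The internal hom of comodules. -/
def homComod : Comod k C.obj := genComod (homCoact r W) (homCoact_gen r W)

/-- The evaluation on the tensor product of vector spaces is colinear. -/
def homEvalHom : tmul V.carrier (homComod r W) ⟶ W :=
  ofLin (V := tmul V.carrier (homComod r W)) (homEval r W) (by
    apply TensorProduct.ext'
    intro v t
    exact (LinearMap.congr_fun (homPair_homCoact r W t) v).symm)

/-- The evaluation of the internal hom. -/
def homEv : V ⊗ homComod r W ⟶ W :=
  ofLin (V := cten V (homComod r W)) (W := tmul V.carrier (homComod r W)) (incl V (homComod r W))
    (LinearMap.ext fun x => (incl_coact V (homComod r W) x).symm) ≫ homEvalHom r W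

/-- The internal hom as an object of the comma category. -/
def homArrow : CostructuredArrow (tensorLeft V) W := CostructuredArrow.mk (homEv r W)

/-- The map to the internal hom. -/
def toHomLeft (Y : CostructuredArrow (tensorLeft V) W) : Y.left ⟶ homComod r W :=
  ofLin (W := homComod r W) (genMap (homData r W) Y) (homCoact_gen r W Y)

variable {r}

/-- Evaluation on the image of X is the given map precomposed with the retraction, which is the
identity on V □ X. -/
lemma toHomLeft_ev (hr : coactHom V ≫ r = 𝟙 V) (Y : CostructuredArrow (tensorLeft V) W) :
    V ◁ toHomLeft r W Y ≫ homEv r W = Y.hom := by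
  apply hom_ext
  apply LinearMap.ext
  intro z
  refine (homEval_gen r W Y (incl V Y.left z)).trans ?_
  rw [tensorRetract_incl hr]

/-- On generators this is naturality of the retraction. It shows that evaluation on V ⊗ T is
determined by its restriction to V □ T, which gives uniqueness of maps into the internal hom. -/
lemma homEval_tensorRetract (hr : coactHom V ≫ r = 𝟙 V) (z : V.carrier ⊗[k] HomSpan r W) :
    toLin (homEv r W) (toLin (tensorRetract r (homComod r W)) z) = homEval r W z := by
  suffices h : (TensorProduct.curry (toLin (homEv r W) ∘ₗ
      toLin (tensorRetract r (homComod r W)))).flip = (TensorProduct.curry (homEval r W)).flip by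
    have h' : toLin (homEv r W) ∘ₗ toLin (tensorRetract r (homComod r W)) = homEval r W :=
      TensorProduct.ext' fun v t => LinearMap.congr_fun (LinearMap.congr_fun h t) v
    exact LinearMap.congr_fun h' z
  refine genSub_hom_ext (θ := homData r W) fun Y => ?_
  apply LinearMap.ext
  intro x
  apply LinearMap.ext
  intro v
  have h1 := congrArg (toLin (homEv r W)) (tensorRetract_natural r (toHomLeft r W Y) (v ⊗ₜ x))
  exact h1.trans (LinearMap.congr_fun (congrArg toLin (toHomLeft_ev W hr Y))
    (toLin (tensorRetract r Y.left) (v ⊗ₜ x)))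

end InternalHom

/-! ### The monoidal closed structure -/

section Closed

open Comod

variable {k : Type u} [Field k]

/-- A retraction of the coaction of V, supplied by cosemisimplicity, yields a terminal object in
each comma category of V □ (-), hence a right adjoint. -/
theorem nonempty_monoidalClosed (C : Coalg k) (hC : IsCosemisimple k C.obj) :
    Nonempty (MonoidalClosed (Comod k C.obj)) := by
  have h (V : Comod k C.obj) : (tensorLeft V).IsLeftAdjoint := by
    obtain ⟨r, hr⟩ := exists_coact_retraction hC V
    have (W : Comod k C.obj) : HasTerminal (CostructuredArrow (tensorLeft V) W) :=
      (IsTerminal.ofUniqueHom (Y := homArrow r W)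
        (fun Y => CostructuredArrow.homMk (toHomLeft r W Y) (toHomLeft_ev W hr Y))
        (fun Y m => by
          apply CostructuredArrow.hom_ext
          apply hom_ext
          apply LinearMap.ext
          intro x
          -- Elements of the internal hom are linear maps V → W. The value of m(x) at v is the
          -- evaluation of the retraction of v ⊗ m(x), which naturality and the triangle for m
          -- express through the given map alone.
          refine Subtype.ext (LinearMap.ext fun v => ?_)
          have h1 := homEval_tensorRetract W hr (v ⊗ₜ toLin m.left x)
          have h2 := congrArg (toLin (homEv r W)) (tensorRetract_natural r m.left (v ⊗ₜ x))
          have h3 := LinearMap.congr_fun (congrArg toLin (CostructuredArrow.w m))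
            (toLin (tensorRetract r Y.left) (v ⊗ₜ x))
          exact h1.symm.trans (h2.trans h3))).hasTerminal
    exact isLeftAdjoint_of_costructuredArrowTerminals (tensorLeft V)
  exact ⟨{ closed := fun V =>
    { rightAdj := (tensorLeft V).rightAdjoint
      adj := Adjunction.ofIsLeftAdjoint _ } }⟩

end Closed

/-! ### Assembling the adjunctions and the morphism -/

section Final

variable {k : Type u} [Field k]

/-- The linear-non-linear adjunction between coalgebras over `C` and `C`-comodules. -/
theorem nonempty_lnlAdjunction (C : Coalg k) (hC : IsCosemisimple k C.obj) :
    Nonempty (LNLAdjunction (toComod C)) := by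
  obtain ⟨closed⟩ := nonempty_monoidalClosed C hC
  obtain ⟨R, ⟨adj⟩⟩ := toComod_isLeftAdjoint C
  -- The right adjoint of a strong monoidal functor is lax monoidal, and the unit and counit are
  -- then monoidal.
  let _ := adj.rightAdjointLaxMonoidal
  exact ⟨{
    closed := closed
    R := R
    adj := adj
    laxU := inferInstance
    laxR := laxBraidedOfAdjunction adj fun X Y => by
      rw [← cancel_epi (Functor.LaxMonoidal.μ (toComod C) X Y),
        Functor.Monoidal.μ_δ_assoc, Functor.LaxBraided.braided_assoc, Functor.Monoidal.μ_δ,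
        Category.comp_id]
    unit_monoidal := inferInstance
    counit_monoidal := inferInstance }⟩

variable {C C' : Coalg k} (f : C' ⟶ C)

/-- The morphism of linear-non-linear adjunctions given by the pullback functors along `f`. -/
def pullbackLNLMorphism (A : LNLAdjunction (toComod C)) (A' : LNLAdjunction (toComod C')) :
    LNLMorphism A A' (Over.pullback f) (comodPullback f) where
  strong := comodPullbackBraided f
  closed V W :=
    letI := A.closed
    letI := A'.closed
    isIso_closedComparison (corestrictAdj f) V W
  cartesian := by
    -- Pullback along f is right adjoint to composition with f, so it preserves all limits, in
    -- particular finite products over C.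
    haveI := (Over.mapPullbackAdj f).rightAdjoint_preservesLimits
    exact ⟨fun _ => inferInstance⟩
  isoU := pullbackComparisonIso f
  isoR := conjugateIsoEquiv ((Over.mapPullbackAdj f).comp A.adj) (A'.adj.comp (corestrictAdj f))
    (mapComparisonIso f)
  unit_comp X := unit_comp_conjugate (Over.mapPullbackAdj f) (corestrictAdj f) A.adj A'.adj
    (mapComparisonIso f) (pullbackComparisonIso f) (comparison_compat f) X

lemma pullbackLNLMorphism_isCanonical (A : LNLAdjunction (toComod C))
    (A' : LNLAdjunction (toComod C')) : IsCanonical f (pullbackLNLMorphism f A A') where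
  tensorMap_eq := pullbackIncl_μ f
  unitMap_eq := pullbackIncl_ε f
  isoU_eq _ _ := rfl

end Final

end ComodLNL

end

theorem mainTheorem7 (k : Type u) [Field k] (C C' : Coalg k)
    (hC : IsCosemisimple k C.obj) (hC' : IsCosemisimple k C'.obj) (f : C' ⟶ C) :
    Nonempty (LNLAdjunction (toComod C)) ∧ Nonempty (LNLAdjunction (toComod C')) ∧
      ∀ (A : LNLAdjunction (toComod C)) (A' : LNLAdjunction (toComod C')),
        ∃ M : LNLMorphism A A' (Over.pullback f) (comodPullback f), IsCanonical f M := by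
  refine ⟨nonempty_lnlAdjunction C hC, nonempty_lnlAdjunction C' hC', fun A A' => ?_⟩
  exact ⟨pullbackLNLMorphism f A A', pullbackLNLMorphism_isCanonical f A A'⟩
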